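/- All functions are real-valued and Lebesgue measurable on $(0,\infty)$, and functions equal almost everywhere are identified. For such $f$, let $f^*(t)=\inf\{s\ge 0:|\{x:|f(x)|>s\}|\le t\}$ be the decreasing rearrangement, $f^{**}(t)=\frac1t\int_0^t f^*(s)\,ds$, and $Sf(t)=\frac1t\int_0^t f(r)\,dr$ the Hardy operator. A function $\varphi:(0,\infty)\to(0,\infty)$ is quasi-concave if $\varphi$ is increasing and $\varphi(t)/t$ is decreasing (both in the weak sense); put $\varphi(0)=0$ and $$\|f\|_{\Lambda_\varphi}=\int_{[0,\infty)}f^*\,d\varphi=\varphi(0+)\,f^*(0+)+\int_{(0,\infty)}f^*\,d\varphi,\qquad \Lambda_\varphi=\{f:\|f\|_{\Lambda_\varphi}<\infty\}.$$ An r.i. Banach function space is a space $Y=\{f:\rho(|f|)<\infty\}$ with $\|f\|_Y=\rho(|f|)$, where $\rho$ is a rearrangement invariant Banach function norm in the sense of Bennett and Sharpley: $\rho$ maps the measurable $[0,\infty]$-valued functions on $(0,\infty)$ to $[0,\infty]$; $\rho(f)=0$ iff $f=0$ a.e.; $\rho(af)=a\rho(f)$ for real $a\ge0$; $\rho(f+g)\le\rho(f)+\rho(g)$;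 $f\le g$ a.e. implies $\rho(f)\le\rho(g)$; $f_n\uparrow f$ a.e. implies $\rho(f_n)\uparrow\rho(f)$; if $|E|<\infty$ then $\rho(\chi_E)<\infty$ and $\int_E f\le C_E\,\rho(f)$ for all $f$, with a finite constant $C_E$; and $\rho(f)=\rho(g)$ whenever $f,g$ are equimeasurable. Let $\mathfrak R[S,\Lambda_\varphi]$ denote the minimal r.i. Banach function space $Y$ such that $S:\Lambda_\varphi\to Y$ is bounded (i.e. $\|Sf\|_Y\le C\|f\|_{\Lambda_\varphi}$ for all $f\in\Lambda_\varphi$), minimal meaning that $Y$ is contained in every other such space; if it exists, it is unique up to equivalence of norms. **Theorem 2.3.** Let $\varphi$ be quasi-concave. Then there is a constant $C>0$ with $$\varphi(t)\ge C\,t\log(1+1/t)\qquad\text{for all }t>0$$ if and only if the space $\mathfrak R[S,\Lambda_\varphi]$ exists. In this case $$X=\{f\in L^1+L^\infty:\ f^{**}\le (Sg)^{**}\text{ on }(0,\infty)\text{ for some decreasing }g\in\Lambda_\varphi\},$$ endowed with $$\|f\|_X=\inf\{\|g\|_{\Lambda_\varphi}:\ g\in\Lambda_\varphi\text{ decreasing},\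 f^{**}\le (Sg)^{**}\text{ on }(0,\infty)\},$$ is an r.i. Banach function space and is a minimal one for which $S:\Lambda_\varphi\to X$ is bounded; and every minimal such space coincides with $X$ as a set, with equivalent norms. -/

import Mathlib

open MeasureTheory Set
open scoped ENNReal NNReal

noncomputable section

namespace HardyRange

/-- Lebesgue measure on the half-line `(0, ∞)`. -/
def μ : Measure ℝ := volume.restrict (Ioi 0)

/-- Quasi-concave functions on `(0, ∞)` (only the values `φ t` for `t > 0` matter). -/
structure QuasiConcave (φ : ℝ → ℝ) : Prop where
  pos : ∀ t, 0 < t → 0 < φ t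
  mono : MonotoneOn φ (Ioi 0)
  anti : AntitoneOn (fun t => φ t / t) (Ioi 0)

/-- Extension of `φ` to the real line by `0` on `(-∞, 0]`. -/
def extendZero (φ : ℝ → ℝ) (t : ℝ) : ℝ := if 0 < t then φ t else 0

theorem QuasiConcave.monotone_extendZero {φ : ℝ → ℝ} (hφ : QuasiConcave φ) :
    Monotone (extendZero φ) := by
  intro s t hst
  unfold extendZero
  split_ifs with hs ht ht
  · exact hφ.mono hs ht hst
  · exact absurd (hs.trans_le hst) ht
  · exact (hφ.pos t ht).le
  · exact le_rfl

/-- The Lebesgue-Stieltjes measure `dφ` on `[0, ∞)`, with the convention `φ(0) = 0`: it has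
an atom of mass `φ(0+)` at the origin. -/
def QuasiConcave.dφ {φ : ℝ → ℝ} (hφ : QuasiConcave φ) : Measure ℝ :=
  hφ.monotone_extendZero.stieltjesFunction.measure

/-- The distribution function `s ↦ |{x > 0 : f x > s}|`. -/
def distr (f : ℝ → ℝ≥0∞) (s : ℝ≥0∞) : ℝ≥0∞ := μ {x | s < f x}

/-- The decreasing rearrangement `f*` (for `t ≥ 0`). -/
def rearr (f : ℝ → ℝ≥0∞) (t : ℝ) : ℝ≥0∞ :=
  sInf {s : ℝ≥0∞ | distr f s ≤ ENNReal.ofReal t}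

/-- The maximal function `f**(t) = (1/t) ∫₀ᵗ f*(s) ds` (for `t > 0`). -/
def maxRearr (f : ℝ → ℝ≥0∞) (t : ℝ) : ℝ≥0∞ :=
  (ENNReal.ofReal t)⁻¹ * ∫⁻ s in Ioc 0 t, rearr f s

/-- The absolute value of a real function, as a function with values in `[0, ∞]`. -/
def absFun (f : ℝ → ℝ) (x : ℝ) : ℝ≥0∞ := ‖f x‖ₑ

/-- `‖f‖_{Λ_φ} = ∫_{[0,∞)} f* dφ`. -/
def lorentzNorm {φ : ℝ → ℝ} (hφ : QuasiConcave φ) (f : ℝ → ℝ) : ℝ≥0∞ :=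
  ∫⁻ t, rearr (absFun f) t ∂hφ.dφ

/-- The minimal Lorentz space `Λ_φ`. -/
def lorentzSpace {φ : ℝ → ℝ} (hφ : QuasiConcave φ) : Set (ℝ → ℝ) :=
  {f | AEMeasurable f μ ∧ lorentzNorm hφ f < ∞}

/-- The Hardy operator `S f(t) = (1/t) ∫₀ᵗ f(r) dr`. -/
def hardy (f : ℝ → ℝ) (t : ℝ) : ℝ := (1 / t) * ∫ r in (0 : ℝ)..t, f r

/-- Rearrangement invariant Banach function norms over `(0, ∞)` in the sense of Bennett and
Sharpley, as functionals on the cone of `[0, ∞]`-valued measurable functions: the norm axioms,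
the lattice property, the Fatou property, finiteness on sets of finite measure, integrability
over sets of finite measure, and invariance under equimeasurability. -/
structure IsRIBanachFunctionNorm (ρ : (ℝ → ℝ≥0∞) → ℝ≥0∞) : Prop where
  eq_zero_iff : ∀ f, AEMeasurable f μ → (ρ f = 0 ↔ f =ᵐ[μ] 0)
  smul : ∀ (a : ℝ≥0) f, AEMeasurable f μ → ρ (fun x => (a : ℝ≥0∞) * f x) = a * ρ f
  add_le : ∀ f g, AEMeasurable f μ → AEMeasurable g μ →
    ρ (fun x => f x + g x) ≤ ρ f + ρ g
  mono : ∀ f g, AEMeasurable f μ → AEMeasurable g μ → (∀ᵐ x ∂μ, f x ≤ g x) → ρ f ≤ ρ g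
  fatou : ∀ f : ℕ → ℝ → ℝ≥0∞, (∀ n, AEMeasurable (f n) μ) →
    (∀ᵐ x ∂μ, Monotone fun n => f n x) → ρ (fun x => ⨆ n, f n x) = ⨆ n, ρ (f n)
  indicator_lt_top : ∀ E : Set ℝ, MeasurableSet E → μ E < ∞ →
    ρ (E.indicator fun _ => 1) < ∞
  lintegral_le : ∀ E : Set ℝ, MeasurableSet E → μ E < ∞ →
    ∃ C : ℝ≥0, ∀ f, AEMeasurable f μ → ∫⁻ x in E, f x ∂μ ≤ C * ρ f
  rearrangement_invariant : ∀ f g, AEMeasurable f μ → AEMeasurable g μ →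
    (∀ s, distr f s = distr g s) → ρ f = ρ g

/-- The function space `{f : ρ(|f|) < ∞}` generated by a function norm. -/
def functionSpace (ρ : (ℝ → ℝ≥0∞) → ℝ≥0∞) : Set (ℝ → ℝ) :=
  {f | AEMeasurable f μ ∧ ρ (absFun f) < ∞}

/-- `S` maps `Λ_φ` boundedly into the space generated by `ρ`. -/
def HardyBounded {φ : ℝ → ℝ} (hφ : QuasiConcave φ) (ρ : (ℝ → ℝ≥0∞) → ℝ≥0∞) : Prop :=
  ∃ C : ℝ≥0, ∀ f ∈ lorentzSpace hφ, ρ (absFun (hardy f)) ≤ C * lorentzNorm hφ f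

/-- `ρ` generates the minimal r.i. Banach function space `Y` such that `S : Λ_φ → Y` is
bounded, i.e. the smallest one with respect to inclusion. -/
structure IsMinimalRange {φ : ℝ → ℝ} (hφ : QuasiConcave φ) (ρ : (ℝ → ℝ≥0∞) → ℝ≥0∞) :
    Prop where
  isRI : IsRIBanachFunctionNorm ρ
  bounded : HardyBounded hφ ρ
  minimal : ∀ σ, IsRIBanachFunctionNorm σ → HardyBounded hφ σ →
    functionSpace ρ ⊆ functionSpace σ

/-- The space `L¹ + L^∞` over `(0, ∞)`. -/
def L1AddLinfty : Set (ℝ → ℝ) :=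
  {f | ∃ a b : ℝ → ℝ, MemLp a 1 μ ∧ MemLp b ∞ μ ∧ f =ᵐ[μ] a + b}

/-- The decreasing functions `g ∈ Λ_φ` with `f** ≤ (S g)**` on `(0, ∞)`. -/
def majorants {φ : ℝ → ℝ} (hφ : QuasiConcave φ) (f : ℝ → ℝ≥0∞) : Set (ℝ → ℝ) :=
  {g | AntitoneOn g (Ioi 0) ∧ g ∈ lorentzSpace hφ ∧
    ∀ t, 0 < t → maxRearr f t ≤ maxRearr (absFun (hardy g)) t}

/-- The space of all `f ∈ L¹ + L^∞` with `f** ≤ (S g)**` for some decreasing `g ∈ Λ_φ`. -/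
def rangeSpace {φ : ℝ → ℝ} (hφ : QuasiConcave φ) : Set (ℝ → ℝ) :=
  {f | f ∈ L1AddLinfty ∧ (majorants hφ (absFun f)).Nonempty}

/-- The norm `inf ‖g‖_{Λ_φ}` over the decreasing `g ∈ Λ_φ` with `f** ≤ (S g)**`, as a functional
on `[0, ∞]`-valued functions; it is `∞` when there is no such `g` or when `f` is not a.e. equal
to the absolute value of a function in `L¹ + L^∞`. -/
def rangeNorm {φ : ℝ → ℝ} (hφ : QuasiConcave φ) (f : ℝ → ℝ≥0∞) : ℝ≥0∞ :=
  ⨅ (g : ℝ → ℝ) (_ : (∃ h ∈ L1AddLinfty, f =ᵐ[μ] absFun h) ∧ g ∈ majorants hφ f),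
    lorentzNorm hφ g

end HardyRange

end

open Filter Topology

namespace HardyRange

/-! ### Decreasing rearrangements -/

/-! Everything is linearised on the cone of right-continuous decreasing functions G (`Decr`). There
both ‖G‖ = ∫ G dφ and ∫_0^t SG are linear in G. By Tonelli the second is integration against the
density log(t/r) on (0,t], a measure that gives (0,d) the mass d(1 + log(t/d)) when d ≤ t, while dφ
gives [0,d) the mass φ(d). By the layer cake formula, two measures compare on the cone once they
compare on initial intervals. So the growth condition yields ∫_0^t SG ≤ C_t ‖G‖ for each t, and
conversely testing a bounded S on χ_(0,t) returns the growth condition (`HardyBounded.growth`).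

Since (Sf)* ≤ S(f*), the candidate norm of f is the infimum of ‖G‖ over decreasing G with ∫_0^t f* ≤
∫_0^t SG for all t (`rangeNorm_eq`). Homogeneity and the triangle inequality come from linearity,
and local integrability from the growth condition.

The Fatou property (`rangeNorm_iSup`) is the delicate axiom. Near-optimal G_n for f_n, with norms at
most M, have by Helly a subsequence with an a.e. limit K, but mass may escape to the origin. With κ
the upper limit of d(1 + log(1/d))/φ(d) at 0, the loss in ∫_0^t SG_n is at most κ(M − ‖K‖), for
every t with the same κ (`QuasiConcave.exists_limit`). This loss is repaid by adding to K a sum of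
indicators of short initial intervals on which the ratio nearly attains κ, at norm cost M − ‖K‖ + ε
(`QuasiConcave.exists_correction`). This works because ∫_0^t f* tends to 0 with t.

Minimality rests on the Hardy-Littlewood-Pólya principle for an arbitrary r.i. norm σ: if ∫_0^t f* ≤
∫_0^t SG for all t, then σ(f) ≤ σ(SG) ≤ C‖G‖. It is proved by hand. Averaging a decreasing function
over an interval is a limit of means of measure-preserving rotations, hence does not increase σ;
cutting a concave primitive by a line is dominated by such an averaging; finitely many cuts bring
the primitive of SG close enough to the polygon that is the primitive of a step function below f*.

Finally, two minimal spaces coincide as sets, and an inclusion of r.i. spaces is bounded by a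
gliding hump, so the norms are equivalent. -/

theorem exists_seq_gt_strictAnti_tendsto {s : ℝ≥0∞} (hs : s ≠ ∞) :
    ∃ u : ℕ → ℝ≥0∞, (∀ n, s < u n) ∧ StrictAnti u ∧ Tendsto u atTop (𝓝 s) := by
  obtain ⟨u, hu, hu', hu''⟩ := exists_seq_strictAnti_tendsto' (lt_top_iff_ne_top.2 hs)
  exact ⟨u, fun n => (hu' n).1, hu, hu''⟩

theorem distr_congr {f g : ℝ → ℝ≥0∞} (h : f =ᵐ[μ] g) (s : ℝ≥0∞) : distr f s = distr g s := by
  refine measure_congr ?_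
  filter_upwards [h] with x hx
  change (s < f x) = (s < g x)
  rw [hx]

theorem distr_mono {f g : ℝ → ℝ≥0∞} (h : ∀ᵐ x ∂μ, f x ≤ g x) (s : ℝ≥0∞) :
    distr f s ≤ distr g s := by
  refine measure_mono_ae ?_
  filter_upwards [h] with x hx h1
  exact lt_of_lt_of_le h1 hx

theorem distr_antitone (f : ℝ → ℝ≥0∞) : Antitone (distr f) := fun _ _ h =>
  measure_mono fun _ hx => lt_of_le_of_lt h hx

/-- The infimum defining f* is attained, because the distribution function is right-continuous: {f >
s} is the increasing union of {f > u n} for u n decreasing to s. -/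
theorem distr_rearr_le (f : ℝ → ℝ≥0∞) (t : ℝ) : distr f (rearr f t) ≤ ENNReal.ofReal t := by
  by_cases h : rearr f t = ∞
  · rw [h]; simp [distr]
  obtain ⟨u, hu, hanti, hlim⟩ := exists_seq_gt_strictAnti_tendsto h
  have hU : {x | rearr f t < f x} = ⋃ n, {x | u n < f x} := by
    ext x
    simp only [mem_ofPred_eq, mem_iUnion]
    refine ⟨fun hx => ((hlim.eventually_lt_const hx).exists), fun ⟨n, hn⟩ => (hu n).trans hn⟩
  have hdir : Directed (· ⊆ ·) fun n => {x | u n < f x} :=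
    directed_of_isDirected_le fun m n hmn x (hx : u m < f x) =>
      lt_of_le_of_lt (hanti.antitone hmn) hx
  rw [distr, hU, hdir.measure_iUnion]
  refine iSup_le fun n => ?_
  obtain ⟨s, hs, hsu⟩ := sInf_lt_iff.1 (hu n)
  exact (distr_antitone f hsu.le).trans hs

theorem rearr_le_iff {f : ℝ → ℝ≥0∞} {t : ℝ} {s : ℝ≥0∞} :
    rearr f t ≤ s ↔ distr f s ≤ ENNReal.ofReal t :=
  ⟨fun h => (distr_antitone f h).trans (distr_rearr_le f t), fun h => sInf_le h⟩

theorem lt_rearr_iff {f : ℝ → ℝ≥0∞} {t : ℝ} {s : ℝ≥0∞} :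
    s < rearr f t ↔ ENNReal.ofReal t < distr f s := by
  rw [← not_le, rearr_le_iff, not_le]

theorem rearr_antitone (f : ℝ → ℝ≥0∞) : Antitone (rearr f) := fun _ _ h =>
  rearr_le_iff.2 ((distr_rearr_le f _).trans (ENNReal.ofReal_le_ofReal h))

theorem rearr_lowerSemicontinuous (f : ℝ → ℝ≥0∞) : LowerSemicontinuous (rearr f) := by
  rw [lowerSemicontinuous_iff_isOpen_preimage]
  intro s
  have : rearr f ⁻¹' Ioi s = {t | ENNReal.ofReal t < distr f s} := by
    ext t; exact lt_rearr_iff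
  rw [this]
  exact isOpen_lt ENNReal.continuous_ofReal continuous_const

theorem rearr_measurable (f : ℝ → ℝ≥0∞) : Measurable (rearr f) := (rearr_antitone f).measurable

theorem rearr_eq_of_distr_eq {f g : ℝ → ℝ≥0∞} (h : ∀ s, distr f s = distr g s) :
    rearr f = rearr g := by
  ext t; unfold rearr; simp only [h]

theorem rearr_congr {f g : ℝ → ℝ≥0∞} (h : f =ᵐ[μ] g) : rearr f = rearr g :=
  rearr_eq_of_distr_eq (distr_congr h)

theorem rearr_mono {f g : ℝ → ℝ≥0∞} (h : ∀ᵐ x ∂μ, f x ≤ g x) (t : ℝ) : rearr f t ≤ rearr g t :=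
  rearr_le_iff.2 ((distr_mono h _).trans (distr_rearr_le g t))

theorem ae_mu_of_forall {p : ℝ → Prop} (h : ∀ x, 0 < x → p x) : ∀ᵐ x ∂μ, p x :=
  (ae_restrict_iff' measurableSet_Ioi).2 (.of_forall h)

theorem volume_ofReal_lt (d : ℝ≥0∞) :
    volume ({t : ℝ | ENNReal.ofReal t < d} ∩ Ioi 0) = d := by
  by_cases hd : d = ∞
  · subst hd
    simp
  · have : {t : ℝ | ENNReal.ofReal t < d} ∩ Ioi 0 = Ioo 0 d.toReal := by
      ext t
      simp only [mem_inter_iff, mem_ofPred_eq, mem_Ioi, mem_Ioo]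
      constructor
      · rintro ⟨h1, h2⟩
        exact ⟨h2, (ENNReal.ofReal_lt_iff_lt_toReal h2.le hd).1 h1⟩
      · rintro ⟨h1, h2⟩
        exact ⟨(ENNReal.ofReal_lt_iff_lt_toReal h1.le hd).2 h2, h1⟩
    rw [this, Real.volume_Ioo, sub_zero, ENNReal.ofReal_toReal hd]

theorem distr_rearr (f : ℝ → ℝ≥0∞) (s : ℝ≥0∞) : distr (rearr f) s = distr f s := by
  have : {t | s < rearr f t} = {t | ENNReal.ofReal t < distr f s} := by
    ext t; exact lt_rearr_iff
  rw [distr, this, μ, Measure.restrict_apply' measurableSet_Ioi, volume_ofReal_lt]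

/-- The layer cake formula for `[0, ∞]`-valued functions. -/
theorem lintegral_eq_lintegral_superlevel {α : Type*} [MeasurableSpace α] (ν : Measure α)
    [SFinite ν] {f : α → ℝ≥0∞} (hf : AEMeasurable f ν) :
    ∫⁻ x, f x ∂ν = ∫⁻ s in Ioi (0 : ℝ), ν {x | ENNReal.ofReal s < f x} := by
  have key : ∀ f : α → ℝ≥0∞, Measurable f →
      ∫⁻ x, f x ∂ν = ∫⁻ s in Ioi (0 : ℝ), ν {x | ENNReal.ofReal s < f x} := by
    intro f hf
    have hm : MeasurableSet {p : α × ℝ | ENNReal.ofReal p.2 < f p.1} :=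
      measurableSet_lt (by fun_prop) (by fun_prop)
    calc ∫⁻ x, f x ∂ν
        = ∫⁻ x, ∫⁻ s in Ioi (0 : ℝ),
            {p : α × ℝ | ENNReal.ofReal p.2 < f p.1}.indicator 1 (x, s) ∂volume ∂ν := by
          refine lintegral_congr fun x => ?_
          have hx : MeasurableSet {s : ℝ | ENNReal.ofReal s < f x} :=
            measurableSet_lt (by fun_prop) (by fun_prop)
          have : (fun s => {p : α × ℝ | ENNReal.ofReal p.2 < f p.1}.indicator
              (1 : α × ℝ → ℝ≥0∞) (x, s)) = {s : ℝ | ENNReal.ofReal s < f x}.indicator 1 := by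
            ext s; rfl
          rw [this, lintegral_indicator_one hx, Measure.restrict_apply hx, volume_ofReal_lt]
      _ = ∫⁻ s in Ioi (0 : ℝ), ∫⁻ x,
            {p : α × ℝ | ENNReal.ofReal p.2 < f p.1}.indicator 1 (x, s) ∂ν :=
          lintegral_lintegral_swap (f := fun x s =>
            {p : α × ℝ | ENNReal.ofReal p.2 < f p.1}.indicator 1 (x, s))
            ((measurable_one.indicator hm).aemeasurable)
      _ = _ := by
          refine lintegral_congr fun s => ?_
          have hx : MeasurableSet {x : α | ENNReal.ofReal s < f x} :=
            measurableSet_lt (by fun_prop) (by fun_prop)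
          rw [← lintegral_indicator_one hx]
          rfl
  rw [lintegral_congr_ae hf.ae_eq_mk, key _ hf.measurable_mk]
  refine lintegral_congr fun s => measure_congr ?_
  filter_upwards [hf.ae_eq_mk] with x hx
  change (_ < hf.mk f x) = (_ < f x)
  rw [hx]

instance : SFinite μ := by unfold μ; infer_instance

/-- By the layer cake formula, the integral of (f − c)₊ sees only the distribution of f above the
level c. -/
theorem lintegral_sub_const_eq {f g : ℝ → ℝ≥0∞} (hf : AEMeasurable f μ) (hg : AEMeasurable g μ)
    (h : ∀ s, distr f s = distr g s) (c : ℝ≥0∞) :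
    ∫⁻ x, (f x - c) ∂μ = ∫⁻ x, (g x - c) ∂μ := by
  rw [lintegral_eq_lintegral_superlevel μ (hf.sub_const c),
    lintegral_eq_lintegral_superlevel μ (hg.sub_const c)]
  refine lintegral_congr fun s => ?_
  simp only [lt_tsub_iff_left]
  exact h _

theorem setLIntegral_le_lintegral_sub_add {f : ℝ → ℝ≥0∞} (E : Set ℝ) (c : ℝ≥0∞) :
    ∫⁻ x in E, f x ∂μ ≤ ∫⁻ x, (f x - c) ∂μ + c * μ E := by
  calc ∫⁻ x in E, f x ∂μ ≤ ∫⁻ x in E, ((f x - c) + c) ∂μ :=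
        lintegral_mono fun x => le_tsub_add
    _ = ∫⁻ x in E, (f x - c) ∂μ + c * μ E := by
        rw [lintegral_add_right _ measurable_const, setLIntegral_const]
    _ ≤ _ := by gcongr; exact Measure.restrict_le_self

theorem restrict_mu_Ioc (t : ℝ) : μ.restrict (Ioc 0 t) = volume.restrict (Ioc 0 t) := by
  rw [μ, Measure.restrict_restrict measurableSet_Ioc]
  congr 1
  exact inter_eq_left.2 Ioc_subset_Ioi_self

theorem mu_Ioc (t : ℝ) : μ (Ioc 0 t) = ENNReal.ofReal t := by
  rw [← Measure.restrict_apply_self μ, restrict_mu_Ioc, Measure.restrict_apply_self,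
    Real.volume_Ioc, sub_zero]

/-- Together with the next lemma this is the variational formula ∫_0^t f* = min over c of ∫(f − c)₊
+ ct, attained at c = f*(t). Subadditivity and the Hardy-Littlewood inequality are read off from it.
-/
theorem lintegral_rearr_le_sub_add {f : ℝ → ℝ≥0∞} (hf : AEMeasurable f μ) (t : ℝ)
    (c : ℝ≥0∞) :
    ∫⁻ s in Ioc 0 t, rearr f s ≤ ∫⁻ x, (f x - c) ∂μ + c * ENNReal.ofReal t := by
  rw [lintegral_sub_const_eq hf (rearr_measurable f).aemeasurable (fun s => (distr_rearr f s).symm),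
    ← mu_Ioc, ← restrict_mu_Ioc]
  exact setLIntegral_le_lintegral_sub_add _ _

theorem lintegral_sub_add_le_lintegral_rearr {f : ℝ → ℝ≥0∞} (hf : AEMeasurable f μ) (t : ℝ) :
    ∫⁻ x, (f x - rearr f t) ∂μ + rearr f t * ENNReal.ofReal t ≤ ∫⁻ s in Ioc 0 t, rearr f s := by
  rw [lintegral_sub_const_eq hf (rearr_measurable f).aemeasurable
    (fun s => (distr_rearr f s).symm)]
  have h1 : ∫⁻ x, (rearr f x - rearr f t) ∂μ ≤ ∫⁻ x in Ioc 0 t, (rearr f x - rearr f t) := by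
    rw [← restrict_mu_Ioc, ← lintegral_indicator measurableSet_Ioc]
    refine lintegral_mono_ae (ae_mu_of_forall fun x hx => ?_)
    by_cases hxt : x ≤ t
    · rw [indicator_of_mem (show x ∈ Ioc 0 t from ⟨hx, hxt⟩)]
    · rw [tsub_eq_zero_of_le (rearr_antitone f (not_le.1 hxt).le)]
      exact zero_le
  have h2 : rearr f t * ENNReal.ofReal t = ∫⁻ _ in Ioc 0 t, rearr f t := by
    rw [setLIntegral_const, Real.volume_Ioc, sub_zero]
  rw [h2]
  refine (add_le_add_left h1 _).trans ?_
  rw [← lintegral_add_right _ measurable_const]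
  refine setLIntegral_mono (rearr_measurable f) fun x hx => ?_
  rw [tsub_add_cancel_of_le (rearr_antitone f hx.2)]

/-- Take c = f*(t) + g*(t) in the variational formula and use (f + g − (a + b))₊ ≤ (f − a)₊ + (g −
b)₊. -/
theorem lintegral_rearr_add_le {f g : ℝ → ℝ≥0∞} (hf : AEMeasurable f μ) (hg : AEMeasurable g μ)
    (t : ℝ) :
    ∫⁻ s in Ioc 0 t, rearr (fun x => f x + g x) s ≤
      (∫⁻ s in Ioc 0 t, rearr f s) + ∫⁻ s in Ioc 0 t, rearr g s := by
  refine (lintegral_rearr_le_sub_add (hf.add hg) t (rearr f t + rearr g t)).trans ?_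
  refine le_trans ?_ (add_le_add (lintegral_sub_add_le_lintegral_rearr hf t)
    (lintegral_sub_add_le_lintegral_rearr hg t))
  rw [add_mul, add_add_add_comm]
  gcongr
  rw [← lintegral_add_left' (hf.sub_const _)]
  exact lintegral_mono fun x => add_tsub_add_le_tsub_add_tsub

/-- The Hardy-Littlewood inequality for characteristic functions. -/
theorem setLIntegral_le_lintegral_rearr {f : ℝ → ℝ≥0∞} (hf : AEMeasurable f μ) {E : Set ℝ}
    {t : ℝ} (hE : μ E ≤ ENNReal.ofReal t) :
    ∫⁻ x in E, f x ∂μ ≤ ∫⁻ s in Ioc 0 t, rearr f s := by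
  refine (setLIntegral_le_lintegral_sub_add E (rearr f t)).trans ?_
  exact (add_le_add_right (mul_le_mul_right hE _) _).trans
    (lintegral_sub_add_le_lintegral_rearr hf t)

theorem lt_top_of_antitoneOn {w : ℝ → ℝ≥0∞} (hw : AntitoneOn w (Ioi 0)) {t : ℝ} (ht : 0 < t)
    (h : ∫⁻ s in Ioc 0 t, w s < ∞) : w t < ∞ := by
  by_contra hc
  rw [not_lt, top_le_iff] at hc
  have : ∫⁻ _ in Ioc 0 t, w t ≤ ∫⁻ s in Ioc 0 t, w s :=
    setLIntegral_mono' measurableSet_Ioc fun x hx => hw hx.1 ht hx.2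
  rw [setLIntegral_const, hc, Real.volume_Ioc, sub_zero,
    ENNReal.top_mul (by simpa using ht)] at this
  exact absurd (this.trans_lt h) (lt_irrefl _)

theorem rearr_lt_top {f : ℝ → ℝ≥0∞} {t : ℝ} (ht : 0 < t)
    (h : ∫⁻ s in Ioc 0 t, rearr f s < ∞) : rearr f t < ∞ :=
  lt_top_of_antitoneOn ((rearr_antitone f).antitoneOn _) ht h

/-- Truncate f at height f*(1): the truncation is bounded and the remainder has L¹ norm at most
∫_0^1 f*. -/
theorem mem_L1AddLinfty {f : ℝ → ℝ} (hf : AEMeasurable f μ)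
    (h : ∫⁻ s in Ioc 0 1, rearr (absFun f) s < ∞) : f ∈ L1AddLinfty := by
  have hc := rearr_lt_top one_pos h
  have hf' : AEMeasurable (absFun f) μ := hf.enorm
  set c : ℝ := (rearr (absFun f) 1).toReal with hcdef
  have hc0 : 0 ≤ c := ENNReal.toReal_nonneg
  have hceq : ENNReal.ofReal c = rearr (absFun f) 1 := ENNReal.ofReal_toReal hc.ne
  set b : ℝ → ℝ := fun x => max (-c) (min (f x) c) with hb
  have hbm : AEMeasurable b μ := (aemeasurable_const.max (hf.min aemeasurable_const))
  refine ⟨fun x => f x - b x, b, ⟨(hf.sub hbm).aestronglyMeasurable, ?_⟩, ?_, ?_⟩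
  · rw [eLpNorm_one_eq_lintegral_enorm]
    refine lt_of_le_of_lt ?_ h
    refine le_trans ?_ (lintegral_sub_add_le_lintegral_rearr hf' 1)
    refine le_add_right (lintegral_mono fun x => ?_)
    rw [← hceq, absFun, ← ofReal_norm, ← ofReal_norm, ← ENNReal.ofReal_sub _ hc0]
    refine ENNReal.ofReal_le_ofReal_iff'.2 ?_
    simp only [hb, Real.norm_eq_abs]
    rcases le_total (f x) c with h1 | h1
    · rw [min_eq_left h1]
      rcases le_total (-c) (f x) with h2 | h2
      · rw [max_eq_right h2]; simp
      · rw [max_eq_left h2, abs_of_nonpos (by linarith), abs_of_nonpos (by linarith)]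
        left; linarith
    · rw [min_eq_right h1, max_eq_right (by linarith), abs_of_nonneg (by linarith),
        abs_of_nonneg (by linarith)]
      left; linarith
  · refine memLp_top_of_bound hbm.aestronglyMeasurable c (.of_forall fun x => ?_)
    rw [Real.norm_eq_abs, abs_le]
    exact ⟨le_max_left _ _, max_le (by linarith) (min_le_right _ _)⟩
  · exact .of_forall fun x => by simp

theorem rearr_iSup {f : ℕ → ℝ → ℝ≥0∞} (hmono : ∀ᵐ x ∂μ, Monotone fun n => f n x) (t : ℝ) :
    rearr (fun x => ⨆ n, f n x) t = ⨆ n, rearr (f n) t := by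
  have hd : ∀ s, distr (fun x => ⨆ n, f n x) s = ⨆ n, distr (f n) s := by
    intro s
    have h1 : {x | s < ⨆ n, f n x} = ⋃ n, {x | s < f n x} := by
      ext x; simp [lt_iSup_iff]
    apply le_antisymm
    · have h2 : ∀ n, μ (⋃ m ∈ Iic n, {x | s < f m x}) ≤ distr (f n) s := by
        intro n
        refine measure_mono_ae ?_
        filter_upwards [hmono] with x hx h3
        obtain ⟨m, hm, h4⟩ := mem_iUnion₂.1 h3
        exact lt_of_lt_of_le h4 (hx hm)
      have h3 : (⋃ n, {x | s < f n x}) = ⋃ n, ⋃ m ∈ Iic n, {x | s < f m x} := by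
        ext x
        simp only [mem_iUnion, mem_Iic]
        exact ⟨fun ⟨n, hn⟩ => ⟨n, n, le_rfl, hn⟩, fun ⟨_, m, _, hm⟩ => ⟨m, hm⟩⟩
      have hdir : Directed (· ⊆ ·) fun n => ⋃ m ∈ Iic n, {x | s < f m x} :=
        directed_of_isDirected_le fun a b hab =>
          biUnion_subset_biUnion_left (Iic_subset_Iic.2 hab)
      rw [distr, h1, h3, hdir.measure_iUnion]
      exact iSup_mono h2
    · exact iSup_le fun n => distr_mono (.of_forall fun x => le_iSup (fun n => f n x) n) s
  refine eq_of_forall_lt_iff fun s => ?_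
  rw [lt_rearr_iff, hd, lt_iSup_iff, lt_iSup_iff]
  simp only [lt_rearr_iff]

theorem rearr_le_of_antitoneOn {g : ℝ → ℝ≥0∞} (hg : AntitoneOn g (Ioi 0)) {t : ℝ} (ht : 0 < t) :
    rearr g t ≤ g t := by
  rw [rearr_le_iff, ← mu_Ioc]
  refine measure_mono_ae (ae_mu_of_forall fun x hx (hlt : g t < g x) => ?_)
  refine ⟨hx, ?_⟩
  by_contra hc
  exact absurd (hg ht hx (not_le.1 hc).le) (not_le.2 hlt)

theorem maxRearr_le_iff {f g : ℝ → ℝ≥0∞} {t : ℝ} (ht : 0 < t) :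
    maxRearr f t ≤ maxRearr g t ↔
      ∫⁻ s in Ioc 0 t, rearr f s ≤ ∫⁻ s in Ioc 0 t, rearr g s := by
  unfold maxRearr
  exact ENNReal.mul_le_mul_iff_right (by simp) (by simpa using ht)

/-! ### The cone of right-continuous decreasing functions -/

/-- Right-continuous decreasing functions with values in `[0, ∞]`. -/
structure Decr (G : ℝ → ℝ≥0∞) : Prop where
  anti : Antitone G
  lsc : LowerSemicontinuous G

theorem Decr.measurable {G : ℝ → ℝ≥0∞} (hG : Decr G) : Measurable G := hG.anti.measurable

theorem decr_rearr (f : ℝ → ℝ≥0∞) : Decr (rearr f) :=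
  ⟨rearr_antitone f, rearr_lowerSemicontinuous f⟩

theorem decr_zero : Decr fun _ => 0 := ⟨fun _ _ _ => le_rfl, lowerSemicontinuous_const⟩

theorem Decr.add {G K : ℝ → ℝ≥0∞} (hG : Decr G) (hK : Decr K) : Decr fun x => G x + K x :=
  ⟨fun _ _ h => add_le_add (hG.anti h) (hK.anti h), hG.lsc.add hK.lsc⟩

theorem Decr.const_mul {G : ℝ → ℝ≥0∞} (hG : Decr G) {c : ℝ≥0∞} (hc : c ≠ ∞) :
    Decr fun x => c * G x :=
  ⟨fun _ _ h => mul_le_mul_right (hG.anti h) _,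
    (ENNReal.continuous_const_mul hc).comp_lowerSemicontinuous hG.lsc
      fun _ _ h => mul_le_mul_right h _⟩

theorem Decr.sub_const {G : ℝ → ℝ≥0∞} (hG : Decr G) (c : ℝ≥0∞) :
    Decr fun x => G x - c := by
  refine ⟨fun _ _ h => tsub_le_tsub_right (hG.anti h) _, ?_⟩
  rw [lowerSemicontinuous_iff_isOpen_preimage]
  intro s
  have : (fun x => G x - c) ⁻¹' Ioi s = G ⁻¹' Ioi (c + s) := by
    ext x; simp [lt_tsub_iff_left]
  rw [this]
  exact lowerSemicontinuous_iff_isOpen_preimage.1 hG.lsc _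

theorem Decr.tsum {G : ℕ → ℝ → ℝ≥0∞} (hG : ∀ n, Decr (G n)) : Decr fun x => ∑' n, G n x :=
  ⟨fun _ _ h => ENNReal.tsum_le_tsum fun n => (hG n).anti h,
    lowerSemicontinuous_tsum fun n => (hG n).lsc⟩

theorem decr_indicator_Iio (d : ℝ) : Decr ((Iio d).indicator 1) := by
  refine ⟨fun x y h => ?_, isOpen_Iio.lowerSemicontinuous_indicator zero_le⟩
  by_cases hy : y < d
  · rw [indicator_of_mem (show y ∈ Iio d from hy),
      indicator_of_mem (show x ∈ Iio d from h.trans_lt hy)]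
    simp
  · rw [indicator_of_notMem (show y ∉ Iio d from hy)]
    exact zero_le

/-- Superlevel sets are open and closed downwards. Right-continuity excludes closed half-lines, so
only the indicators of `Iio d` have to be tested. -/
theorem Decr.superlevel {G : ℝ → ℝ≥0∞} (hG : Decr G) (s : ℝ≥0∞) :
    {x | s < G x} = ∅ ∨ {x | s < G x} = univ ∨ ∃ d, {x | s < G x} = Iio d := by
  rcases eq_empty_or_nonempty {x | s < G x} with h | hne
  · exact .inl h
  by_cases hb : BddAbove {x | s < G x}
  · refine .inr (.inr ⟨sSup {x | s < G x}, ?_⟩)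
    ext x
    have hopen : IsOpen {x | s < G x} := lowerSemicontinuous_iff_isOpen_preimage.1 hG.lsc s
    constructor
    · intro hx
      obtain ⟨y, hy, hxy⟩ := (((hopen.eventually_mem hx).filter_mono nhdsWithin_le_nhds).and
        (eventually_mem_nhdsWithin (s := Ioi x))).exists
      exact lt_of_lt_of_le hxy (le_csSup hb hy)
    · intro hx
      obtain ⟨y, hy, hxy⟩ := exists_lt_of_lt_csSup hne hx
      exact lt_of_lt_of_le hy (hG.anti hxy.le)
  · refine .inr (.inl (eq_univ_of_forall fun x => ?_))
    obtain ⟨y, hy, hxy⟩ := not_bddAbove_iff.1 hb x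
    exact lt_of_lt_of_le hy (hG.anti hxy.le)

theorem Decr.lintegral_le_of_superlevel {G : ℝ → ℝ≥0∞} (hG : Decr G) {ν₁ ν₂ : Measure ℝ}
    [SFinite ν₁] [SFinite ν₂] {C : ℝ≥0∞}
    (h : ∀ s, ν₁ {x | s < G x} ≤ C * ν₂ {x | s < G x}) :
    ∫⁻ x, G x ∂ν₁ ≤ C * ∫⁻ x, G x ∂ν₂ := by
  rw [lintegral_eq_lintegral_superlevel ν₁ hG.measurable.aemeasurable,
    lintegral_eq_lintegral_superlevel ν₂ hG.measurable.aemeasurable, ← lintegral_const_mul]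
  · exact lintegral_mono fun s => h _
  · refine Antitone.measurable fun a b hab => measure_mono fun x hx => ?_
    exact lt_of_le_of_lt (ENNReal.ofReal_le_ofReal hab) hx

/-- Local form of the comparison principle: when G vanishes from δ on, only intervals of length at
most δ occur as superlevel sets. -/
theorem Decr.lintegral_le_of_Iio_le {G : ℝ → ℝ≥0∞} (hG : Decr G) {ν₁ ν₂ : Measure ℝ}
    [SFinite ν₁] [SFinite ν₂] {C : ℝ≥0∞} (h0 : ν₁ (Iio 0) = 0) {δ : ℝ} (hδ : G δ = 0)
    (h : ∀ d, 0 < d → d ≤ δ → ν₁ (Iio d) ≤ C * ν₂ (Iio d)) :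
    ∫⁻ x, G x ∂ν₁ ≤ C * ∫⁻ x, G x ∂ν₂ := by
  refine hG.lintegral_le_of_superlevel fun s => ?_
  have hmem : δ ∉ {x | s < G x} := by simp [hδ]
  rcases hG.superlevel s with h1 | h1 | ⟨d, h1⟩
  · simp [h1]
  · exact absurd (h1 ▸ mem_univ δ) hmem
  · rw [h1] at hmem ⊢
    rcases le_or_gt d 0 with hd | hd
    · exact (measure_mono (Iio_subset_Iio hd)).trans (h0.le.trans zero_le)
    · exact h d hd (not_lt.1 hmem)

theorem Decr.lintegral_le_of_Iio {G : ℝ → ℝ≥0∞} (hG : Decr G) {ν₁ ν₂ : Measure ℝ}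
    [SFinite ν₁] [SFinite ν₂] {C : ℝ≥0∞} (h0 : ν₁ (Iio 0) = 0)
    (h : ∀ d, 0 < d → ν₁ (Iio d) ≤ C * ν₂ (Iio d)) :
    ∫⁻ x, G x ∂ν₁ ≤ C * ∫⁻ x, G x ∂ν₂ := by
  have h' : ∀ d, ν₁ (Iio d) ≤ C * ν₂ (Iio d) := fun d => by
    rcases le_or_gt d 0 with hd | hd
    · exact (measure_mono (Iio_subset_Iio hd)).trans (h0.le.trans zero_le)
    · exact h d hd
  refine hG.lintegral_le_of_superlevel fun s => ?_
  rcases hG.superlevel s with h1 | h1 | ⟨d, h1⟩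
  · simp [h1]
  · have hU : (univ : Set ℝ) = ⋃ n : ℕ, Iio (n : ℝ) := by
      ext x; simp [exists_nat_gt x]
    have hdir : Directed (· ⊆ ·) fun n : ℕ => Iio (n : ℝ) :=
      directed_of_isDirected_le fun a b hab => Iio_subset_Iio (by exact_mod_cast hab)
    rw [h1]
    nth_rewrite 1 [hU]
    rw [hdir.measure_iUnion]
    exact iSup_le fun n => (h' n).trans (mul_le_mul_right (measure_mono (subset_univ _)) _)
  · rw [h1]; exact h' d

/-! ### Averages -/

/-- The Hardy average of a function with values in `[0, ∞]`. -/
noncomputable def avg (G : ℝ → ℝ≥0∞) (t : ℝ) : ℝ≥0∞ :=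
  (ENNReal.ofReal t)⁻¹ * ∫⁻ r in Ioc 0 t, G r

/-- The integral of the Hardy average over `(0, t]`. -/
noncomputable def avgInt (G : ℝ → ℝ≥0∞) (t : ℝ) : ℝ≥0∞ := ∫⁻ s in Ioc 0 t, avg G s

/-- The weight `r ↦ log (t / r)` on `(0, t]`. -/
noncomputable def logWeight (t r : ℝ) : ℝ≥0∞ :=
  ∫⁻ s in Ioc 0 t, (Ici r).indicator (fun s => (ENNReal.ofReal s)⁻¹) s

/-- The measure with density `r ↦ log (t / r)` on `(0, t]`. -/
noncomputable def logMeasure (t : ℝ) : Measure ℝ :=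
  (volume.restrict (Ioc 0 t)).withDensity (logWeight t)

instance (t : ℝ) : SFinite (logMeasure t) := by unfold logMeasure; infer_instance

theorem measurable_logKernel : Measurable fun p : ℝ × ℝ =>
    (Ici p.1).indicator (fun s => (ENNReal.ofReal s)⁻¹) p.2 := by
  have : (fun p : ℝ × ℝ => (Ici p.1).indicator (fun s => (ENNReal.ofReal s)⁻¹) p.2) =
      {p : ℝ × ℝ | p.1 ≤ p.2}.indicator fun p => (ENNReal.ofReal p.2)⁻¹ := by
    ext p; simp [indicator]
  rw [this]
  exact Measurable.indicator (by fun_prop) (measurableSet_le measurable_fst measurable_snd)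

theorem measurable_logWeight (t : ℝ) : Measurable (logWeight t) :=
  measurable_logKernel.lintegral_prod_right'

/-- Tonelli: the value G(r) is weighted by the integral of 1/s over r ≤ s ≤ t. This exhibits ∫_0^t
SG as a positive linear functional of G. -/
theorem avgInt_eq_lintegral {G : ℝ → ℝ≥0∞} (hG : Measurable G) (t : ℝ) :
    avgInt G t = ∫⁻ r, G r ∂logMeasure t := by
  rw [logMeasure, lintegral_withDensity_eq_lintegral_mul _ (measurable_logWeight t) hG]
  have h1 : avgInt G t = ∫⁻ s in Ioc 0 t, ∫⁻ r in Ioc 0 t,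
      (Ici r).indicator (fun s => (ENNReal.ofReal s)⁻¹) s * G r := by
    refine setLIntegral_congr_fun measurableSet_Ioc fun s hs => ?_
    have h2 : (fun r => (Ici r).indicator (fun s => (ENNReal.ofReal s)⁻¹) s * G r) =
        (Iic s).indicator fun r => (ENNReal.ofReal s)⁻¹ * G r := by
      ext r; by_cases h : r ≤ s <;> simp [h]
    simp only [h2]
    rw [setLIntegral_indicator measurableSet_Iic, lintegral_const_mul _ hG, avg]
    congr 3
    ext r
    simp only [mem_Ioc, mem_inter_iff, mem_Iic]
    exact ⟨fun h => ⟨h.2, h.1, h.2.trans hs.2⟩, fun h => ⟨h.2.1, h.1⟩⟩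
  rw [h1, lintegral_lintegral_swap]
  · refine lintegral_congr fun r => ?_
    simp only [Pi.mul_apply, logWeight]
    rw [lintegral_mul_const]
    exact measurable_logKernel.comp (measurable_const.prodMk measurable_id)
  · refine Measurable.aemeasurable ?_
    exact (measurable_logKernel.comp measurable_swap).mul (hG.comp measurable_snd)

theorem avg_indicator_Iio_of_le {d s : ℝ} (hs : 0 < s) (h : s ≤ d) :
    avg ((Iio d).indicator 1) s = 1 := by
  have : ∫⁻ r in Ioc 0 s, (Iio d).indicator (1 : ℝ → ℝ≥0∞) r = ENNReal.ofReal s := by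
    rw [lintegral_indicator_one measurableSet_Iio, Measure.restrict_apply measurableSet_Iio]
    apply le_antisymm
    · refine (measure_mono inter_subset_right).trans (by simp)
    · refine le_trans ?_ (measure_mono (show Ioo 0 s ⊆ _ from fun x hx =>
        ⟨hx.2.trans_le h, hx.1, hx.2.le⟩))
      simp
  rw [avg, this, ENNReal.inv_mul_cancel (by simpa using hs) (by simp)]

theorem avg_indicator_Iio_of_ge {d s : ℝ} (hd : 0 < d) (h : d ≤ s) :
    avg ((Iio d).indicator 1) s = ENNReal.ofReal (d * s⁻¹) := by
  have hs := hd.trans_le h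
  have : ∫⁻ r in Ioc 0 s, (Iio d).indicator (1 : ℝ → ℝ≥0∞) r = ENNReal.ofReal d := by
    rw [lintegral_indicator_one measurableSet_Iio, Measure.restrict_apply measurableSet_Iio]
    have : Iio d ∩ Ioc 0 s = Ioo 0 d := by
      ext x; simp only [mem_inter_iff, mem_Iio, mem_Ioc, mem_Ioo]
      exact ⟨fun hx => ⟨hx.2.1, hx.1⟩, fun hx => ⟨hx.2, hx.1, hx.2.le.trans h⟩⟩
    rw [this]; simp
  rw [avg, this, ← ENNReal.ofReal_inv_of_pos hs, ← ENNReal.ofReal_mul (by positivity), mul_comm]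

theorem logMeasure_Iio (t d : ℝ) : logMeasure t (Iio d) = avgInt ((Iio d).indicator 1) t := by
  rw [avgInt_eq_lintegral (decr_indicator_Iio d).measurable, lintegral_indicator_one
    measurableSet_Iio]

theorem logMeasure_Iio_zero (t : ℝ) : logMeasure t (Iio 0) = 0 := by
  rw [logMeasure_Iio, avgInt]
  refine (lintegral_congr fun s => ?_).trans lintegral_zero
  have : ∫⁻ r in Ioc 0 s, (Iio 0).indicator (1 : ℝ → ℝ≥0∞) r = 0 := by
    refine (setLIntegral_congr_fun measurableSet_Ioc fun r hr => ?_).trans lintegral_zero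
    simp [hr.1.le]
  rw [avg, this, mul_zero]

theorem logMeasure_Iio_of_le {t d : ℝ} (h : t ≤ d) :
    logMeasure t (Iio d) = ENNReal.ofReal t := by
  rw [logMeasure_Iio, avgInt, setLIntegral_congr_fun (g := fun _ => 1) measurableSet_Ioc
    fun s hs => avg_indicator_Iio_of_le hs.1 (hs.2.trans h)]
  simp

/-- The Hardy average of the indicator is 1 up to d and d/s afterwards; integrating it avoids
integrating the logarithmic weight. -/
theorem logMeasure_Iio_of_ge {t d : ℝ} (hd : 0 < d) (h : d ≤ t) :
    logMeasure t (Iio d) = ENNReal.ofReal (d * (1 + Real.log (t / d))) := by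
  have hlog : 0 ≤ Real.log (t / d) := Real.log_nonneg ((one_le_div hd).2 h)
  rw [logMeasure_Iio, avgInt, ← Ioc_union_Ioc_eq_Ioc hd.le h, lintegral_union measurableSet_Ioc
    (Ioc_disjoint_Ioc_of_le le_rfl), setLIntegral_congr_fun (g := fun _ => 1) measurableSet_Ioc
    fun s hs => avg_indicator_Iio_of_le hs.1 hs.2,
    setLIntegral_congr_fun (g := fun s => ENNReal.ofReal (d * s⁻¹)) measurableSet_Ioc
      fun s hs => avg_indicator_Iio_of_ge hd hs.1.le]
  have hint : IntervalIntegrable (fun s : ℝ => d * s⁻¹) volume d t := by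
    refine ContinuousOn.intervalIntegrable ?_
    rw [uIcc_of_le h]
    exact continuousOn_const.mul (continuousOn_inv₀.mono fun x hx => (hd.trans_le hx.1).ne')
  rw [← ofReal_integral_eq_lintegral_ofReal, ← intervalIntegral.integral_of_le h,
    intervalIntegral.integral_const_mul, integral_inv_of_pos hd (hd.trans_le h)]
  · rw [setLIntegral_one, Real.volume_Ioc, sub_zero, ← ENNReal.ofReal_add hd.le (by positivity)]
    congr 1; ring
  · exact (intervalIntegrable_iff_integrableOn_Ioc_of_le h).1 hint
  · refine (ae_restrict_iff' measurableSet_Ioc).2 (.of_forall fun x hx => ?_)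
    have := hd.trans hx.1
    change 0 ≤ d * x⁻¹
    positivity

theorem avgInt_add {G K : ℝ → ℝ≥0∞} (hG : Measurable G) (hK : Measurable K) (t : ℝ) :
    avgInt (fun x => G x + K x) t = avgInt G t + avgInt K t := by
  rw [avgInt_eq_lintegral (G := fun x => G x + K x) (hG.add hK), avgInt_eq_lintegral hG,
    avgInt_eq_lintegral hK, lintegral_add_left hG]

theorem avgInt_mono {G K : ℝ → ℝ≥0∞} (h : ∀ x, G x ≤ K x) (t : ℝ) : avgInt G t ≤ avgInt K t :=
  lintegral_mono fun _ => mul_le_mul_right (lintegral_mono h) _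

theorem avgInt_monotone (G : ℝ → ℝ≥0∞) : Monotone (avgInt G) := fun _ _ h =>
  lintegral_mono_set (Ioc_subset_Ioc_right h)

/-! ### The Lorentz measure -/

/-- Quasi-concavity traps φ(x) between φ(d) min(1, x/d) and φ(d) max(1, x/d). -/
theorem QuasiConcave.continuousAt {φ : ℝ → ℝ} (hφ : QuasiConcave φ) {d : ℝ} (hd : 0 < d) :
    ContinuousAt φ d := by
  have hlow : Tendsto (fun x => φ d * min 1 (x / d)) (𝓝 d) (𝓝 (φ d)) := by
    have : ContinuousAt (fun x => φ d * min 1 (x / d)) d := by fun_prop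
    simpa [ContinuousAt, hd.ne'] using this
  have hupp : Tendsto (fun x => φ d * max 1 (x / d)) (𝓝 d) (𝓝 (φ d)) := by
    have : ContinuousAt (fun x => φ d * max 1 (x / d)) d := by fun_prop
    simpa [ContinuousAt, hd.ne'] using this
  have hp := hφ.pos d hd
  refine tendsto_of_tendsto_of_tendsto_of_le_of_le' hlow hupp ?_ ?_
  · filter_upwards [lt_mem_nhds hd] with x hx
    rcases le_total x d with h | h
    · have := hφ.anti hx hd h
      simp only at this
      rw [div_le_div_iff₀ hd hx] at this
      rw [min_eq_right ((div_le_one hd).2 h), mul_div_assoc', div_le_iff₀ hd]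
      exact this
    · rw [min_eq_left ((one_le_div hd).2 h), mul_one]
      exact hφ.mono hd hx h
  · filter_upwards [lt_mem_nhds hd] with x hx
    rcases le_total x d with h | h
    · rw [max_eq_left ((div_le_one hd).2 h), mul_one]
      exact hφ.mono hx hd h
    · have := hφ.anti hd hx h
      simp only at this
      rw [div_le_div_iff₀ hx hd] at this
      rw [max_eq_right ((one_le_div hd).2 h), mul_div_assoc', le_div_iff₀ hd]
      exact this

theorem QuasiConcave.continuousAt_extendZero {φ : ℝ → ℝ} (hφ : QuasiConcave φ) {x : ℝ}
    (hx : x ≠ 0) : ContinuousAt (extendZero φ) x := by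
  rcases lt_or_gt_of_ne hx with h | h
  · refine (continuousAt_const (y := (0 : ℝ))).congr ?_
    filter_upwards [gt_mem_nhds h] with y hy
    simp [extendZero, hy.le]
  · refine (hφ.continuousAt h).congr ?_
    filter_upwards [lt_mem_nhds h] with y hy
    simp [extendZero, hy]

theorem QuasiConcave.stieltjes_apply {φ : ℝ → ℝ} (hφ : QuasiConcave φ) {x : ℝ}
    (hx : x ≠ 0) : hφ.monotone_extendZero.stieltjesFunction x = extendZero φ x := by
  rw [Monotone.stieltjesFunction_eq]
  exact rightLim_eq_of_tendsto ((hφ.continuousAt_extendZero hx).mono_left nhdsWithin_le_nhds)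

theorem QuasiConcave.dφ_Iio_eq {φ : ℝ → ℝ} (hφ : QuasiConcave φ) {l d : ℝ}
    (h : Tendsto (extendZero φ) (𝓝[<] d) (𝓝 l)) : hφ.dφ (Iio d) = ENNReal.ofReal l := by
  have h0 : Tendsto hφ.monotone_extendZero.stieltjesFunction atBot (𝓝 0) := by
    refine tendsto_const_nhds.congr' ?_
    filter_upwards [eventually_lt_atBot 0] with x hx
    rw [hφ.stieltjes_apply hx.ne]
    simp [extendZero, hx.le]
  have h1 : Tendsto hφ.monotone_extendZero.stieltjesFunction (𝓝[<] d) (𝓝 l) := by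
    refine h.congr' ?_
    rcases eq_or_ne d 0 with rfl | hd
    · filter_upwards [self_mem_nhdsWithin] with x hx
      rw [hφ.stieltjes_apply (ne_of_lt hx)]
    · filter_upwards [nhdsWithin_le_nhds (isOpen_ne.mem_nhds hd)] with x hx
      rw [hφ.stieltjes_apply hx]
  rw [QuasiConcave.dφ, StieltjesFunction.measure_Iio _ h0, sub_zero,
    leftLim_eq_of_tendsto h1]

theorem QuasiConcave.dφ_Iio {φ : ℝ → ℝ} (hφ : QuasiConcave φ) {d : ℝ} (hd : 0 < d) :
    hφ.dφ (Iio d) = ENNReal.ofReal (φ d) := by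
  rw [hφ.dφ_Iio_eq ((hφ.continuousAt_extendZero hd.ne').mono_left nhdsWithin_le_nhds)]
  simp [extendZero, hd]

theorem QuasiConcave.dφ_Iio_zero {φ : ℝ → ℝ} (hφ : QuasiConcave φ) : hφ.dφ (Iio 0) = 0 := by
  rw [hφ.dφ_Iio_eq (l := 0), ENNReal.ofReal_zero]
  refine tendsto_const_nhds.congr' ?_
  filter_upwards [self_mem_nhdsWithin] with x hx
  simp [extendZero, (show x < 0 from hx).le]

instance {φ : ℝ → ℝ} (hφ : QuasiConcave φ) : SFinite hφ.dφ := by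
  unfold QuasiConcave.dφ; infer_instance

/-- The functional `∫ G dφ`. -/
noncomputable def QuasiConcave.nrm {φ : ℝ → ℝ} (hφ : QuasiConcave φ) (G : ℝ → ℝ≥0∞) : ℝ≥0∞ :=
  ∫⁻ t, G t ∂hφ.dφ

theorem QuasiConcave.nrm_mono {φ : ℝ → ℝ} (hφ : QuasiConcave φ) {G K : ℝ → ℝ≥0∞}
    (h : ∀ x, 0 ≤ x → G x ≤ K x) : hφ.nrm G ≤ hφ.nrm K := by
  refine lintegral_mono_ae ?_
  have : ∀ᵐ x ∂hφ.dφ, x ∉ Iio (0 : ℝ) := measure_eq_zero_iff_ae_notMem.1 hφ.dφ_Iio_zero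
  filter_upwards [this] with x hx
  exact h x (not_lt.1 hx)

theorem QuasiConcave.mul_le_nrm {φ : ℝ → ℝ} (hφ : QuasiConcave φ) {G : ℝ → ℝ≥0∞} (hG : Decr G)
    {t : ℝ} (ht : 0 < t) : G t * ENNReal.ofReal (φ t) ≤ hφ.nrm G := by
  rw [← hφ.dφ_Iio ht, ← setLIntegral_const]
  exact (setLIntegral_mono hG.measurable fun x hx => hG.anti (le_of_lt hx)).trans
    (setLIntegral_le_lintegral _ _)

theorem QuasiConcave.lt_top_of_nrm {φ : ℝ → ℝ} (hφ : QuasiConcave φ) {G : ℝ → ℝ≥0∞} (hG : Decr G)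
    (h : hφ.nrm G < ∞) {t : ℝ} (ht : 0 < t) : G t < ∞ := by
  by_contra hc
  rw [not_lt, top_le_iff] at hc
  have := hφ.mul_le_nrm hG ht
  rw [hc, ENNReal.top_mul (by simpa using hφ.pos t ht)] at this
  exact absurd (this.trans_lt h) (lt_irrefl _)

theorem QuasiConcave.div_mul_min_le {φ : ℝ → ℝ} (hφ : QuasiConcave φ) {t d : ℝ} (ht : 0 < t)
    (hd : 0 < d) : φ t / t * min d t ≤ φ d := by
  rcases le_total d t with h | h
  · rw [min_eq_left h]
    exact (le_div_iff₀ hd).1 (hφ.anti hd ht h)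
  · rw [min_eq_right h, div_mul_cancel₀ _ ht.ne']
    exact hφ.mono ht hd h

/-- Functions of finite norm are integrable near 0 without any growth condition, since min(d,t) ≤
(t/φ(t)) φ(d). -/
theorem QuasiConcave.setLIntegral_lt_top {φ : ℝ → ℝ} (hφ : QuasiConcave φ) {G : ℝ → ℝ≥0∞}
    (hG : Decr G) (h : hφ.nrm G < ∞) {t : ℝ} (ht : 0 < t) : ∫⁻ r in Ioc 0 t, G r < ∞ := by
  have hp := hφ.pos t ht
  refine (hG.lintegral_le_of_Iio (ν₂ := hφ.dφ) (C := ENNReal.ofReal (t / φ t)) ?_ ?_).trans_lt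
    (ENNReal.mul_lt_top ENNReal.ofReal_lt_top h)
  · rw [Measure.restrict_apply measurableSet_Iio, show Iio (0 : ℝ) ∩ Ioc 0 t = ∅ from ?_,
      measure_empty]
    ext x
    simp only [mem_inter_iff, mem_Iio, mem_Ioc, mem_empty_iff_false, iff_false]
    exact fun h => absurd h.1 (not_lt.2 h.2.1.le)
  · intro d hd
    rw [Measure.restrict_apply measurableSet_Iio, hφ.dφ_Iio hd,
      ← ENNReal.ofReal_mul (by positivity)]
    refine (measure_mono (t := Icc 0 (min d t)) fun x hx =>
      ⟨hx.2.1.le, le_min (le_of_lt hx.1) hx.2.2⟩).trans ?_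
    rw [Real.volume_Icc, sub_zero]
    refine ENNReal.ofReal_le_ofReal ?_
    rw [div_mul_eq_mul_div, le_div_iff₀ hp]
    have := hφ.div_mul_min_le ht hd
    rw [div_mul_eq_mul_div, div_le_iff₀ ht] at this
    linarith

/-! ### The growth condition -/

/-- The growth condition `φ t ≥ C t log (1 + 1 / t)`. -/
def Growth (φ : ℝ → ℝ) : Prop :=
  ∃ C : ℝ, 0 < C ∧ ∀ t : ℝ, 0 < t → C * (t * Real.log (1 + 1 / t)) ≤ φ t

/-- 1 + log(t/d) is at most 1 + |log t| plus log(1/d); the constant part is absorbed because log(1 +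
1/d) ≥ log(1 + 1/t) > 0. -/
theorem log_div_le {t d : ℝ} (ht : 0 < t) (hd : 0 < d) (h : d ≤ t) :
    1 + Real.log (t / d) ≤ ((1 + |Real.log t|) / Real.log (1 + 1 / t) + 1) *
      Real.log (1 + 1 / d) := by
  have h1 : 0 < Real.log (1 + 1 / t) := Real.log_pos (by simpa using ht)
  have h2 : Real.log (1 + 1 / t) ≤ Real.log (1 + 1 / d) :=
    Real.log_le_log (by positivity) (by gcongr)
  have h3 : Real.log (1 / d) ≤ Real.log (1 + 1 / d) :=
    Real.log_le_log (by positivity) (by linarith)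
  have h4 : 1 + |Real.log t| ≤ (1 + |Real.log t|) / Real.log (1 + 1 / t) *
      Real.log (1 + 1 / d) := by
    rw [div_mul_eq_mul_div, le_div_iff₀ h1]
    gcongr
  rw [div_eq_mul_one_div, Real.log_mul ht.ne' (by positivity)]
  linarith [le_abs_self (Real.log t)]

/-- For d ≤ t this is the growth condition with a constant depending on t. For d ≥ t the left side
stays equal to t while φ(d) ≥ φ(t). -/
theorem QuasiConcave.exists_logMeasure_le {φ : ℝ → ℝ} (hφ : QuasiConcave φ) (hgr : Growth φ)
    {t : ℝ} (ht : 0 < t) :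
    ∃ C : ℝ≥0, ∀ d, 0 < d → logMeasure t (Iio d) ≤ C * hφ.dφ (Iio d) := by
  obtain ⟨C, hC, hgr⟩ := hgr
  have hp := hφ.pos t ht
  set A := (1 + |Real.log t|) / Real.log (1 + 1 / t) + 1 with hA
  have h1 : 0 < Real.log (1 + 1 / t) := Real.log_pos (by simpa using ht)
  have hA0 : 0 ≤ A := by positivity
  refine ⟨Real.toNNReal (max (A / C) (t / φ t)), fun d hd => ?_⟩
  have hM0 : 0 ≤ max (A / C) (t / φ t) := le_max_of_le_right (by positivity)
  rw [hφ.dφ_Iio hd, ← ENNReal.ofReal, ← ENNReal.ofReal_mul hM0]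
  have hpd := hφ.pos d hd
  rcases le_total d t with h | h
  · rw [logMeasure_Iio_of_ge hd h]
    refine ENNReal.ofReal_le_ofReal ?_
    calc d * (1 + Real.log (t / d)) ≤ d * (A * Real.log (1 + 1 / d)) := by
          gcongr; exact log_div_le ht hd h
      _ = A / C * (C * (d * Real.log (1 + 1 / d))) := by field_simp
      _ ≤ A / C * φ d := by gcongr; exact hgr d hd
      _ ≤ _ := by gcongr; exact le_max_left _ _
  · rw [logMeasure_Iio_of_le h]
    refine ENNReal.ofReal_le_ofReal ?_
    calc t = t / φ t * φ t := by field_simp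
      _ ≤ max (A / C) (t / φ t) * φ d := by
        gcongr
        · exact le_max_right _ _
        · exact hφ.mono ht hd h

theorem QuasiConcave.exists_avgInt_le {φ : ℝ → ℝ} (hφ : QuasiConcave φ) (hgr : Growth φ)
    {t : ℝ} (ht : 0 < t) : ∃ C : ℝ≥0, ∀ G, Decr G → avgInt G t ≤ C * hφ.nrm G := by
  obtain ⟨C, hC⟩ := hφ.exists_logMeasure_le hgr ht
  refine ⟨C, fun G hG => ?_⟩
  rw [avgInt_eq_lintegral hG.measurable]
  exact hG.lintegral_le_of_Iio (logMeasure_Iio_zero t) hC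

theorem QuasiConcave.avgInt_lt_top {φ : ℝ → ℝ} (hφ : QuasiConcave φ) (hgr : Growth φ)
    {G : ℝ → ℝ≥0∞} (hG : Decr G) (h : hφ.nrm G < ∞) {t : ℝ} (ht : 0 < t) : avgInt G t < ∞ := by
  obtain ⟨C, hC⟩ := hφ.exists_avgInt_le hgr ht
  exact (hC G hG).trans_lt (ENNReal.mul_lt_top ENNReal.coe_lt_top h)

/-- The upper limit of `d (1 + log (1 / d)) / φ d` at the origin. -/
noncomputable def critConst (φ : ℝ → ℝ) : ℝ :=
  limsup (fun d => d * (1 + Real.log (1 / d)) / φ d) (𝓝[>] 0)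

/-- The growth condition bounds d/φ(d) by 1/(C log(1 + 1/d)). This is what makes the critical
constant the same for all t. -/
theorem tendsto_div_zero {φ : ℝ → ℝ} (hφ : QuasiConcave φ) (hgr : Growth φ) :
    Tendsto (fun d => d / φ d) (𝓝[>] 0) (𝓝 0) := by
  obtain ⟨C, hC, hgr⟩ := hgr
  have h1 : Tendsto (fun d : ℝ => (C * Real.log (1 + 1 / d))⁻¹) (𝓝[>] 0) (𝓝 0) := by
    refine tendsto_inv_atTop_zero.comp (Tendsto.const_mul_atTop hC
      (Real.tendsto_log_atTop.comp (tendsto_atTop_add_const_left _ _ ?_)))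
    exact (tendsto_inv_nhdsGT_zero (𝕜 := ℝ)).congr fun x => (one_div x).symm
  refine tendsto_of_tendsto_of_tendsto_of_le_of_le' tendsto_const_nhds h1 ?_ ?_
  · filter_upwards [self_mem_nhdsWithin] with d hd
    exact div_nonneg (le_of_lt hd) (hφ.pos d hd).le
  · filter_upwards [self_mem_nhdsWithin] with d hd
    have hd : 0 < d := hd
    have h2 : 0 < Real.log (1 + 1 / d) := Real.log_pos (by simpa using hd)
    rw [div_le_iff₀ (hφ.pos d hd), inv_mul_eq_div, le_div_iff₀ (by positivity)]
    have := hgr d hd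
    linarith

theorem isBoundedUnder_ratio {φ : ℝ → ℝ} (hφ : QuasiConcave φ) (hgr : Growth φ) :
    IsBoundedUnder (· ≤ ·) (𝓝[>] 0) (fun d => d * (1 + Real.log (1 / d)) / φ d) := by
  obtain ⟨C, hC⟩ := hφ.exists_logMeasure_le hgr one_pos
  refine ⟨C, eventually_map.2 ?_⟩
  filter_upwards [Ioo_mem_nhdsGT one_pos] with d hd
  have := hC d hd.1
  rw [logMeasure_Iio_of_ge hd.1 hd.2.le, hφ.dφ_Iio hd.1, ← ENNReal.ofReal_coe_nnreal,
    ← ENNReal.ofReal_mul C.coe_nonneg] at this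
  rw [div_le_iff₀ (hφ.pos d hd.1)]
  exact (ENNReal.ofReal_le_ofReal_iff (mul_nonneg C.coe_nonneg (hφ.pos d hd.1).le)).1 this

theorem ratio_nonneg {φ : ℝ → ℝ} (hφ : QuasiConcave φ) :
    ∀ᶠ d in 𝓝[>] 0, 0 ≤ d * (1 + Real.log (1 / d)) / φ d := by
  filter_upwards [Ioo_mem_nhdsGT one_pos] with d hd
  have : 0 ≤ Real.log (1 / d) := Real.log_nonneg ((one_le_div hd.1).2 hd.2.le)
  have := hφ.pos d hd.1
  have := hd.1
  positivity

theorem isCoboundedUnder_ratio {φ : ℝ → ℝ} (hφ : QuasiConcave φ) :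
    IsCoboundedUnder (· ≤ ·) (𝓝[>] 0) (fun d => d * (1 + Real.log (1 / d)) / φ d) :=
  IsBoundedUnder.isCoboundedUnder_flip ⟨0, eventually_map.2 (ratio_nonneg hφ)⟩

theorem critConst_nonneg {φ : ℝ → ℝ} (hφ : QuasiConcave φ) (hgr : Growth φ) :
    0 ≤ critConst φ :=
  le_limsup_of_frequently_le (ratio_nonneg hφ).frequently (isBoundedUnder_ratio hφ hgr)

/-- All dependence on t sits in (d/φ(d)) log t, which vanishes as d → 0. -/
theorem mul_log_div {t d : ℝ} (φd : ℝ) (ht : 0 < t) (hd : 0 < d) :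
    d * (1 + Real.log (t / d)) / φd =
      d * (1 + Real.log (1 / d)) / φd + d / φd * Real.log t := by
  rw [div_eq_mul_one_div t d, Real.log_mul ht.ne' (by positivity)]
  ring

/-- Near the origin, ∫_0^t SG costs at most κ per unit of norm, for any κ above the critical
constant; this bounds what escaping mass can carry away. -/
theorem QuasiConcave.logMeasure_le_of_critConst_lt {φ : ℝ → ℝ} (hφ : QuasiConcave φ)
    (hgr : Growth φ) {t κ : ℝ} (ht : 0 < t) (hκ : critConst φ < κ) :
    ∃ δ, 0 < δ ∧ ∀ d, 0 < d → d ≤ δ →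
      logMeasure t (Iio d) ≤ ENNReal.ofReal κ * hφ.dφ (Iio d) := by
  obtain ⟨κ', h1, h2⟩ := exists_between hκ
  have e1 := eventually_lt_of_limsup_lt h1 (isBoundedUnder_ratio hφ hgr)
  have e2 : Tendsto (fun d => d / φ d * Real.log t) (𝓝[>] 0) (𝓝 0) := by
    simpa using (tendsto_div_zero hφ hgr).mul_const (Real.log t)
  have e3 := (e1.and (e2.eventually_lt_const (sub_pos.2 h2))).and (Ioo_mem_nhdsGT ht)
  obtain ⟨δ, hδ, hsub⟩ := mem_nhdsGT_iff_exists_Ioc_subset.1 e3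
  refine ⟨δ, hδ, fun d hd hdδ => ?_⟩
  obtain ⟨⟨h3, h4⟩, h5⟩ := hsub ⟨hd, hdδ⟩
  have hκ0 := (critConst_nonneg hφ hgr).trans hκ.le
  rw [logMeasure_Iio_of_ge hd h5.2.le, hφ.dφ_Iio hd, ← ENNReal.ofReal_mul hκ0]
  refine ENNReal.ofReal_le_ofReal ?_
  rw [← div_le_iff₀ (hφ.pos d hd), mul_log_div _ ht hd]
  linarith

/-- The converse: arbitrarily short initial intervals achieve a rate κ below the critical constant,
and one of them is returned. -/
theorem QuasiConcave.exists_le_logMeasure_of_lt_critConst {φ : ℝ → ℝ} (hφ : QuasiConcave φ)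
    (hgr : Growth φ) {b κ : ℝ} (hb : 0 < b) (hκ0 : 0 ≤ κ) (hκ : κ < critConst φ) :
    ∃ a, 0 < a ∧ ENNReal.ofReal κ * ENNReal.ofReal (φ a) ≤ logMeasure b (Iio a) := by
  obtain ⟨κ', h1, h2⟩ := exists_between hκ
  have e1 := frequently_lt_of_lt_limsup (isCoboundedUnder_ratio hφ) h2
  have e2 : Tendsto (fun d => d / φ d * Real.log b) (𝓝[>] 0) (𝓝 0) := by
    simpa using (tendsto_div_zero hφ hgr).mul_const (Real.log b)
  obtain ⟨a, h3, h4, h5⟩ := (e1.and_eventually ((e2.eventually_const_lt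
    (show κ - κ' < 0 by linarith)).and (Ioo_mem_nhdsGT hb))).exists
  refine ⟨a, h5.1, ?_⟩
  rw [logMeasure_Iio_of_ge h5.1 h5.2.le, ← ENNReal.ofReal_mul hκ0]
  refine ENNReal.ofReal_le_ofReal ?_
  rw [← le_div_iff₀ (hφ.pos a h5.1), mul_log_div _ hb h5.1]
  linarith

/-! ### Limits of decreasing functions -/

/-- Helly's selection principle for `[0, ∞]`-valued decreasing functions. -/
theorem exists_subseq_tendsto {G : ℕ → ℝ → ℝ≥0∞} (hG : ∀ n, Decr (G n)) :
    ∃ ψ : ℕ → ℕ, StrictMono ψ ∧ ∃ K, Decr K ∧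
      (∀ t, K t ≤ liminf (fun k => G (ψ k) t) atTop) ∧
      ∀ᵐ t : ℝ, Tendsto (fun k => G (ψ k) t) atTop (𝓝 (K t)) := by
  -- Sequential compactness of [0,∞]^ℚ replaces the diagonal argument.
  obtain ⟨x, ψ, hψ, hx⟩ := CompactSpace.tendsto_subseq fun n => fun q : ℚ => G n q
  rw [tendsto_pi_nhds] at hx
  -- Using only rationals strictly to the right of t makes K right-continuous and at most the lower
  -- limit at every point; at continuity points of K it is the limit.
  set K : ℝ → ℝ≥0∞ := fun t => ⨆ (q : ℚ) (_ : t < q), x q with hK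
  have hKanti : Antitone K := fun a b hab =>
    iSup_mono fun q => iSup_le fun hq => le_iSup_of_le (hab.trans_lt hq) le_rfl
  have hlow : ∀ t, K t ≤ liminf (fun k => G (ψ k) t) atTop := by
    intro t
    refine iSup₂_le fun q hq => ?_
    rw [← (hx q).liminf_eq]
    exact liminf_le_liminf (.of_forall fun k => (hG (ψ k)).anti hq.le)
  refine ⟨ψ, hψ, K, ⟨hKanti, ?_⟩, hlow, ?_⟩
  · rw [lowerSemicontinuous_iff_isOpen_preimage]
    intro s
    have : K ⁻¹' Ioi s = ⋃ (q : ℚ) (_ : s < x q), Iio (q : ℝ) := by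
      ext t
      simp only [hK, mem_preimage, mem_Ioi, lt_iSup_iff, mem_iUnion, mem_Iio]
      exact ⟨fun ⟨q, h1, h2⟩ => ⟨q, h2, h1⟩, fun ⟨q, h1, h2⟩ => ⟨q, h2, h1⟩⟩
    rw [this]
    exact isOpen_biUnion fun _ _ => isOpen_Iio
  · filter_upwards [hKanti.countable_not_continuousAt.ae_notMem volume] with t ht
    have hc : ContinuousAt K t := not_not.1 ht
    refine tendsto_of_le_liminf_of_limsup_le (hlow t)
      (le_of_forall_gt_imp_ge_of_dense fun c hct => ?_)
    obtain ⟨s, hs, hst⟩ := (((hc.eventually_lt_const hct).filter_mono nhdsWithin_le_nhds).and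
      (eventually_mem_nhdsWithin (s := Iio t))).exists
    obtain ⟨q, h1, h2⟩ := exists_rat_btwn (mem_Iio.1 hst)
    have h3 : x q ≤ K s := le_iSup₂_of_le q h1 le_rfl
    refine le_trans ?_ (h3.trans hs.le)
    rw [← (hx q).limsup_eq]
    exact limsup_le_limsup (.of_forall fun k => (hG (ψ k)).anti h2.le)

theorem avgInt_const (c : ℝ≥0∞) (t : ℝ) : avgInt (fun _ => c) t = c * ENNReal.ofReal t := by
  have : ∀ s ∈ Ioc 0 t, avg (fun _ => c) s = c := fun s hs => by
    rw [avg, setLIntegral_const, Real.volume_Ioc, sub_zero, mul_left_comm,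
      ENNReal.inv_mul_cancel (by simpa using hs.1) (by simp), mul_one]
  rw [avgInt, setLIntegral_congr_fun measurableSet_Ioc this, setLIntegral_const, Real.volume_Ioc,
    sub_zero]

/-- Truncation at c supplies the dominating constant, integrable because the logarithmic measure is
finite. -/
theorem tendsto_avgInt_min {G : ℕ → ℝ → ℝ≥0∞} (hG : ∀ n, Decr (G n)) {K : ℝ → ℝ≥0∞}
    (hK : Measurable K) (hlim : ∀ᵐ t : ℝ, Tendsto (fun k => G k t) atTop (𝓝 (K t)))
    {c : ℝ≥0∞} (hc : c ≠ ∞) (t : ℝ) :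
    Tendsto (fun k => avgInt (fun x => min (G k x) c) t) atTop
      (𝓝 (avgInt (fun x => min (K x) c) t)) := by
  have hm : ∀ k, Measurable fun x => min (G k x) c := fun k =>
    (hG k).measurable.min measurable_const
  simp_rw [fun k => avgInt_eq_lintegral (hm k), avgInt_eq_lintegral (hK.min measurable_const)]
  refine tendsto_lintegral_of_dominated_convergence (fun _ => c) hm
    (fun k => .of_forall fun x => min_le_right _ _) ?_ ?_
  · rw [← avgInt_eq_lintegral measurable_const, avgInt_const]
    exact ENNReal.mul_ne_top hc ENNReal.ofReal_ne_top
  · have hac : logMeasure t ≪ volume :=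
      (withDensity_absolutelyContinuous _ _).trans Measure.absolutelyContinuous_restrict
    filter_upwards [hac.ae_le hlim] with x hx
    exact hx.min tendsto_const_nhds

/-- Split G into (G − c)₊ and min(G,c). The first part vanishes from δ on, so it contributes at most
κ times its norm, and that norm is at most M minus the norm of the truncation. -/
theorem QuasiConcave.add_nrm_min_le {φ : ℝ → ℝ} (hφ : QuasiConcave φ) {G : ℝ → ℝ≥0∞}
    (hG : Decr G) {M c κ h : ℝ≥0∞} (hM : hφ.nrm G ≤ M) {t δ : ℝ} (hδ : G δ ≤ c)
    (hκ : ∀ d, 0 < d → d ≤ δ → logMeasure t (Iio d) ≤ κ * hφ.dφ (Iio d))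
    (hle : h ≤ avgInt G t) :
    h + κ * hφ.nrm (fun x => min (G x) c) ≤ κ * M + avgInt (fun x => min (G x) c) t := by
  have hk := hG.sub_const c
  have hm : Measurable fun x => min (G x) c := hG.measurable.min measurable_const
  have hsplit : G = fun x => (G x - c) + min (G x) c := by
    ext x; exact tsub_add_min.symm
  have h1 : avgInt G t ≤ κ * hφ.nrm (fun x => G x - c) + avgInt (fun x => min (G x) c) t := by
    conv_lhs => rw [hsplit]
    rw [avgInt_add hk.measurable hm]
    gcongr
    rw [avgInt_eq_lintegral hk.measurable]
    exact hk.lintegral_le_of_Iio_le (logMeasure_Iio_zero t) (tsub_eq_zero_of_le hδ) hκ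
  have h2 : hφ.nrm (fun x => G x - c) + hφ.nrm (fun x => min (G x) c) ≤ M := by
    refine le_trans (le_of_eq ?_) hM
    conv_rhs => rw [hsplit]
    exact (lintegral_add_left hk.measurable _).symm
  calc h + κ * hφ.nrm (fun x => min (G x) c)
      ≤ κ * hφ.nrm (fun x => G x - c) + avgInt (fun x => min (G x) c) t +
        κ * hφ.nrm (fun x => min (G x) c) := by gcongr; exact hle.trans h1
    _ = κ * (hφ.nrm (fun x => G x - c) + hφ.nrm (fun x => min (G x) c)) +
        avgInt (fun x => min (G x) c) t := by ring
    _ ≤ _ := by gcongr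

theorem QuasiConcave.nrm_eq_iSup_min {φ : ℝ → ℝ} (hφ : QuasiConcave φ) {K : ℝ → ℝ≥0∞}
    (hK : Measurable K) : hφ.nrm K = ⨆ n : ℕ, hφ.nrm fun x => min (K x) n := by
  unfold QuasiConcave.nrm
  rw [← lintegral_iSup (fun n => hK.min measurable_const)]
  · refine lintegral_congr fun x => ?_
    have h : (⨆ n : ℕ, min (K x) (n : ℝ≥0∞)) = min (K x) (⨆ n : ℕ, (n : ℝ≥0∞)) :=
      (inf_iSup_eq _ _).symm
    rw [h, ENNReal.iSup_natCast, min_eq_left le_top]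
  · intro m n hmn x
    exact min_le_min_left _ (by exact_mod_cast hmn)

/-- Truncated parts pass to the limit by dominated convergence and Fatou; unbounded peaks can only
sit near 0, where they are worth at most the critical constant per unit of norm. The norm of K is
written on the left to avoid subtraction in [0,∞]. -/
theorem QuasiConcave.exists_limit {φ : ℝ → ℝ} (hφ : QuasiConcave φ) (hgr : Growth φ)
    {G : ℕ → ℝ → ℝ≥0∞} (hG : ∀ n, Decr (G n)) {M : ℝ≥0∞} (hM : M ≠ ∞)
    (hn : ∀ n, hφ.nrm (G n) ≤ M) {h : ℕ → ℝ → ℝ≥0∞} (hmono : ∀ t, Monotone fun n => h n t)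
    (hle : ∀ n t, 0 < t → h n t ≤ avgInt (G n) t) :
    ∃ K, Decr K ∧ hφ.nrm K ≤ M ∧ ∀ t, 0 < t → (⨆ n, h n t) +
      ENNReal.ofReal (critConst φ) * hφ.nrm K ≤
        ENNReal.ofReal (critConst φ) * M + avgInt K t := by
  obtain ⟨ψ, hψ, K, hK, hlow, hlim⟩ := exists_subseq_tendsto hG
  have hKM : hφ.nrm K ≤ M := by
    refine (lintegral_mono hlow).trans ((lintegral_liminf_le fun k => (hG _).measurable).trans ?_)
    exact liminf_le_of_frequently_le' (Frequently.of_forall fun k => hn _)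
  refine ⟨K, hK, hKM, fun t ht => ?_⟩
  rw [ENNReal.iSup_add]
  refine iSup_le fun j => ?_
  have key : ∀ κ, critConst φ < κ →
      h j t + ENNReal.ofReal κ * hφ.nrm K ≤ ENNReal.ofReal κ * M + avgInt K t := by
    intro κ hκ
    obtain ⟨δ, hδ, hδ'⟩ := hφ.logMeasure_le_of_critConst_lt hgr ht hκ
    rw [hφ.nrm_eq_iSup_min hK.measurable, ENNReal.mul_iSup, ENNReal.add_iSup]
    refine iSup_le fun n => ?_
    have hp := hφ.pos δ hδ
    -- The bound c ≥ n recovers K as n grows; c ≥ M/φ(δ) forces every G k to be at most c from δ on.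
    set c : ℝ≥0∞ := max n (M / ENNReal.ofReal (φ δ)) with hc
    have hctop : c ≠ ∞ := by
      rw [hc, ← lt_top_iff_ne_top, max_lt_iff]
      exact ⟨ENNReal.natCast_lt_top n, ENNReal.div_lt_top hM (by simpa using hp)⟩
    have hGδ : ∀ k, G k δ ≤ c := fun k => by
      refine le_trans ?_ (le_max_right _ _)
      rw [ENNReal.le_div_iff_mul_le (.inl (by simpa using hp)) (.inl ENNReal.ofReal_ne_top)]
      exact (hφ.mul_le_nrm (hG k) hδ).trans (hn k)
    have hev : ∀ k ≥ j, h j t + ENNReal.ofReal κ * hφ.nrm (fun x => min (G (ψ k) x) c) ≤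
        ENNReal.ofReal κ * M + avgInt (fun x => min (G (ψ k) x) c) t := fun k hk =>
      hφ.add_nrm_min_le (hG _) (hn _) (hGδ _) hδ'
        ((hmono t (hk.trans (hψ.le_apply))).trans (hle _ t ht))
    have hlimA := (tendsto_avgInt_min (fun k => hG (ψ k)) hK.measurable hlim hctop t).const_add
      (ENNReal.ofReal κ * M)
    have hliminf : hφ.nrm (fun x => min (K x) c) ≤
        liminf (fun k => hφ.nrm fun x => min (G (ψ k) x) c) atTop := by
      refine le_trans (lintegral_mono fun x => ?_)
        (lintegral_liminf_le fun k => (hG (ψ k)).measurable.min measurable_const)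
      refine le_of_forall_lt fun a ha => ?_
      obtain ⟨b, hab, hb⟩ := exists_between ha
      refine lt_of_lt_of_le hab (le_liminf_of_le (by isBoundedDefault) ?_)
      filter_upwards [eventually_lt_of_lt_liminf ((hb.trans_le (min_le_left _ _)).trans_le
        (hlow x))] with k hk
      exact le_min hk.le (hb.le.trans (min_le_right _ _))
    set F : ℝ≥0∞ → ℝ≥0∞ := fun a => h j t + ENNReal.ofReal κ * a with hF
    have hFmono : Monotone F := fun a b hab => by simp only [hF]; gcongr
    have hFcont : Continuous F :=
      continuous_const.add (ENNReal.continuous_const_mul ENNReal.ofReal_ne_top)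
    have h1 : F (hφ.nrm fun x => min (K x) c) ≤
        ENNReal.ofReal κ * M + avgInt (fun x => min (K x) c) t := by
      refine (hFmono hliminf).trans ?_
      rw [hFmono.map_liminf_of_continuousAt _ hFcont.continuousAt, ← hlimA.liminf_eq]
      refine liminf_le_liminf ?_
      filter_upwards [eventually_ge_atTop j] with k hk using hev k hk
    refine le_trans (hFmono (hφ.nrm_mono fun x _ => min_le_min_left _ (le_max_left _ _)))
      (h1.trans ?_)
    gcongr
    exact avgInt_mono (fun x => min_le_left _ _) t
  have hKtop : hφ.nrm K ≠ ∞ := (hKM.trans_lt (lt_top_iff_ne_top.2 hM)).ne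
  -- Now κ decreases to the critical constant; the finite norms make both sides continuous in κ.
  have hl : ∀ a : ℝ≥0∞, a ≠ ∞ → Tendsto (fun κ => ENNReal.ofReal κ * a) (𝓝[>] (critConst φ))
      (𝓝 (ENNReal.ofReal (critConst φ) * a)) := fun a ha =>
    ((ENNReal.continuous_mul_const ha).comp ENNReal.continuous_ofReal).continuousAt.mono_left
      nhdsWithin_le_nhds
  refine le_of_tendsto_of_tendsto ((hl _ hKtop).const_add _) ((hl _ hM).add_const _) ?_
  filter_upwards [self_mem_nhdsWithin] with κ hκ using key κ hκ

/-- A constant deficit κN cannot be matched exactly near t = 0 by an average, but there h itself is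
small. Infinitely many short indicators with geometrically decreasing norms cover the full deficit
for large t and the smallness of h for small t. -/
theorem QuasiConcave.exists_correction {φ : ℝ → ℝ} (hφ : QuasiConcave φ) (hgr : Growth φ)
    {h : ℝ → ℝ≥0∞} (hmono : Monotone h) (h0 : Tendsto h (𝓝[>] 0) (𝓝 0)) {N ε : ℝ≥0∞}
    (hN : N ≠ ∞) (hε : ε ≠ ∞) (hε0 : ε ≠ 0) {A : ℝ → ℝ≥0∞}
    (hle : ∀ t, 0 < t → h t ≤ ENNReal.ofReal (critConst φ) * N + A t) :
    ∃ k, Decr k ∧ hφ.nrm k ≤ N + ε ∧ ∀ t, 0 < t → h t ≤ avgInt k t + A t := by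
  rcases (critConst_nonneg hφ hgr).eq_or_lt with hκ | hκ
  · refine ⟨fun _ => 0, decr_zero, by simp [QuasiConcave.nrm], fun t ht => ?_⟩
    have := hle t ht
    rw [← hκ, ENNReal.ofReal_zero, zero_mul, zero_add] at this
    exact this.trans le_add_self
  set S := N + ε with hS
  have hStop : S ≠ ∞ := ENNReal.add_ne_top.2 ⟨hN, hε⟩
  have hS0 : S ≠ 0 := by simp [hS, hε0]
  -- The slack ε in S = N + ε pays for replacing the critical constant by a smaller κ; the factor
  -- 1/2 keeps κ positive when N = 0.
  obtain ⟨κ, hκ0, hκlt, hκN⟩ : ∃ κ, 0 < κ ∧ κ < critConst φ ∧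
      ENNReal.ofReal (critConst φ) * N ≤ ENNReal.ofReal κ * S := by
    have hs : 0 < S.toReal := ENNReal.toReal_pos hS0 hStop
    have hns : N.toReal < S.toReal := by
      rw [hS, ENNReal.toReal_add hN hε]
      linarith [ENNReal.toReal_pos hε0 hε]
    refine ⟨critConst φ * max (N.toReal / S.toReal) (1 / 2), by positivity, ?_, ?_⟩
    · refine mul_lt_of_lt_one_right hκ (max_lt ((div_lt_one hs).2 hns) (by norm_num))
    · have h1 : critConst φ * N.toReal ≤
          critConst φ * max (N.toReal / S.toReal) (1 / 2) * S.toReal := by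
        rw [mul_assoc]
        refine mul_le_mul_of_nonneg_left ?_ hκ.le
        rw [← div_le_iff₀ hs]
        exact le_max_left _ _
      have h2 := ENNReal.ofReal_le_ofReal h1
      rwa [ENNReal.ofReal_mul hκ.le, ENNReal.ofReal_mul (by positivity),
        ENNReal.ofReal_toReal hN, ENNReal.ofReal_toReal hStop] at h2
  have hκ0' : ENNReal.ofReal κ ≠ 0 := by simpa using hκ0
  obtain ⟨u, huanti, hupos, hulim⟩ := exists_seq_strictAnti_tendsto (0 : ℝ)
  have hu : Tendsto u atTop (𝓝[>] 0) :=
    tendsto_nhdsWithin_iff.2 ⟨hulim, .of_forall hupos⟩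
  -- Scales u (ψ i) tending to 0 at which h is already at most κ S 2^{-(i+1)}.
  obtain ⟨ψ, hψ, hψh⟩ := extraction_forall_of_eventually
    (P := fun i n => h (u n) ≤ ENNReal.ofReal κ * S * 2⁻¹ ^ (i + 1)) fun i => by
      refine ((h0.comp hu).eventually_lt_const (u := ENNReal.ofReal κ * S * 2⁻¹ ^ (i + 1)) ?_).mono
        fun n hn => hn.le
      exact pos_iff_ne_zero.2 (mul_ne_zero (mul_ne_zero hκ0' hS0) (pow_ne_zero _ (by simp)))
  choose a ha0 ha using fun i => hφ.exists_le_logMeasure_of_lt_critConst hgr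
    (hupos (ψ i)) hκ0.le hκlt
  have hp : ∀ i, ENNReal.ofReal (φ (a i)) ≠ 0 := fun i => by simpa using hφ.pos _ (ha0 i)
  set w : ℕ → ℝ≥0∞ := fun i => S * 2⁻¹ ^ (i + 1) / ENNReal.ofReal (φ (a i)) with hw
  have hwtop : ∀ i, w i ≠ ∞ := fun i =>
    ENNReal.div_ne_top (ENNReal.mul_ne_top hStop (by simp)) (hp i)
  have hwmul : ∀ i, w i * ENNReal.ofReal (φ (a i)) = S * 2⁻¹ ^ (i + 1) := fun i =>
    ENNReal.div_mul_cancel (hp i) ENNReal.ofReal_ne_top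
  have hgeom : ∀ m, ∑' i, S * 2⁻¹ ^ (m + i + 1) = S * 2⁻¹ ^ m := by
    intro m
    simp_rw [add_assoc, pow_add _ m, ENNReal.tsum_mul_left, pow_succ, ENNReal.tsum_mul_right,
      ENNReal.tsum_geometric, ENNReal.one_sub_inv_two]
    simp [ENNReal.mul_inv_cancel]
  -- The i-th indicator is normalised to norm S 2^{-(i+1)}. For t ≥ u (ψ m) each term with i ≥ m
  -- yields at least κ times its norm, hence κ S 2^{-m} in total.
  set k : ℝ → ℝ≥0∞ := fun x => ∑' i, w i * (Iio (a i)).indicator 1 x with hk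
  have hdec : ∀ i, Decr fun x => w i * (Iio (a i)).indicator 1 x := fun i =>
    (decr_indicator_Iio (a i)).const_mul (hwtop i)
  have hkint : ∀ ν : Measure ℝ, ∫⁻ x, k x ∂ν = ∑' i, w i * ν (Iio (a i)) := fun ν => by
    rw [hk, lintegral_tsum fun i => (hdec i).measurable.aemeasurable]
    refine tsum_congr fun i => ?_
    rw [lintegral_const_mul _ (decr_indicator_Iio (a i)).measurable,
      lintegral_indicator_one measurableSet_Iio]
  have htail : ∀ m t, u (ψ m) ≤ t → ENNReal.ofReal κ * S * 2⁻¹ ^ m ≤ avgInt k t := by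
    intro m t hmt
    rw [avgInt_eq_lintegral (Decr.tsum hdec).measurable, hkint, mul_assoc, ← hgeom,
      ← ENNReal.tsum_mul_left]
    have hinj : Function.Injective fun i : ℕ => m + i := add_right_injective m
    refine le_trans (ENNReal.tsum_le_tsum fun i => ?_)
      (ENNReal.tsum_comp_le_tsum_of_injective hinj fun i => w i * logMeasure t (Iio (a i)))
    rw [← hwmul, mul_left_comm]
    refine mul_le_mul_right ((ha (m + i)).trans ?_) _
    rw [logMeasure_Iio, logMeasure_Iio]
    exact avgInt_monotone _ ((huanti.antitone (hψ.monotone (Nat.le_add_right m i))).trans hmt)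
  refine ⟨k, Decr.tsum hdec, ?_, fun t ht => ?_⟩
  · rw [QuasiConcave.nrm, hkint]
    refine le_of_eq ?_
    simp_rw [fun i => hφ.dφ_Iio (ha0 i), hwmul]
    simpa using hgeom 0
  · have hex : ∃ i, u (ψ i) ≤ t :=
      (((hulim.comp hψ.tendsto_atTop).eventually_lt_const ht).exists).imp fun _ h => h.le
    classical
    -- If t ≥ u (ψ 0), all of κS is available and covers the deficit. Otherwise t lies between two
    -- consecutive scales, and the tail from m + 1 alone dominates h(t).
    rcases hm : Nat.find hex with _ | m
    · have := Nat.find_spec hex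
      rw [hm] at this
      have h1 := htail 0 t this
      rw [pow_zero, mul_one] at h1
      exact (hle t ht).trans (add_le_add_left (hκN.trans h1) _)
    · have h2 := Nat.find_spec hex
      rw [hm] at h2
      have h1 := htail (m + 1) t h2
      have h3 : t < u (ψ m) := not_le.1 (Nat.find_min hex (by omega))
      exact ((hmono h3.le).trans (hψh m)).trans (h1.trans le_self_add)

/-! ### The range norm through the cone of decreasing functions -/

/-- `G` is a right-continuous decreasing function whose Hardy average dominates `f` in the sense
of Hardy, Littlewood and Pólya. -/
def Dominates (G f : ℝ → ℝ≥0∞) : Prop :=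
  Decr G ∧ ∀ t, 0 < t → ∫⁻ s in Ioc 0 t, rearr f s ≤ avgInt G t

theorem le_avg {G : ℝ → ℝ≥0∞} (hG : Antitone G) {a : ℝ} (ha : 0 < a) : G a ≤ avg G a := by
  rw [avg, ← ENNReal.div_eq_inv_mul, ENNReal.le_div_iff_mul_le (by simp [ha]) (by simp),
    ← sub_zero a, ← Real.volume_Ioc, sub_zero, ← setLIntegral_const]
  exact setLIntegral_mono hG.measurable fun x hx => hG hx.2

theorem avg_antitoneOn {G : ℝ → ℝ≥0∞} (hG : Antitone G) : AntitoneOn (avg G) (Ioi 0) := by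
  intro a ha b hb hab
  have ha : 0 < a := ha
  have hb : 0 < b := hb
  have h1 : ENNReal.ofReal a * avg G a = ∫⁻ r in Ioc 0 a, G r := by
    rw [avg, ← mul_assoc, ENNReal.mul_inv_cancel (by simpa using ha) (by simp), one_mul]
  have h2 : G a ≤ avg G a := le_avg hG ha
  have h3 : ∫⁻ r in Ioc 0 b, G r ≤ ENNReal.ofReal b * avg G a := by
    rw [← Ioc_union_Ioc_eq_Ioc ha.le hab, lintegral_union measurableSet_Ioc
      (Ioc_disjoint_Ioc_of_le le_rfl), ← h1]
    have h4 : ∫⁻ r in Ioc a b, G r ≤ avg G a * ENNReal.ofReal (b - a) := by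
      rw [← Real.volume_Ioc, ← setLIntegral_const]
      exact setLIntegral_mono measurable_const fun x hx => (hG hx.1.le).trans h2
    refine (add_le_add_right h4 _).trans (le_of_eq ?_)
    rw [mul_comm (avg G a), ← add_mul, ← ENNReal.ofReal_add ha.le (sub_nonneg.2 hab)]
    congr 2; ring
  rw [avg, ← ENNReal.div_eq_inv_mul]
  exact ENNReal.div_le_of_le_mul' h3

theorem measurable_avg {G : ℝ → ℝ≥0∞} : Measurable (avg G) := by
  have : Monotone fun t => ∫⁻ r in Ioc 0 t, G r := fun a b h =>
    lintegral_mono_set (Ioc_subset_Ioc_right h)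
  exact (ENNReal.measurable_ofReal.inv).mul this.measurable

theorem absFun_hardy_le {f : ℝ → ℝ} (hf : AEMeasurable f μ) {t : ℝ} (ht : 0 < t) :
    absFun (hardy f) t ≤ avg (rearr (absFun f)) t := by
  rw [absFun, hardy, enorm_mul, avg, intervalIntegral.integral_of_le ht.le]
  refine mul_le_mul' (le_of_eq ?_) ?_
  · rw [one_div, Real.enorm_of_nonneg (by positivity), ENNReal.ofReal_inv_of_pos ht]
  · refine (enorm_integral_le_lintegral_enorm _).trans ?_
    rw [← restrict_mu_Ioc]
    exact (setLIntegral_le_lintegral_rearr hf.enorm (mu_Ioc t).le).trans_eq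
      (by rw [restrict_mu_Ioc]; rfl)

/-- |Sf| ≤ S(f*) by Hardy-Littlewood, and S(f*) is already decreasing, so (Sf)* ≤ S(f*) pointwise.
-/
theorem dominates_hardy {f : ℝ → ℝ} (hf : AEMeasurable f μ) :
    Dominates (rearr (absFun f)) (absFun (hardy f)) := by
  refine ⟨decr_rearr _, fun t ht => ?_⟩
  refine setLIntegral_mono measurable_avg fun s hs => ?_
  exact (rearr_mono (ae_mu_of_forall fun x hx => absFun_hardy_le hf hx) s).trans
    (rearr_le_of_antitoneOn (avg_antitoneOn (rearr_antitone _)) hs.1)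

theorem dominates_of_mem_majorants {φ : ℝ → ℝ} {hφ : QuasiConcave φ} {f : ℝ → ℝ≥0∞} {g : ℝ → ℝ}
    (hg : g ∈ majorants hφ f) : Dominates (rearr (absFun g)) f :=
  ⟨decr_rearr _, fun t ht => ((maxRearr_le_iff ht).1 (hg.2.2 t ht)).trans
    ((dominates_hardy hg.2.1.1).2 t ht)⟩

theorem QuasiConcave.absFun_hardy_toReal {φ : ℝ → ℝ} (hφ : QuasiConcave φ) {G : ℝ → ℝ≥0∞}
    (hG : Decr G) (hfin : hφ.nrm G < ∞) {t : ℝ} (ht : 0 < t) :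
    absFun (hardy fun x => (G x).toReal) t = avg G t := by
  have h1 : ∫⁻ r in Ioc 0 t, ENNReal.ofReal (G r).toReal = ∫⁻ r in Ioc 0 t, G r :=
    setLIntegral_congr_fun measurableSet_Ioc fun r hr =>
      ENNReal.ofReal_toReal (hφ.lt_top_of_nrm hG hfin hr.1).ne
  rw [absFun, hardy, intervalIntegral.integral_of_le ht.le, enorm_mul, avg,
    integral_eq_lintegral_of_nonneg_ae (.of_forall fun _ => ENNReal.toReal_nonneg)
      hG.measurable.ennreal_toReal.aestronglyMeasurable, h1, one_div,
    Real.enorm_of_nonneg (by positivity), ENNReal.ofReal_inv_of_pos ht,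
    Real.enorm_of_nonneg ENNReal.toReal_nonneg,
    ENNReal.ofReal_toReal (hφ.setLIntegral_lt_top hG hfin ht).ne]

theorem QuasiConcave.lorentzNorm_toReal_le {φ : ℝ → ℝ} (hφ : QuasiConcave φ) {G : ℝ → ℝ≥0∞}
    (hG : Decr G) : lorentzNorm hφ (fun x => (G x).toReal) ≤ hφ.nrm G := by
  have hle : ∀ x, absFun (fun x => (G x).toReal) x ≤ G x := fun x => by
    rw [absFun, Real.enorm_of_nonneg ENNReal.toReal_nonneg]
    exact ENNReal.ofReal_toReal_le
  refine hφ.nrm_mono fun x hx => ?_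
  refine (rearr_mono (.of_forall hle) x).trans ?_
  -- The origin is treated separately since dφ may have an atom there.
  rcases hx.eq_or_lt with rfl | hx
  · rw [rearr_le_iff]
    refine le_of_eq_of_le (measure_eq_zero_iff_ae_notMem.2 (ae_mu_of_forall fun x hx => ?_)) zero_le
    exact not_lt.2 (hG.anti hx.le)
  · exact rearr_le_of_antitoneOn (hG.anti.antitoneOn _) hx

theorem Dominates.mem_majorants {φ : ℝ → ℝ} {hφ : QuasiConcave φ} {G f : ℝ → ℝ≥0∞}
    (h : Dominates G f) (hfin : hφ.nrm G < ∞) : (fun x => (G x).toReal) ∈ majorants hφ f := by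
  obtain ⟨hG, hdom⟩ := h
  refine ⟨fun a ha b hb hab => ?_, ⟨hG.measurable.ennreal_toReal.aemeasurable,
    (hφ.lorentzNorm_toReal_le hG).trans_lt hfin⟩, fun t ht => ?_⟩
  · exact ENNReal.toReal_mono (hφ.lt_top_of_nrm hG hfin ha).ne (hG.anti hab)
  · rw [maxRearr_le_iff ht]
    refine (hdom t ht).trans ?_
    have hae : absFun (hardy fun x => (G x).toReal) =ᵐ[μ] avg G :=
      ae_mu_of_forall fun x hx => hφ.absFun_hardy_toReal hG hfin hx
    rw [rearr_congr hae, avgInt, ← restrict_mu_Ioc]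
    exact (setLIntegral_le_lintegral_rearr measurable_avg.aemeasurable (mu_Ioc t).le).trans_eq
      (by rw [restrict_mu_Ioc])

/-- Passing from g to g* keeps the norm, and from G to its real values does not increase it.
Membership in L¹ + L^∞ is automatic, because ∫_0^1 SG is finite under the growth condition. -/
theorem rangeNorm_eq {φ : ℝ → ℝ} (hφ : QuasiConcave φ) (hgr : Growth φ) {f : ℝ → ℝ≥0∞}
    (hf : AEMeasurable f μ) :
    rangeNorm hφ f = ⨅ (G : ℝ → ℝ≥0∞) (_ : Dominates G f), hφ.nrm G := by
  apply le_antisymm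
  · refine le_iInf₂ fun G hG => ?_
    by_cases hfin : hφ.nrm G < ∞
    · refine iInf₂_le_of_le (fun x => (G x).toReal) ⟨?_, hG.mem_majorants hfin⟩
        (hφ.lorentzNorm_toReal_le hG.1)
      have h1 : ∫⁻ s in Ioc 0 1, rearr f s < ∞ :=
        (hG.2 1 one_pos).trans_lt (hφ.avgInt_lt_top hgr hG.1 hfin one_pos)
      have hfe : ∀ᵐ x ∂μ, f x < ∞ := by
        have hc := rearr_lt_top one_pos h1
        have h2 := le_self_add.trans (lintegral_sub_add_le_lintegral_rearr hf 1)
        filter_upwards [ae_lt_top' (hf.sub_const _) (h2.trans_lt h1).ne] with x hx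
        by_contra hx'
        rw [not_lt.1 hx' |> top_le_iff.1, ENNReal.top_sub hc.ne] at hx
        exact lt_irrefl _ hx
      have hae : f =ᵐ[μ] absFun fun x => (f x).toReal := by
        filter_upwards [hfe] with x hx
        rw [absFun, Real.enorm_of_nonneg ENNReal.toReal_nonneg, ENNReal.ofReal_toReal hx.ne]
      refine ⟨_, mem_L1AddLinfty hf.ennreal_toReal ?_, hae⟩
      rwa [← rearr_congr hae]
    · rw [not_lt.1 hfin |> top_le_iff.1]; exact le_top
  · refine le_iInf₂ fun g hg => ?_
    exact iInf₂_le_of_le _ (dominates_of_mem_majorants hg.2) le_rfl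

/-! ### The range norm is a rearrangement invariant Banach function norm -/

theorem Dominates.of_le {G f g : ℝ → ℝ≥0∞} (h : Dominates G g)
    (hfg : ∀ t, 0 < t → ∫⁻ s in Ioc 0 t, rearr f s ≤ ∫⁻ s in Ioc 0 t, rearr g s) :
    Dominates G f := ⟨h.1, fun t ht => (hfg t ht).trans (h.2 t ht)⟩

theorem rangeNorm_le {φ : ℝ → ℝ} {hφ : QuasiConcave φ} (hgr : Growth φ) {f G : ℝ → ℝ≥0∞}
    (hf : AEMeasurable f μ) (hG : Dominates G f) : rangeNorm hφ f ≤ hφ.nrm G := by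
  rw [rangeNorm_eq hφ hgr hf]
  exact iInf₂_le G hG

theorem exists_dominates {φ : ℝ → ℝ} {hφ : QuasiConcave φ} (hgr : Growth φ) {f : ℝ → ℝ≥0∞}
    (hf : AEMeasurable f μ) {c : ℝ≥0∞} (hc : rangeNorm hφ f < c) :
    ∃ G, Dominates G f ∧ hφ.nrm G < c := by
  rw [rangeNorm_eq hφ hgr hf] at hc
  simpa [iInf_lt_iff] using hc

theorem rangeNorm_mono {φ : ℝ → ℝ} {hφ : QuasiConcave φ} (hgr : Growth φ) {f g : ℝ → ℝ≥0∞}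
    (hf : AEMeasurable f μ) (hg : AEMeasurable g μ)
    (hfg : ∀ t, 0 < t → ∫⁻ s in Ioc 0 t, rearr f s ≤ ∫⁻ s in Ioc 0 t, rearr g s) :
    rangeNorm hφ f ≤ rangeNorm hφ g := by
  rw [rangeNorm_eq hφ hgr hg]
  exact le_iInf₂ fun G hG => rangeNorm_le hgr hf (hG.of_le hfg)

theorem exists_lintegral_rearr_le {φ : ℝ → ℝ} (hφ : QuasiConcave φ) (hgr : Growth φ) {t : ℝ}
    (ht : 0 < t) : ∃ C : ℝ≥0, ∀ f, AEMeasurable f μ →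
      ∫⁻ s in Ioc 0 t, rearr f s ≤ C * rangeNorm hφ f := by
  obtain ⟨C, hC⟩ := hφ.exists_avgInt_le hgr ht
  -- A nonzero constant is needed to move the multiplication inside the infimum.
  refine ⟨C + 1, fun f hf => ?_⟩
  rw [rangeNorm_eq hφ hgr hf, iInf_subtype', ENNReal.mul_iInf_of_ne (by simp) (by simp)]
  refine le_iInf fun G => (G.2.2 t ht).trans ((hC _ G.2.1).trans (mul_le_mul_left ?_ _))
  exact_mod_cast le_self_add

theorem rearr_zero {f : ℝ → ℝ≥0∞} (hf : f =ᵐ[μ] 0) (t : ℝ) : rearr f t = 0 := by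
  rw [rearr_congr hf, ← nonpos_iff_eq_zero, rearr_le_iff]
  simp [distr]

theorem rangeNorm_eq_zero_iff {φ : ℝ → ℝ} (hφ : QuasiConcave φ) (hgr : Growth φ) {f : ℝ → ℝ≥0∞}
    (hf : AEMeasurable f μ) : rangeNorm hφ f = 0 ↔ f =ᵐ[μ] 0 := by
  constructor
  · intro h
    have h1 : distr f 0 = 0 := by
      by_contra hne
      obtain ⟨t, ht0, htd⟩ := ENNReal.lt_iff_exists_real_btwn.1 (pos_iff_ne_zero.2 hne)
      have ht : 0 < t := by simpa using htd.1
      obtain ⟨C, hC⟩ := exists_lintegral_rearr_le hφ hgr ht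
      have h2 := hC f hf
      rw [h, mul_zero] at h2
      have h3 : ∫⁻ _ in Ioc 0 t, rearr f t ≤ 0 :=
        (setLIntegral_mono (rearr_measurable f) fun x hx => rearr_antitone f hx.2).trans h2
      rw [setLIntegral_const, Real.volume_Ioc, sub_zero, nonpos_iff_eq_zero, mul_eq_zero] at h3
      rcases h3 with h3 | h3
      · exact absurd h3 (lt_rearr_iff.2 htd.2).ne'
      · exact absurd h3 htd.1.ne'
    filter_upwards [measure_eq_zero_iff_ae_notMem.1 h1] with x hx
    exact nonpos_iff_eq_zero.1 (not_lt.1 hx)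
  · intro h
    rw [← nonpos_iff_eq_zero]
    refine (rangeNorm_le hgr hf (G := fun _ => 0) ⟨decr_zero, fun t ht => ?_⟩).trans
      (by simp [QuasiConcave.nrm])
    simp [rearr_zero h]

theorem rearr_const_mul_le (a : ℝ≥0) (f : ℝ → ℝ≥0∞) (t : ℝ) :
    rearr (fun x => (a : ℝ≥0∞) * f x) t ≤ a * rearr f t := by
  rw [rearr_le_iff]
  refine le_trans (measure_mono fun x hx => ?_) (distr_rearr_le f t)
  exact lt_of_mul_lt_mul_left' (show (a : ℝ≥0∞) * rearr f t < a * f x from hx)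

theorem rangeNorm_const_mul_le {φ : ℝ → ℝ} (hφ : QuasiConcave φ) (hgr : Growth φ) (a : ℝ≥0)
    (ha : a ≠ 0) {f : ℝ → ℝ≥0∞} (hf : AEMeasurable f μ) :
    rangeNorm hφ (fun x => (a : ℝ≥0∞) * f x) ≤ a * rangeNorm hφ f := by
  rw [rangeNorm_eq hφ hgr hf, iInf_subtype', ENNReal.mul_iInf_of_ne (by simpa using ha) (by simp)]
  refine le_iInf fun ⟨G, hG⟩ => ?_
  refine (rangeNorm_le hgr (hf.const_mul _) (G := fun x => a * G x)
    ⟨hG.1.const_mul (by simp), fun t ht => ?_⟩).trans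
    (lintegral_const_mul _ hG.1.measurable).le
  rw [avgInt_eq_lintegral (hG.1.measurable.const_mul _), lintegral_const_mul _ hG.1.measurable,
    ← avgInt_eq_lintegral hG.1.measurable]
  refine (lintegral_mono fun s => rearr_const_mul_le a f s).trans ?_
  rw [lintegral_const_mul _ (rearr_measurable f)]
  exact mul_le_mul_right (hG.2 t ht) _

theorem rangeNorm_const_mul {φ : ℝ → ℝ} (hφ : QuasiConcave φ) (hgr : Growth φ) (a : ℝ≥0)
    {f : ℝ → ℝ≥0∞} (hf : AEMeasurable f μ) :
    rangeNorm hφ (fun x => (a : ℝ≥0∞) * f x) = a * rangeNorm hφ f := by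
  rcases eq_or_ne a 0 with rfl | ha
  · rw [ENNReal.coe_zero, zero_mul]
    refine (rangeNorm_eq_zero_iff hφ hgr (hf.const_mul _)).2 (.of_forall fun x => ?_)
    simp
  · refine le_antisymm (rangeNorm_const_mul_le hφ hgr a ha hf) ?_
    have h1 := rangeNorm_const_mul_le hφ hgr a⁻¹ (inv_ne_zero ha) (hf.const_mul (a : ℝ≥0∞))
    have h2 : (a : ℝ≥0∞) * (a⁻¹ : ℝ≥0) = 1 := by
      rw [← ENNReal.coe_mul, mul_inv_cancel₀ ha, ENNReal.coe_one]
    have h3 : (fun x => ((a⁻¹ : ℝ≥0) : ℝ≥0∞) * ((a : ℝ≥0∞) * f x)) = f := by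
      ext x
      rw [← mul_assoc, mul_comm ((a⁻¹ : ℝ≥0) : ℝ≥0∞), h2, one_mul]
    rw [h3] at h1
    refine (mul_le_mul_right h1 (a : ℝ≥0∞)).trans_eq ?_
    rw [← mul_assoc, h2, one_mul]

theorem rangeNorm_add_le {φ : ℝ → ℝ} (hφ : QuasiConcave φ) (hgr : Growth φ) {f g : ℝ → ℝ≥0∞}
    (hf : AEMeasurable f μ) (hg : AEMeasurable g μ) :
    rangeNorm hφ (fun x => f x + g x) ≤ rangeNorm hφ f + rangeNorm hφ g := by
  rw [rangeNorm_eq hφ hgr hf, rangeNorm_eq hφ hgr hg, iInf_subtype', iInf_subtype',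
    ENNReal.iInf_add]
  refine le_iInf fun ⟨G, hG⟩ => ?_
  rw [ENNReal.add_iInf]
  refine le_iInf fun ⟨K, hK⟩ => ?_
  refine (rangeNorm_le hgr (hf.add hg) (G := fun x => G x + K x)
    ⟨hG.1.add hK.1, fun t ht => ?_⟩).trans (lintegral_add_left hG.1.measurable _).le
  rw [avgInt_add hG.1.measurable hK.1.measurable]
  exact (lintegral_rearr_add_le hf hg t).trans (add_le_add (hG.2 t ht) (hK.2 t ht))

/-- Absolute continuity of the integral; this is the smallness near 0 that the correction needs. -/
theorem tendsto_lintegral_rearr_zero {f : ℝ → ℝ≥0∞} (h : ∫⁻ s in Ioc 0 1, rearr f s < ∞) :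
    Tendsto (fun t => ∫⁻ s in Ioc 0 t, rearr f s) (𝓝[>] 0) (𝓝 0) := by
  have h1 : Tendsto (fun t => ∫⁻ s in Ioc 0 t, rearr f s ∂volume.restrict (Ioc 0 1))
      (𝓝[>] 0) (𝓝 0) := by
    refine tendsto_setLIntegral_zero h.ne ?_
    refine tendsto_of_tendsto_of_tendsto_of_le_of_le tendsto_const_nhds
      (h := fun t : ℝ => ENNReal.ofReal t) ?_ (fun _ => zero_le) fun t => ?_
    · simpa using (ENNReal.continuous_ofReal.tendsto 0).mono_left nhdsWithin_le_nhds
    · exact (Measure.restrict_apply_le _ _).trans (by simp)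
  refine h1.congr' ?_
  filter_upwards [Ioo_mem_nhdsGT one_pos] with t ht
  rw [Measure.restrict_restrict measurableSet_Ioc,
    inter_eq_left.2 (Ioc_subset_Ioc_right ht.2.le)]

theorem rangeNorm_iSup {φ : ℝ → ℝ} (hφ : QuasiConcave φ) (hgr : Growth φ) {f : ℕ → ℝ → ℝ≥0∞}
    (hf : ∀ n, AEMeasurable (f n) μ) (hmono : ∀ᵐ x ∂μ, Monotone fun n => f n x) :
    rangeNorm hφ (fun x => ⨆ n, f n x) = ⨆ n, rangeNorm hφ (f n) := by
  have hF : AEMeasurable (fun x => ⨆ n, f n x) μ := AEMeasurable.iSup hf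
  apply le_antisymm
  swap
  · exact iSup_le fun n => rangeNorm_mono hgr (hf n) hF fun t ht =>
      lintegral_mono fun s => rearr_mono (.of_forall fun x => le_iSup (fun n => f n x) n) s
  refine ENNReal.le_of_forall_pos_le_add fun ε hε hfin => ?_
  set M₀ := ⨆ n, rangeNorm hφ (f n) with hM₀
  have hε2 : (ε / 2 : ℝ≥0∞) ≠ 0 := by simpa using hε.ne'
  have hε2t : (ε / 2 : ℝ≥0∞) ≠ ∞ := ENNReal.div_ne_top (by simp) (by simp)
  set M := M₀ + ε / 2 with hM
  have hMtop : M ≠ ∞ := ENNReal.add_ne_top.2 ⟨hfin.ne, hε2t⟩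
  choose G hG hGn using fun n => exists_dominates hgr (hf n) (c := M)
    ((le_iSup (fun n => rangeNorm hφ (f n)) n).trans_lt (ENNReal.lt_add_right hfin.ne hε2))
  have hmono' : ∀ t, Monotone fun n => ∫⁻ s in Ioc 0 t, rearr (f n) s := fun t m n hmn =>
    lintegral_mono fun s => rearr_mono (hmono.mono fun x hx => hx hmn) s
  obtain ⟨K, hK, hKM, hle⟩ := hφ.exists_limit hgr (fun n => (hG n).1) hMtop
    (fun n => (hGn n).le) hmono' fun n t ht => (hG n).2 t ht
  have hsup : ∀ t, ⨆ n, ∫⁻ s in Ioc 0 t, rearr (f n) s =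
      ∫⁻ s in Ioc 0 t, rearr (fun x => ⨆ n, f n x) s := fun t => by
    simp_rw [rearr_iSup hmono]
    exact (lintegral_iSup (fun n => rearr_measurable _) fun m n hmn s =>
      rearr_mono (hmono.mono fun x hx => hx hmn) s).symm
  have hKtop : hφ.nrm K ≠ ∞ := (hKM.trans_lt (lt_top_iff_ne_top.2 hMtop)).ne
  have hle' : ∀ t, 0 < t → ∫⁻ s in Ioc 0 t, rearr (fun x => ⨆ n, f n x) s ≤
      ENNReal.ofReal (critConst φ) * (M - hφ.nrm K) + avgInt K t := by
    intro t ht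
    have h1 := hle t ht
    rw [hsup] at h1
    -- Cancelling the finite term with the norm of K leaves the deficit in terms of N = M − ‖K‖.
    have h2 : ENNReal.ofReal (critConst φ) * M = ENNReal.ofReal (critConst φ) * (M - hφ.nrm K) +
        ENNReal.ofReal (critConst φ) * hφ.nrm K := by
      rw [← mul_add, tsub_add_cancel_of_le hKM]
    rw [h2, add_right_comm] at h1
    exact (ENNReal.add_le_add_iff_right
      (ENNReal.mul_ne_top ENNReal.ofReal_ne_top hKtop)).1 h1
  have hNtop : M - hφ.nrm K ≠ ∞ := ENNReal.sub_ne_top hMtop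
  have h1fin : ∫⁻ s in Ioc 0 1, rearr (fun x => ⨆ n, f n x) s < ∞ :=
    (hle' 1 one_pos).trans_lt (ENNReal.add_lt_top.2
      ⟨ENNReal.mul_lt_top ENNReal.ofReal_lt_top (lt_top_iff_ne_top.2 hNtop),
        hφ.avgInt_lt_top hgr hK (lt_top_iff_ne_top.2 hKtop) one_pos⟩)
  obtain ⟨k, hk, hkn, hkle⟩ := hφ.exists_correction hgr
    (h := fun t => ∫⁻ s in Ioc 0 t, rearr (fun x => ⨆ n, f n x) s)
    (fun a b hab => lintegral_mono_set (Ioc_subset_Ioc_right hab))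
    (tendsto_lintegral_rearr_zero h1fin) hNtop hε2t hε2 hle'
  refine (rangeNorm_le hgr hF (G := fun x => k x + K x) ⟨hk.add hK, fun t ht => ?_⟩).trans ?_
  · rw [avgInt_add hk.measurable hK.measurable]
    exact hkle t ht
  · refine (lintegral_add_left hk.measurable _).trans_le ?_
    refine (add_le_add_left hkn _).trans (le_of_eq ?_)
    -- One half of ε was spent on near-optimality of the G n, the other on the correction.
    change M - hφ.nrm K + ε / 2 + hφ.nrm K = M₀ + ε
    rw [add_right_comm, tsub_add_cancel_of_le hKM, hM, add_assoc, ENNReal.add_halves]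

theorem rangeNorm_indicator_lt_top {φ : ℝ → ℝ} (hφ : QuasiConcave φ) (hgr : Growth φ) {E : Set ℝ}
    (hE : MeasurableSet E) (hEfin : μ E < ∞) :
    rangeNorm hφ (E.indicator fun _ => 1) < ∞ := by
  set T := (μ E).toReal + 1 with hT
  have hT0 : 0 < T := by positivity
  have hET : μ E ≤ ENNReal.ofReal T := by
    rw [← ENNReal.ofReal_toReal hEfin.ne]
    exact ENNReal.ofReal_le_ofReal (by linarith)
  have hd := decr_indicator_Iio T
  refine (rangeNorm_le hgr ((measurable_const.indicator hE).aemeasurable)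
    (G := (Iio T).indicator 1) ⟨hd, fun t ht => ?_⟩).trans_lt ?_
  · refine setLIntegral_mono measurable_avg fun s hs => le_trans ?_ (le_avg hd.anti hs.1)
    by_cases h : s < T
    · rw [indicator_of_mem (show s ∈ Iio T from h), rearr_le_iff]
      refine le_of_eq_of_le (measure_eq_zero_iff_ae_notMem.2 (.of_forall fun x => ?_)) zero_le
      exact not_lt.2 (indicator_le_self E (fun _ => (1 : ℝ≥0∞)) x)
    · rw [indicator_of_notMem (show s ∉ Iio T from h), rearr_le_iff]
      refine (measure_mono fun x hx => ?_).trans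
        (hET.trans (ENNReal.ofReal_le_ofReal (not_lt.1 h)))
      exact mem_of_indicator_ne_zero (ne_of_gt
        (show 0 < E.indicator (fun _ => (1 : ℝ≥0∞)) x from hx))
  · rw [QuasiConcave.nrm, lintegral_indicator_one measurableSet_Iio, hφ.dφ_Iio hT0]
    exact ENNReal.ofReal_lt_top

theorem isRIBanachFunctionNorm_rangeNorm {φ : ℝ → ℝ} (hφ : QuasiConcave φ) (hgr : Growth φ) :
    IsRIBanachFunctionNorm (rangeNorm hφ) where
  eq_zero_iff _ hf := rangeNorm_eq_zero_iff hφ hgr hf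
  smul a _ hf := rangeNorm_const_mul hφ hgr a hf
  add_le _ _ hf hg := rangeNorm_add_le hφ hgr hf hg
  mono _ _ hf hg h := rangeNorm_mono hgr hf hg fun _ _ => lintegral_mono fun s => rearr_mono h s
  fatou _ hf hm := rangeNorm_iSup hφ hgr hf hm
  indicator_lt_top _ hE hfin := rangeNorm_indicator_lt_top hφ hgr hE hfin
  lintegral_le E _ hfin := by
    have hT0 : 0 < (μ E).toReal + 1 := by positivity
    obtain ⟨C, hC⟩ := exists_lintegral_rearr_le hφ hgr hT0
    refine ⟨C, fun f hf => (setLIntegral_le_lintegral_rearr hf ?_).trans (hC f hf)⟩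
    conv_lhs => rw [← ENNReal.ofReal_toReal hfin.ne]
    exact ENNReal.ofReal_le_ofReal (by linarith)
  rearrangement_invariant f g hf hg h := by
    have := rearr_eq_of_distr_eq h
    exact le_antisymm (rangeNorm_mono hgr hf hg fun _ _ => by rw [this])
      (rangeNorm_mono hgr hg hf fun _ _ => by rw [this])

/-! ### Boundedness of the Hardy operator -/

theorem aemeasurable_hardy {f : ℝ → ℝ} (hf : AEMeasurable f μ) : AEMeasurable (hardy f) μ := by
  set g := hf.mk f with hg
  have hgm : Measurable g := hf.measurable_mk
  have h1 : StronglyMeasurable fun t => ∫ r, {p : ℝ × ℝ | 0 < p.2 ∧ p.2 ≤ p.1}.indicator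
      (fun p => g p.2) (t, r) := by
    refine StronglyMeasurable.integral_prod_right (Measurable.stronglyMeasurable ?_)
    exact (hgm.comp measurable_snd).indicator ((measurableSet_lt measurable_const
      measurable_snd).inter (measurableSet_le measurable_snd measurable_fst))
  refine ⟨fun t => (1 / t) * ∫ r, {p : ℝ × ℝ | 0 < p.2 ∧ p.2 ≤ p.1}.indicator
      (fun p => g p.2) (t, r), (measurable_const.div measurable_id).mul h1.measurable,
    ae_mu_of_forall fun t ht => ?_⟩
  rw [hardy, intervalIntegral.integral_of_le ht.le]
  congr 1
  have h2 : (fun r => {p : ℝ × ℝ | 0 < p.2 ∧ p.2 ≤ p.1}.indicator (fun p => g p.2) (t, r)) =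
      (Ioc 0 t).indicator g := by
    ext r; simp only [indicator, mem_ofPred_eq, mem_Ioc]
  rw [h2, integral_indicator measurableSet_Ioc, ← restrict_mu_Ioc]
  exact integral_congr_ae (ae_restrict_of_ae hf.ae_eq_mk)

theorem hardyBounded_rangeNorm {φ : ℝ → ℝ} (hφ : QuasiConcave φ) (hgr : Growth φ) :
    HardyBounded hφ (rangeNorm hφ) := by
  refine ⟨1, fun f hf => ?_⟩
  rw [ENNReal.coe_one, one_mul]
  exact rangeNorm_le hgr (aemeasurable_hardy hf.1).enorm (dominates_hardy hf.1)

theorem functionSpace_rangeNorm {φ : ℝ → ℝ} (hφ : QuasiConcave φ) (hgr : Growth φ) :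
    functionSpace (rangeNorm hφ) = rangeSpace hφ := by
  ext f
  constructor
  · rintro ⟨hf, hfin⟩
    obtain ⟨G, hG, hGfin⟩ := exists_dominates hgr hf.enorm hfin
    exact ⟨mem_L1AddLinfty hf ((hG.2 1 one_pos).trans_lt
      (hφ.avgInt_lt_top hgr hG.1 hGfin one_pos)), _, hG.mem_majorants hGfin⟩
  · rintro ⟨h1, g, hg⟩
    have h1' := h1
    obtain ⟨a, b, ha, hb, hab⟩ := h1'
    have hf : AEMeasurable f μ :=
      (ha.1.aemeasurable.add hb.1.aemeasurable).congr hab.symm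
    exact ⟨hf, (rangeNorm_le hgr hf.enorm (dominates_of_mem_majorants hg)).trans_lt hg.2.1.2⟩

/-! ### Averaging over an interval contracts rearrangement invariant norms -/

/-- The rotation of the interval `(a, b]` by `c`, extended by the identity. -/
noncomputable def rotate (a b c x : ℝ) : ℝ :=
  if x ∈ Ioc a (b - c) then x + c else if x ∈ Ioc (b - c) b then x - (b - a - c) else x

theorem measurable_rotate (a b c : ℝ) : Measurable (rotate a b c) :=
  Measurable.ite measurableSet_Ioc (by fun_prop)
    (Measurable.ite measurableSet_Ioc (by fun_prop) measurable_id)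

theorem rotate_of_notMem {a b c x : ℝ} (hc : 0 ≤ c) (hcb : c ≤ b - a) (hx : x ∉ Ioc a b) :
    rotate a b c x = x := by
  rw [rotate, if_neg fun h => hx ⟨h.1, h.2.trans (by linarith)⟩,
    if_neg fun h => hx ⟨lt_of_le_of_lt (by linarith) h.1, h.2⟩]

theorem rotate_mem {a b c x : ℝ} (hc : 0 ≤ c) (hcb : c ≤ b - a) (hx : x ∈ Ioc a b) :
    rotate a b c x ∈ Ioc a b := by
  unfold rotate
  split_ifs with h1 h2
  · exact ⟨by linarith [h1.1], by linarith [h1.2]⟩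
  · exact ⟨by linarith [h2.1], by linarith [h2.2]⟩
  · exact hx

/-- The two pieces of (a,b] are translated onto complementary pieces; a ≥ 0 keeps everything inside
(0,∞). -/
theorem mu_rotate_preimage {a b c : ℝ} (ha : 0 ≤ a) (hc : 0 ≤ c) (hcb : c ≤ b - a) (A : Set ℝ) :
    μ (rotate a b c ⁻¹' A) = μ A := by
  have hsplit : ∀ X : Set ℝ, ∀ m, a ≤ m → m ≤ b → μ X = volume (X ∩ Ioc a m) +
      volume (X ∩ Ioc m b) + volume ((X ∩ Ioi 0) \ Ioc a b) := by
    intro X m h1 h2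
    rw [μ, Measure.restrict_apply' measurableSet_Ioi,
      ← measure_inter_add_sdiff (X ∩ Ioi 0) (measurableSet_Ioc (a := a) (b := b)),
      ← measure_inter_add_sdiff (X ∩ Ioi 0 ∩ Ioc a b) (measurableSet_Ioc (a := a) (b := m))]
    congr 3
    · ext x
      simp only [mem_inter_iff, mem_Ioi, mem_Ioc]
      exact ⟨fun h => ⟨h.1.1.1, h.2⟩, fun h => ⟨⟨⟨h.1, by linarith [h.2.1]⟩, h.2.1,
        by linarith [h.2.2]⟩, h.2⟩⟩
    · ext x
      simp only [mem_inter_iff, mem_Ioi, mem_Ioc, Set.mem_sdiff, not_and, not_le]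
      exact ⟨fun h => ⟨h.1.1.1, h.2 h.1.2.1, h.1.2.2⟩, fun h => ⟨⟨⟨h.1, by linarith [h.2.1]⟩,
        by linarith [h.2.1], h.2.2⟩, fun _ => h.2.1⟩⟩
  rw [hsplit _ (b - c) (by linarith) (by linarith), hsplit A (a + c) (by linarith) (by linarith)]
  have e1 : rotate a b c ⁻¹' A ∩ Ioc a (b - c) = (fun x => x + c) ⁻¹' (A ∩ Ioc (a + c) b) := by
    ext x
    simp only [mem_inter_iff, mem_preimage, mem_Ioc]
    constructor
    · rintro ⟨h1, h2⟩
      rw [rotate, if_pos (show x ∈ Ioc a (b - c) from h2)] at h1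
      exact ⟨h1, by linarith [h2.1], by linarith [h2.2]⟩
    · rintro ⟨h1, h2⟩
      have h3 : x ∈ Ioc a (b - c) := ⟨by linarith [h2.1], by linarith [h2.2]⟩
      exact ⟨by rwa [rotate, if_pos h3], h3⟩
  have e2 : rotate a b c ⁻¹' A ∩ Ioc (b - c) b =
      (fun x => x + -(b - a - c)) ⁻¹' (A ∩ Ioc a (a + c)) := by
    ext x
    simp only [mem_inter_iff, mem_preimage, mem_Ioc]
    constructor
    · rintro ⟨h1, h2⟩
      rw [rotate, if_neg fun h => absurd h.2 (not_le.2 h2.1),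
        if_pos (show x ∈ Ioc (b - c) b from h2)] at h1
      exact ⟨h1, by linarith [h2.1], by linarith [h2.2]⟩
    · rintro ⟨h1, h2⟩
      have h3 : x ∈ Ioc (b - c) b := ⟨by linarith [h2.1], by linarith [h2.2]⟩
      exact ⟨by rwa [rotate, if_neg fun h => absurd h.2 (not_le.2 h3.1), if_pos h3], h3⟩
  have e3 : (rotate a b c ⁻¹' A ∩ Ioi 0) \ Ioc a b = (A ∩ Ioi 0) \ Ioc a b := by
    ext x
    simp only [Set.mem_sdiff, mem_inter_iff, mem_preimage]
    constructor
    · rintro ⟨⟨h1, h2⟩, h3⟩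
      rw [rotate_of_notMem hc hcb h3] at h1
      exact ⟨⟨h1, h2⟩, h3⟩
    · rintro ⟨⟨h1, h2⟩, h3⟩
      exact ⟨⟨by rwa [rotate_of_notMem hc hcb h3], h2⟩, h3⟩
  rw [e1, e2, e3, measure_preimage_add_right, measure_preimage_add_right,
    add_comm (volume (A ∩ Ioc (a + c) b))]

theorem IsRIBanachFunctionNorm.sum_le {σ : (ℝ → ℝ≥0∞) → ℝ≥0∞} (hσ : IsRIBanachFunctionNorm σ)
    {f : ℕ → ℝ → ℝ≥0∞} (hf : ∀ n, AEMeasurable (f n) μ) (n : ℕ) :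
    σ (fun x => ∑ j ∈ Finset.range n, f j x) ≤ ∑ j ∈ Finset.range n, σ (f j) := by
  induction n with
  | zero =>
    simp only [Finset.range_zero, Finset.sum_empty]
    exact ((hσ.eq_zero_iff _ aemeasurable_const).2 (.of_forall fun _ => rfl)).le
  | succ n ih =>
    simp only [Finset.sum_range_succ]
    exact (hσ.add_le _ _ (Finset.aemeasurable_fun_sum _ fun j _ => hf j) (hf n)).trans
      (add_le_add_left ih _)

/-- The rotations of x form a δ-spaced cyclic orbit in (a,b], so every z outside the first cell has
an orbit point less than or at distance δ to its left. In the first cell the left neighbour may have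
wrapped around. -/
theorem exists_rotate_near {a b x z : ℝ} {n : ℕ} (hn : 0 < n) (hab : a < b)
    (hx : x ∈ Ioc a b) (hz : z ∈ Ioc (a + (b - a) / n) b) :
    ∃ j < n, z ∈ Ioc (rotate a b (j * ((b - a) / n)) x)
      (rotate a b (j * ((b - a) / n)) x + (b - a) / n) := by
  set δ := (b - a) / n with hδ
  have hn' : (0 : ℝ) < n := by exact_mod_cast hn
  have hδ0 : 0 < δ := div_pos (sub_pos.2 hab) hn'
  have hnδ : n * δ = b - a := by rw [hδ]; field_simp
  obtain ⟨hx1, hx2⟩ := hx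
  obtain ⟨hz1, hz2⟩ := hz
  have hceil : ∀ y, 0 < y → y ≤ b - a → ∃ j < n, (j : ℝ) * δ < y ∧ y ≤ j * δ + δ := by
    intro y hy hyb
    have h1 : 0 < ⌈y / δ⌉₊ := Nat.ceil_pos.2 (div_pos hy hδ0)
    obtain ⟨j, hj⟩ := Nat.exists_eq_succ_of_ne_zero h1.ne'
    have h2 := Nat.ceil_lt_add_one (div_pos hy hδ0).le
    have h3 := Nat.le_ceil (y / δ)
    rw [hj, Nat.succ_eq_add_one, Nat.cast_add, Nat.cast_one] at h2 h3
    have h4 : (j : ℝ) * δ < y := by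
      rw [← lt_div_iff₀ hδ0]; linarith
    refine ⟨j, ?_, h4, ?_⟩
    · have : (j : ℝ) * δ < n * δ := h4.trans_le (hyb.trans hnδ.ge)
      exact_mod_cast lt_of_mul_lt_mul_right this hδ0.le
    · rw [div_le_iff₀ hδ0] at h3; linarith
  rcases lt_or_ge x z with hxz | hzx
  · obtain ⟨j, hj, h1, h2⟩ := hceil (z - x) (by linarith) (by linarith)
    refine ⟨j, hj, ?_⟩
    have : rotate a b (j * δ) x = x + j * δ := if_pos ⟨hx1, by linarith⟩
    rw [this]
    exact ⟨by linarith, by linarith⟩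
  · obtain ⟨j, hj, h1, h2⟩ := hceil (z - x + (b - a)) (by linarith) (by linarith)
    refine ⟨j, hj, ?_⟩
    have : rotate a b (j * δ) x = x - (b - a - j * δ) := by
      rw [rotate, if_neg fun h => absurd h.2 (not_le.2 (by linarith)),
        if_pos ⟨by linarith, hx2⟩]
    rw [this]
    exact ⟨by linarith, by linarith⟩

theorem setLIntegral_le_sum_rotate {a b x : ℝ} {n : ℕ} (hn : 0 < n) (hab : a < b)
    (hx : x ∈ Ioc a b) {u : ℝ → ℝ≥0∞} (hu : AntitoneOn u (Ioc a b)) :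
    ∫⁻ z in Ioc (a + (b - a) / n) b, u z ≤
      ENNReal.ofReal ((b - a) / n) * ∑ j ∈ Finset.range n, u (rotate a b (j * ((b - a) / n)) x) := by
  set δ := (b - a) / n with hδ
  have hn' : (0 : ℝ) < n := by exact_mod_cast hn
  have hδ0 : 0 < δ := div_pos (sub_pos.2 hab) hn'
  have hnδ : n * δ = b - a := by rw [hδ]; field_simp
  have hmem : ∀ j ∈ Finset.range n, rotate a b (j * δ) x ∈ Ioc a b := fun j hj => by
    refine rotate_mem (by positivity) ?_ hx
    rw [← hnδ]
    exact mul_le_mul_of_nonneg_right (by exact_mod_cast (Finset.mem_range.1 hj).le) hδ0.le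
  set I : ℕ → Set ℝ := fun j =>
    Ioc (rotate a b (j * δ) x) (min (rotate a b (j * δ) x + δ) b) with hI
  calc ∫⁻ z in Ioc (a + δ) b, u z ≤ ∫⁻ z in ⋃ j : Fin n, I j, u z := by
        refine lintegral_mono_set fun z hz => ?_
        obtain ⟨j, hj, h1⟩ := exists_rotate_near hn hab hx hz
        exact mem_iUnion.2 ⟨⟨j, hj⟩, h1.1, le_min h1.2 hz.2⟩
    _ ≤ ∑ j ∈ Finset.range n, ∫⁻ z in I j, u z := by
        rw [Finset.sum_range, ← tsum_fintype (L := .unconditional _)]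
        exact lintegral_iUnion_le (fun j : Fin n => I j) u
    _ ≤ ∑ j ∈ Finset.range n, ENNReal.ofReal δ * u (rotate a b (j * δ) x) := by
        refine Finset.sum_le_sum fun j hj => ?_
        have h1 := hmem j hj
        calc ∫⁻ z in I j, u z ≤ ∫⁻ _ in I j, u (rotate a b (j * δ) x) :=
              setLIntegral_mono measurable_const fun z hz =>
                hu h1 ⟨h1.1.trans hz.1, hz.2.trans (min_le_right _ _)⟩ hz.1.le
          _ = u (rotate a b (j * δ) x) * volume (I j) := setLIntegral_const _ _
          _ ≤ u (rotate a b (j * δ) x) * ENNReal.ofReal δ := by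
              gcongr
              rw [hI, Real.volume_Ioc]
              exact ENNReal.ofReal_le_ofReal (by linarith [min_le_left (rotate a b (j * δ) x + δ) b])
          _ = _ := mul_comm _ _
    _ = _ := by rw [Finset.mul_sum]

/-- The integral over (a + δ, b] is at most a Riemann sum along an orbit, so the shortened mean is
dominated by the arithmetic mean of n rotated copies of u, each equimeasurable with u. The shortened
means increase to the full one, and the Fatou property concludes. -/
theorem IsRIBanachFunctionNorm.average_le {σ : (ℝ → ℝ≥0∞) → ℝ≥0∞}
    (hσ : IsRIBanachFunctionNorm σ) {a b : ℝ} (ha : 0 ≤ a) (hab : a < b) {u : ℝ → ℝ≥0∞}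
    (hum : Measurable u) (hu : AntitoneOn u (Ioc a b)) :
    σ ((Ioc a b).piecewise (fun _ => (ENNReal.ofReal (b - a))⁻¹ * ∫⁻ z in Ioc a b, u z) u) ≤
      σ u := by
  classical
  have hL : 0 < b - a := sub_pos.2 hab
  set m : ℕ → ℝ≥0∞ := fun k => (ENNReal.ofReal (b - a))⁻¹ *
    ∫⁻ z in Ioc (a + (b - a) / (k + 1 : ℕ)) b, u z with hm
  have hδmono : ∀ ⦃k l : ℕ⦄, k ≤ l → (b - a) / (l + 1 : ℕ) ≤ (b - a) / (k + 1 : ℕ) := by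
    intro k l hkl
    gcongr
  have hmmono : Monotone m := fun k l hkl =>
    mul_le_mul_right (lintegral_mono_set (Ioc_subset_Ioc_left (by linarith [hδmono hkl]))) _
  have hmsup : ⨆ k, m k = (ENNReal.ofReal (b - a))⁻¹ * ∫⁻ z in Ioc a b, u z := by
    rw [hm, ← ENNReal.mul_iSup]
    congr 1
    have hU : Ioc a b = ⋃ k : ℕ, Ioc (a + (b - a) / (k + 1 : ℕ)) b := by
      ext z
      simp only [mem_Ioc, mem_iUnion]
      constructor
      · rintro ⟨h1, h2⟩
        obtain ⟨k, hk⟩ := exists_nat_gt ((b - a) / (z - a))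
        refine ⟨k, ?_, h2⟩
        have h3 : 0 < z - a := sub_pos.2 h1
        have h4 : (b - a) / (k + 1 : ℕ) < z - a := by
          rw [div_lt_iff₀ (by positivity)]
          rw [div_lt_iff₀ h3] at hk
          push_cast
          nlinarith
        linarith
      · rintro ⟨k, h1, h2⟩
        have : 0 < (b - a) / (k + 1 : ℕ) := by positivity
        exact ⟨by linarith, h2⟩
    rw [hU]
    refine (setLIntegral_iUnion_of_directed _ (directed_of_isDirected_le fun k l hkl => ?_)).symm
    exact Ioc_subset_Ioc_left (by linarith [hδmono hkl])
  have hpw : (Ioc a b).piecewise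
      (fun _ => (ENNReal.ofReal (b - a))⁻¹ * ∫⁻ z in Ioc a b, u z) u =
      fun x => ⨆ k, (Ioc a b).piecewise (fun _ => m k) u x := by
    ext x
    by_cases hx : x ∈ Ioc a b
    · simp only [piecewise_eq_of_mem _ _ _ hx, hmsup]
    · simp only [piecewise_eq_of_notMem _ _ _ hx, ciSup_const]
  have hmeas : ∀ k, Measurable ((Ioc a b).piecewise (fun _ => m k) u) := fun k =>
    Measurable.piecewise measurableSet_Ioc measurable_const hum
  rw [hpw, hσ.fatou _ fun k => (hmeas k).aemeasurable]
  swap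
  · refine .of_forall fun x k l hkl => ?_
    by_cases hx : x ∈ Ioc a b
    · simp only [piecewise_eq_of_mem _ _ _ hx]; exact hmmono hkl
    · simp only [piecewise_eq_of_notMem _ _ _ hx, le_refl]
  refine iSup_le fun k => ?_
  set n := k + 1 with hn
  have hn0 : (0 : ℝ) < n := by rw [hn]; positivity
  set δ := (b - a) / n with hδ
  have hδ0 : 0 < δ := by positivity
  have hnδ : n * δ = b - a := by rw [hδ]; field_simp
  have hrot : ∀ j : ℕ, Measurable fun x => u (rotate a b (j * δ) x) := fun j =>
    hum.comp (measurable_rotate _ _ _)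
  have hjle : ∀ j ∈ Finset.range n, (j : ℝ) * δ ≤ b - a := fun j hj => by
    rw [← hnδ]
    exact mul_le_mul_of_nonneg_right (by exact_mod_cast (Finset.mem_range.1 hj).le) hδ0.le
  have hnn : ((n : ℝ≥0)⁻¹ : ℝ≥0) * (n : ℝ≥0∞) = 1 := by
    rw [← ENNReal.coe_natCast, ← ENNReal.coe_mul, inv_mul_cancel₀ (by simp [hn]), ENNReal.coe_one]
  have hpt : ∀ x, (Ioc a b).piecewise (fun _ => m k) u x ≤
      ((n : ℝ≥0)⁻¹ : ℝ≥0) * ∑ j ∈ Finset.range n, u (rotate a b (j * δ) x) := by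
    intro x
    by_cases hx : x ∈ Ioc a b
    · rw [piecewise_eq_of_mem _ _ _ hx]
      refine (mul_le_mul_right (setLIntegral_le_sum_rotate (Nat.succ_pos k) hab hx hu) _).trans ?_
      rw [← mul_assoc]
      refine mul_le_mul_left (le_of_eq ?_) _
      rw [← ENNReal.ofReal_inv_of_pos hL, ← ENNReal.ofReal_mul (by positivity)]
      rw [← ENNReal.ofReal_coe_nnreal]
      congr 1
      rw [NNReal.coe_inv, NNReal.coe_natCast, Nat.succ_eq_add_one, ← hn]
      field_simp
    · rw [piecewise_eq_of_notMem _ _ _ hx, Finset.sum_congr rfl fun j hj => by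
        rw [rotate_of_notMem (by positivity) (hjle j hj) hx], Finset.sum_const, Finset.card_range,
        nsmul_eq_mul, ← mul_assoc, hnn, one_mul]
  refine (hσ.mono _ _ (hmeas k).aemeasurable ?_ (.of_forall hpt)).trans ?_
  · exact ((Finset.measurable_fun_sum _ fun j _ => hrot j).const_mul _).aemeasurable
  rw [hσ.smul _ _ (Finset.measurable_fun_sum _ fun j _ => hrot j).aemeasurable]
  refine (mul_le_mul_right (hσ.sum_le (fun j => (hrot j).aemeasurable) n) _).trans ?_
  have hinv : ∀ j ∈ Finset.range n, σ (fun x => u (rotate a b (j * δ) x)) = σ u := fun j hj =>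
    hσ.rearrangement_invariant _ _ (hrot j).aemeasurable hum.aemeasurable fun s =>
      mu_rotate_preimage ha (by positivity) (hjle j hj) {x | s < u x}
  rw [Finset.sum_congr rfl hinv, Finset.sum_const, Finset.card_range, nsmul_eq_mul, ← mul_assoc,
    hnn, one_mul]

/-! ### The Hardy-Littlewood-Pólya principle -/

/-- Decreasing integrable functions on `(0, R]`, extended by zero. -/
structure IsProfile (R : ℝ) (u : ℝ → ℝ) : Prop where
  anti : AntitoneOn u (Ioi 0)
  nonneg : ∀ x, 0 ≤ u x
  zero : ∀ x, x ∉ Ioc 0 R → u x = 0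
  measurable : Measurable u
  integrable : Integrable u

theorem mul_sub_le_integral {u : ℝ → ℝ} (hu : Integrable u) {a b c : ℝ} (hab : a ≤ b)
    (h : ∀ x ∈ Ioo a b, c ≤ u x) : c * (b - a) ≤ ∫ x in a..b, u x := by
  have h1 := intervalIntegral.integral_mono_on_of_le_Ioo hab
    (f := fun _ => c) (g := u) intervalIntegrable_const hu.intervalIntegrable h
  rw [intervalIntegral.integral_const, smul_eq_mul] at h1
  linarith

theorem integral_le_mul_sub {u : ℝ → ℝ} (hu : Integrable u) {a b c : ℝ} (hab : a ≤ b)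
    (h : ∀ x ∈ Ioo a b, u x ≤ c) : ∫ x in a..b, u x ≤ c * (b - a) := by
  have h1 := intervalIntegral.integral_mono_on_of_le_Ioo hab
    (f := u) (g := fun _ => c) hu.intervalIntegrable intervalIntegrable_const h
  rw [intervalIntegral.integral_const, smul_eq_mul] at h1
  linarith

theorem integral_zero_add {u : ℝ → ℝ} (hu : Integrable u) (a b : ℝ) :
    (∫ x in (0 : ℝ)..a, u x) + ∫ x in a..b, u x = ∫ x in (0 : ℝ)..b, u x :=
  intervalIntegral.integral_add_adjacent_intervals hu.intervalIntegrable hu.intervalIntegrable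

theorem IsProfile.replace_le {σ : (ℝ → ℝ≥0∞) → ℝ≥0∞} (hσ : IsRIBanachFunctionNorm σ) {R : ℝ}
    {u : ℝ → ℝ} (hu : IsProfile R u) {a b β : ℝ} (ha : 0 ≤ a) (hab : a < b)
    (hmean : β * (b - a) ≤ ∫ x in a..b, u x) :
    σ (fun x => ENNReal.ofReal ((Ioc a b).piecewise (fun _ => β) u x)) ≤
      σ (fun x => ENNReal.ofReal (u x)) := by
  have hm : Measurable fun x => ENNReal.ofReal (u x) := hu.measurable.ennreal_ofReal
  refine le_trans (hσ.mono _ _ ?_ ?_ (.of_forall fun x => ?_))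
    (hσ.average_le ha hab hm fun x hx y hy hxy => ENNReal.ofReal_le_ofReal
      (hu.anti (ha.trans_lt hx.1) (ha.trans_lt hy.1) hxy))
  · exact (Measurable.piecewise measurableSet_Ioc measurable_const
      hu.measurable).ennreal_ofReal.aemeasurable
  · exact (Measurable.piecewise measurableSet_Ioc measurable_const hm).aemeasurable
  · by_cases hx : x ∈ Ioc a b
    · rw [piecewise_eq_of_mem _ _ _ hx, piecewise_eq_of_mem _ _ _ hx,
        ← ofReal_integral_eq_lintegral_ofReal hu.integrable.integrableOn
          (.of_forall fun x => hu.nonneg x), ← intervalIntegral.integral_of_le hab.le,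
        ← ENNReal.ofReal_inv_of_pos (sub_pos.2 hab),
        ← ENNReal.ofReal_mul (inv_nonneg.2 (sub_pos.2 hab).le)]
      refine ENNReal.ofReal_le_ofReal ?_
      rw [inv_mul_eq_div, le_div_iff₀ (sub_pos.2 hab)]
      exact hmean
    · rw [piecewise_eq_of_notMem _ _ _ hx, piecewise_eq_of_notMem _ _ _ hx]

/-- The ends are the infimum and supremum of the set where the primitive exceeds the line; only
continuity of the primitive is used. At b = R the primitive may still lie strictly above. -/
theorem IsProfile.exists_interval {R : ℝ} {u : ℝ → ℝ} (hu : IsProfile R u) {α β : ℝ} (hα : 0 ≤ α)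
    (hne : ∃ t ∈ Icc 0 R, α + β * t < ∫ x in (0 : ℝ)..t, u x) :
    ∃ a b, 0 ≤ a ∧ a < b ∧ b ≤ R ∧ ∫ x in (0 : ℝ)..a, u x = α + β * a ∧
      α + β * b ≤ ∫ x in (0 : ℝ)..b, u x ∧
      (b < R → ∫ x in (0 : ℝ)..b, u x = α + β * b) ∧
      ∀ t ∈ Icc 0 R, t ∉ Icc a b → ∫ x in (0 : ℝ)..t, u x ≤ α + β * t := by
  set D : ℝ → ℝ := fun t => (∫ x in (0 : ℝ)..t, u x) - (α + β * t) with hD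
  have hDc : Continuous D := by
    have := intervalIntegral.continuous_primitive (fun a b => hu.integrable.intervalIntegrable) 0
    exact this.sub (by fun_prop)
  have hD0 : D 0 ≤ 0 := by simp [hD, hα]
  set U : Set ℝ := {t | t ∈ Icc 0 R ∧ 0 < D t} with hU
  have hUne : U.Nonempty := by
    obtain ⟨t, ht, h⟩ := hne
    exact ⟨t, ht, by simp only [hD]; linarith⟩
  have hbb : BddBelow U := ⟨0, fun t ht => ht.1.1⟩
  have hba : BddAbove U := ⟨R, fun t ht => ht.1.2⟩
  have hclosed : closure U ⊆ {t | 0 ≤ D t} :=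
    closure_minimal (fun t ht => ht.2.le) (isClosed_le continuous_const hDc)
  have ha0 : 0 ≤ sInf U := le_csInf hUne fun t ht => ht.1.1
  have hbR : sSup U ≤ R := csSup_le hUne fun t ht => ht.1.2
  have hDa : 0 ≤ D (sInf U) := hclosed (csInf_mem_closure hUne hbb)
  have hDb : 0 ≤ D (sSup U) := hclosed (csSup_mem_closure hUne hba)
  have hleft : ∀ t ∈ U, ∃ s ∈ U, s < t := by
    intro t ht
    have ht0 : 0 < t := lt_of_le_of_ne ht.1.1 fun h => by
      have := ht.2; rw [← h] at this; linarith
    obtain ⟨s, h1, h2, h3⟩ := (((hDc.continuousAt.eventually_const_lt ht.2).filter_mono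
      nhdsWithin_le_nhds).and (Ioo_mem_nhdsLT ht0)).exists
    exact ⟨s, ⟨⟨h2.le, h3.le.trans ht.1.2⟩, h1⟩, h3⟩
  have haU : sInf U ∉ U := fun h => by
    obtain ⟨s, hs, hlt⟩ := hleft _ h
    exact absurd (csInf_le hbb hs) (not_le.2 hlt)
  have hab : sInf U < sSup U := by
    obtain ⟨t, ht⟩ := hUne
    obtain ⟨s, hs, hlt⟩ := hleft t ht
    exact lt_of_le_of_lt (csInf_le hbb hs) (hlt.trans_le (le_csSup hba ht))
  refine ⟨sInf U, sSup U, ha0, hab, hbR, ?_, ?_, fun hlt => ?_, fun t ht hnot => ?_⟩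
  · have h1 : D (sInf U) ≤ 0 := not_lt.1 fun h => haU ⟨⟨ha0, hab.le.trans hbR⟩, h⟩
    simp only [hD] at h1 hDa
    linarith
  · simp only [hD] at hDb
    linarith
  · have h1 : D (sSup U) ≤ 0 := by
      by_contra hpos
      obtain ⟨s, h1, h2, h3⟩ := (((hDc.continuousAt.eventually_const_lt
        (not_le.1 hpos)).filter_mono nhdsWithin_le_nhds).and (Ioo_mem_nhdsGT hlt)).exists
      exact absurd (le_csSup hba (show s ∈ U from ⟨⟨(ha0.trans hab.le).trans h2.le, h3.le⟩, h1⟩))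
        (not_le.2 h2)
    simp only [hD] at h1 hDb
    linarith
  · by_contra hpos
    have hmem : t ∈ U := ⟨ht, by simp only [hD]; linarith⟩
    exact hnot ⟨csInf_le hbb hmem, le_csSup hba hmem⟩

/-- Replacing u by the slope β between the two crossings turns the primitive into its minimum with
the line. The mean of u there is at least β, so averaging controls σ; concavity of the primitive
keeps the new function decreasing. -/
theorem IsProfile.exists_cut {σ : (ℝ → ℝ≥0∞) → ℝ≥0∞} (hσ : IsRIBanachFunctionNorm σ) {R : ℝ}
    {u : ℝ → ℝ} (hu : IsProfile R u) {α β : ℝ} (hα : 0 ≤ α) (hβ : 0 ≤ β) :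
    ∃ v, IsProfile R v ∧
      σ (fun x => ENNReal.ofReal (v x)) ≤ σ (fun x => ENNReal.ofReal (u x)) ∧
      ∀ t ∈ Icc 0 R, ∫ x in (0 : ℝ)..t, v x = min (∫ x in (0 : ℝ)..t, u x) (α + β * t) := by
  by_cases hne : ∃ t ∈ Icc 0 R, α + β * t < ∫ x in (0 : ℝ)..t, u x
  swap
  · push Not at hne
    exact ⟨u, hu, le_rfl, fun t ht => (min_eq_left (hne t ht)).symm⟩
  obtain ⟨a, b, ha, hab, hbR, hHa, hHb, hHb', hout⟩ := hu.exists_interval hα hne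
  have hint := hu.integrable
  have hadd := integral_zero_add hint
  have hmean : β * (b - a) ≤ ∫ x in a..b, u x := by linarith [hadd a b]
  have hleft : ∀ x, 0 < x → x ≤ a → β ≤ u x := fun x hx hxa => by
    have h1 := integral_le_mul_sub hint hab.le fun y hy => hu.anti hx
      (ha.trans_lt hy.1) (hxa.trans hy.1.le)
    exact le_of_mul_le_mul_right (hmean.trans h1) (sub_pos.2 hab)
  -- If b < R the mean over (a,b] is exactly β; otherwise u vanishes beyond b.
  have hright : ∀ x, b < x → u x ≤ β := fun x hx => by
    rcases lt_or_ge b R with h | h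
    · have h1 := mul_sub_le_integral hint hab.le fun y hy => hu.anti
        (ha.trans_lt hy.1) (show x ∈ Ioi 0 from (ha.trans_lt hab).trans hx) (hy.2.le.trans hx.le)
      have h2 : ∫ x in a..b, u x = β * (b - a) := by linarith [hadd a b, hHb' h]
      rw [h2] at h1
      exact le_of_mul_le_mul_right h1 (sub_pos.2 hab)
    · rw [hu.zero x fun hx' => absurd hx'.2 (not_le.2 (h.trans_lt hx))]
      exact hβ
  set v := (Ioc a b).piecewise (fun _ => β) u with hv
  have hvin : ∀ x ∈ Ioc a b, v x = β := fun x hx => piecewise_eq_of_mem _ _ _ hx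
  have hvout : ∀ x ∉ Ioc a b, v x = u x := fun x hx => piecewise_eq_of_notMem _ _ _ hx
  have hvint : Integrable v :=
    Integrable.piecewise measurableSet_Ioc (integrableOn_const (by simp)) hint.integrableOn
  have hvp : IsProfile R v := by
    refine ⟨fun x hx y hy hxy => ?_, fun x => ?_, fun x hx => ?_,
      Measurable.piecewise measurableSet_Ioc measurable_const hu.measurable, hvint⟩
    · by_cases h1 : x ∈ Ioc a b <;> by_cases h2 : y ∈ Ioc a b
      · rw [hvin x h1, hvin y h2]
      · rw [hvin x h1, hvout y h2]
        exact hright y (not_le.1 fun h => h2 ⟨h1.1.trans_le hxy, h⟩)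
      · rw [hvout x h1, hvin y h2]
        exact hleft x hx (not_lt.1 fun h => h1 ⟨h, hxy.trans h2.2⟩)
      · rw [hvout x h1, hvout y h2]
        exact hu.anti hx hy hxy
    · by_cases h1 : x ∈ Ioc a b
      · rw [hvin x h1]; exact hβ
      · rw [hvout x h1]; exact hu.nonneg x
    · rw [hvout x fun h => hx ⟨ha.trans_lt h.1, h.2.trans hbR⟩]
      exact hu.zero x hx
  have hva : ∀ t, 0 ≤ t → t ≤ a → ∫ x in (0 : ℝ)..t, v x = ∫ x in (0 : ℝ)..t, u x := by
    intro t ht hta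
    refine intervalIntegral.integral_congr_Ioo_of_le ht fun x hx => ?_
    exact hvout x fun h => absurd h.1 (not_lt.2 (hx.2.le.trans hta))
  have hvm : ∀ t, a ≤ t → t ≤ b → ∫ x in (0 : ℝ)..t, v x = α + β * t := by
    intro t hat htb
    have h1 : ∫ x in a..t, v x = β * (t - a) := by
      rw [intervalIntegral.integral_congr_Ioo_of_le hat (g := fun _ => β)
        fun x hx => hvin x ⟨hx.1, hx.2.le.trans htb⟩, intervalIntegral.integral_const, smul_eq_mul,
        mul_comm]
    rw [← integral_zero_add hvint a t, hva a ha le_rfl, h1, hHa]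
    ring
  refine ⟨v, hvp, hu.replace_le hσ ha hab hmean, fun t ht => ?_⟩
  rcases le_or_gt t a with hta | hta
  · rw [hva t ht.1 hta, min_eq_left]
    rcases hta.eq_or_lt with rfl | hta
    · exact hHa.le
    · exact hout t ht fun h => absurd h.1 (not_le.2 hta)
  rcases le_or_gt t b with htb | htb
  · rw [hvm t hta.le htb, min_eq_right]
    have hut : t ∈ Ioi 0 := ha.trans_lt hta
    -- The primitive lies above the line inside (a,b]: if u(t) ≥ β compare with the crossing at a,
    -- otherwise with the endpoint b.
    rcases le_total β (u t) with h | h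
    · have h1 := mul_sub_le_integral hint hta.le fun y hy =>
        h.trans (hu.anti (show y ∈ Ioi 0 from ha.trans_lt hy.1) hut hy.2.le)
      linarith [hadd a t]
    · have h1 := integral_le_mul_sub hint htb fun y hy =>
        (hu.anti hut (show y ∈ Ioi 0 from (mem_Ioi.1 hut).trans hy.1) hy.1.le).trans h
      linarith [hadd t b]
  · have hbR' : b < R := htb.trans_le ht.2
    have h1 : ∫ x in b..t, v x = ∫ x in b..t, u x :=
      intervalIntegral.integral_congr_Ioo_of_le htb.le fun x hx =>
        hvout x fun h => absurd h.2 (not_le.2 hx.1)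
    rw [← integral_zero_add hvint b t, hvm b hab.le le_rfl, h1, ← hHb' hbR', hadd b t, min_eq_left]
    exact hout t ht fun h => absurd h.2 (not_le.2 htb)

/-- Only two bounds on the new primitive are kept: it is below all the lines, and it is at least
anything below both the old primitive and the lines. -/
theorem IsProfile.exists_cut_finite {σ : (ℝ → ℝ≥0∞) → ℝ≥0∞} (hσ : IsRIBanachFunctionNorm σ)
    {R : ℝ} {u : ℝ → ℝ} (hu : IsProfile R u) {α β : ℕ → ℝ} (n : ℕ) (hα : ∀ i < n, 0 ≤ α i)
    (hβ : ∀ i < n, 0 ≤ β i) :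
    ∃ v, IsProfile R v ∧
      σ (fun x => ENNReal.ofReal (v x)) ≤ σ (fun x => ENNReal.ofReal (u x)) ∧
      ∀ t ∈ Icc 0 R, (∀ i < n, ∫ x in (0 : ℝ)..t, v x ≤ α i + β i * t) ∧
        ∀ y ≤ ∫ x in (0 : ℝ)..t, u x, (∀ i < n, y ≤ α i + β i * t) →
          y ≤ ∫ x in (0 : ℝ)..t, v x := by
  induction n with
  | zero => exact ⟨u, hu, le_rfl, fun t _ => ⟨fun i hi => absurd hi (Nat.not_lt_zero i),
      fun y hy _ => hy⟩⟩
  | succ n ih =>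
    obtain ⟨v, hv, hσv, h⟩ := ih (fun i hi => hα i (by omega)) fun i hi => hβ i (by omega)
    obtain ⟨w, hw, hσw, h'⟩ := hv.exists_cut hσ (hα n (by omega)) (hβ n (by omega))
    refine ⟨w, hw, hσw.trans hσv, fun t ht => ⟨fun i hi => ?_, fun y hy hy' => ?_⟩⟩
    · rw [h' t ht]
      rcases Nat.lt_succ_iff_lt_or_eq.1 hi with hi | rfl
      · exact (min_le_left _ _).trans ((h t ht).1 i hi)
      · exact min_le_right _ _
    · rw [h' t ht]
      exact le_min ((h t ht).2 y hy fun i hi => hy' i (by omega)) (hy' n (by omega))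

/-- The step function on `(0, N δ]` taking on each interval `(i δ, (i + 1) δ]` the value of `F` at
its right endpoint. -/
noncomputable def stepFun (F : ℝ → ℝ) (δ : ℝ) (N : ℕ) (x : ℝ) : ℝ :=
  if x ∈ Ioc 0 (N * δ) then F (⌈x / δ⌉₊ * δ) else 0

section stepFun

variable {F : ℝ → ℝ} {δ : ℝ} {N : ℕ}

theorem le_ceil_mul (hδ : 0 < δ) (x : ℝ) : x ≤ ⌈x / δ⌉₊ * δ :=
  (div_le_iff₀ hδ).1 (Nat.le_ceil _)

theorem stepFun_le (hF : AntitoneOn F (Ioi 0)) (hF0 : ∀ x, 0 ≤ F x) (hδ : 0 < δ) {i : ℕ} {x : ℝ}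
    (hx : i * δ < x) : stepFun F δ N x ≤ F ((i + 1 : ℕ) * δ) := by
  unfold stepFun
  split_ifs with h
  · have hi : i < ⌈x / δ⌉₊ := Nat.lt_ceil.2 ((lt_div_iff₀ hδ).2 hx)
    have h1 : ((i + 1 : ℕ) : ℝ) * δ ≤ ⌈x / δ⌉₊ * δ :=
      mul_le_mul_of_nonneg_right (by exact_mod_cast hi) hδ.le
    have h2 : 0 < ((i + 1 : ℕ) : ℝ) * δ := by positivity
    exact hF h2 (h2.trans_le h1) h1
  · exact hF0 _

theorem le_stepFun (hF : AntitoneOn F (Ioi 0)) (hδ : 0 < δ) {i : ℕ} (hi : i < N) {x : ℝ}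
    (hx0 : 0 < x) (hx : x ≤ (i + 1 : ℕ) * δ) : F ((i + 1 : ℕ) * δ) ≤ stepFun F δ N x := by
  have hmem : x ∈ Ioc 0 (N * δ) :=
    ⟨hx0, hx.trans (mul_le_mul_of_nonneg_right (by exact_mod_cast hi) hδ.le)⟩
  rw [stepFun, if_pos hmem]
  have h1 : ⌈x / δ⌉₊ ≤ i + 1 := Nat.ceil_le.2 ((div_le_iff₀ hδ).2 hx)
  have h2 : (⌈x / δ⌉₊ : ℝ) * δ ≤ (i + 1 : ℕ) * δ :=
    mul_le_mul_of_nonneg_right (by exact_mod_cast h1) hδ.le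
  have h3 : 0 < (⌈x / δ⌉₊ : ℝ) * δ := hx0.trans_le (le_ceil_mul hδ x)
  exact hF h3 (h3.trans_le h2) h2

theorem stepFun_le_self (hF : AntitoneOn F (Ioi 0)) (hF0 : ∀ x, 0 ≤ F x) (hδ : 0 < δ) {x : ℝ}
    (hx : 0 < x) : stepFun F δ N x ≤ F x := by
  unfold stepFun
  split_ifs
  · exact hF hx (hx.trans_le (le_ceil_mul hδ x)) (le_ceil_mul hδ x)
  · exact hF0 x

theorem isProfile_stepFun (hF : AntitoneOn F (Ioi 0)) (hF0 : ∀ x, 0 ≤ F x) (hFm : Measurable F)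
    (hδ : 0 < δ) : IsProfile (N * δ) (stepFun F δ N) := by
  have hm : Measurable (stepFun F δ N) := Measurable.ite measurableSet_Ioc
    (hFm.comp ((measurable_from_nat.comp (Nat.measurable_ceil.comp
      (measurable_id.div_const δ))).mul_const δ)) measurable_const
  have h0 : ∀ x, 0 ≤ stepFun F δ N x := fun x => by
    unfold stepFun; split_ifs
    · exact hF0 _
    · exact le_rfl
  have hz : ∀ x, x ∉ Ioc 0 (N * δ) → stepFun F δ N x = 0 := fun x hx => if_neg hx
  refine ⟨fun x hx y hy hxy => ?_, h0, hz, hm, ?_⟩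
  · by_cases hyN : y ∈ Ioc 0 (N * δ)
    · have hxN : x ∈ Ioc 0 (N * δ) := ⟨hx, hxy.trans hyN.2⟩
      rw [stepFun, stepFun, if_pos hxN, if_pos hyN]
      refine hF ((mem_Ioi.1 hx).trans_le (le_ceil_mul hδ x))
        ((mem_Ioi.1 hy).trans_le (le_ceil_mul hδ y)) ?_
      have : ⌈x / δ⌉₊ ≤ ⌈y / δ⌉₊ := Nat.ceil_mono (by gcongr)
      exact mul_le_mul_of_nonneg_right (by exact_mod_cast this) hδ.le
    · rw [hz y hyN]; exact h0 x
  · have hi : Integrable ((Ioc 0 (N * δ)).indicator fun _ => F ((0 + 1 : ℕ) * δ)) :=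
      (integrable_indicator_iff measurableSet_Ioc).2
        (integrableOn_const measure_Ioc_lt_top.ne)
    refine hi.mono' hm.aestronglyMeasurable (.of_forall fun x => ?_)
    rw [Real.norm_of_nonneg (h0 x)]
    by_cases hx : x ∈ Ioc 0 (N * δ)
    · rw [indicator_of_mem hx]
      exact stepFun_le hF hF0 hδ (by simpa using hx.1)
    · rw [indicator_of_notMem hx, hz x hx]

/-- The primitive of a decreasing step function is a concave polygon, lying under the lines that
extend its edges. Cutting u by these lines gives v whose primitive lies between the polygon and the
lines; on each cell this forces v to be at least the step value. -/
theorem IsRIBanachFunctionNorm.stepFun_le {σ : (ℝ → ℝ≥0∞) → ℝ≥0∞}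
    (hσ : IsRIBanachFunctionNorm σ) (hF : AntitoneOn F (Ioi 0)) (hF0 : ∀ x, 0 ≤ F x)
    (hFm : Measurable F) (hδ : 0 < δ) {u : ℝ → ℝ} (hu : IsProfile (N * δ) u)
    (hle : ∀ t ∈ Icc 0 (N * δ), ∫ x in (0 : ℝ)..t, stepFun F δ N x ≤ ∫ x in (0 : ℝ)..t, u x) :
    σ (fun x => ENNReal.ofReal (stepFun F δ N x)) ≤ σ (fun x => ENNReal.ofReal (u x)) := by
  have hp := isProfile_stepFun (N := N) hF hF0 hFm hδ
  set p := stepFun F δ N with hpdef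
  have hadd := integral_zero_add hp.integrable
  set c : ℕ → ℝ := fun i => F ((i + 1 : ℕ) * δ) with hc
  -- Intercept of the line through the i-th edge, whose slope is c i.
  set α : ℕ → ℝ := fun i => (∫ x in (0 : ℝ)..(i * δ), p x) - c i * (i * δ) with hα
  have hl : ∀ i < N, ∀ t, 0 ≤ t → ∫ x in (0 : ℝ)..t, p x ≤ α i + c i * t := by
    intro i hi t ht
    rcases le_total t (i * δ) with h | h
    · have h1 := mul_sub_le_integral (c := c i) hp.integrable h fun y hy =>
        le_stepFun (N := N) hF hδ hi (ht.trans_lt hy.1) (hy.2.le.trans (by push_cast; linarith))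
      simp only [hα]
      linarith [hadd t (i * δ)]
    · have h1 := integral_le_mul_sub (c := c i) hp.integrable h fun y hy =>
        HardyRange.stepFun_le (N := N) hF hF0 hδ hy.1
      simp only [hα]
      linarith [hadd (i * δ) t]
  have hα0 : ∀ i < N, 0 ≤ α i := fun i hi => by simpa using hl i hi 0 le_rfl
  obtain ⟨v, hv, hσv, hcut⟩ := hu.exists_cut_finite hσ N hα0 fun i _ => hF0 _
  refine le_trans (hσ.mono _ _ hp.measurable.ennreal_ofReal.aemeasurable
    hv.measurable.ennreal_ofReal.aemeasurable ?_) hσv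
  have hcount : (range fun i : ℕ => (i : ℝ) * δ).Countable := countable_range _
  -- Nodes are discarded so that x is strictly left of the right endpoint e of its cell and e − x
  -- can be divided out.
  have hae : ∀ᵐ x ∂μ, x ∉ range fun i : ℕ => (i : ℝ) * δ :=
    ae_restrict_of_ae (hcount.ae_notMem volume)
  filter_upwards [hae, ae_mu_of_forall (p := fun x => 0 < x) fun _ h => h] with x hx hx0
  refine ENNReal.ofReal_le_ofReal ?_
  by_cases hmem : x ∈ Ioc 0 (N * δ)
  swap
  · rw [hp.zero x hmem]; exact hv.nonneg x
  obtain ⟨i, hi⟩ := Nat.exists_eq_succ_of_ne_zero (Nat.ceil_pos.2 (div_pos hx0 hδ)).ne'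
  have hxi : i * δ < x := by
    have : i < ⌈x / δ⌉₊ := by omega
    exact (lt_div_iff₀ hδ).1 (Nat.lt_ceil.1 this)
  have hiN : i < N := by
    have := hxi.trans_le hmem.2
    exact_mod_cast lt_of_mul_lt_mul_right this hδ.le
  set e : ℝ := (i + 1 : ℕ) * δ with he
  have hxe : x < e := by
    refine lt_of_le_of_ne ?_ fun h => hx ⟨i + 1, h.symm⟩
    have := le_ceil_mul hδ x
    rwa [hi] at this
  have he0 : 0 < e := hx0.trans hxe
  have heN : e ≤ N * δ := mul_le_mul_of_nonneg_right (by exact_mod_cast hiN) hδ.le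
  have hie : (i : ℝ) * δ ≤ e := (hxi.trans hxe).le
  have h1 : c i * (e - i * δ) ≤ ∫ x in (i * δ)..e, p x :=
    mul_sub_le_integral hp.integrable hie fun y hy =>
      le_stepFun (N := N) hF hδ hiN (lt_of_le_of_lt (by positivity) hy.1) hy.2.le
  have h2 := (hcut e ⟨he0.le, heN⟩).2 _ (hle e ⟨he0.le, heN⟩) fun j hj => hl j hj e he0.le
  have h3 := (hcut x ⟨hx0.le, hmem.2⟩).1 i hiN
  have h4 := integral_le_mul_sub hv.integrable hxe.le fun y hy =>
    hv.anti hx0 (hx0.trans hy.1) hy.1.le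
  have h5 := integral_zero_add hv.integrable x e
  -- From x to e the primitive of v climbs from below the i-th line to at least its value at e, and
  -- it climbs at most by v(x)(e − x).
  have h6 : c i * (e - x) ≤ v x * (e - x) := by
    simp only [hα] at h3
    linarith [hadd (i * δ) e]
  exact (HardyRange.stepFun_le hF hF0 hδ hxi).trans
    (le_of_mul_le_mul_right h6 (sub_pos.2 hxe))

end stepFun

/-- The Hardy-Littlewood-Pólya principle for rearrangement invariant function norms. -/
theorem IsRIBanachFunctionNorm.le_of_lintegral_rearr_le {σ : (ℝ → ℝ≥0∞) → ℝ≥0∞}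
    (hσ : IsRIBanachFunctionNorm σ) {f w : ℝ → ℝ≥0∞} (hf : AEMeasurable f μ) (hwm : Measurable w)
    (hw : AntitoneOn w (Ioi 0)) (hfin : ∀ t, 0 < t → ∫⁻ s in Ioc 0 t, w s < ∞)
    (hle : ∀ t, 0 < t → ∫⁻ s in Ioc 0 t, rearr f s ≤ ∫⁻ s in Ioc 0 t, w s) : σ f ≤ σ w := by
  have hrfin : ∀ t, 0 < t → rearr f t < ∞ := fun t ht =>
    rearr_lt_top ht ((hle t ht).trans_lt (hfin t ht))
  set F : ℝ → ℝ := fun x => (rearr f x).toReal with hFdef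
  have hFof : ∀ x, 0 < x → ENNReal.ofReal (F x) = rearr f x := fun x hx =>
    ENNReal.ofReal_toReal (hrfin x hx).ne
  have hF : AntitoneOn F (Ioi 0) := fun x hx y _ hxy =>
    ENNReal.toReal_mono (hrfin x hx).ne (rearr_antitone f hxy)
  have hF0 : ∀ x, 0 ≤ F x := fun x => ENNReal.toReal_nonneg
  have hFm : Measurable F := (rearr_measurable f).ennreal_toReal
  -- Dyadic meshes are nested, which makes the step functions below f* increase.
  set δ : ℕ → ℝ := fun k => (2 ^ k)⁻¹ with hδdef
  have hδ : ∀ k, 0 < δ k := fun k => by positivity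
  have hNδ : ∀ k : ℕ, ((k * 2 ^ k : ℕ) : ℝ) * δ k = k := fun k => by
    simp only [hδdef]; push_cast; field_simp
  set p : ℕ → ℝ → ℝ := fun k => stepFun F (δ k) (k * 2 ^ k) with hp
  have hpp : ∀ k : ℕ, IsProfile k (p k) := fun k => by
    have := isProfile_stepFun (N := k * 2 ^ k) hF hF0 hFm (hδ k)
    rwa [hNδ] at this
  have hpx : ∀ (k : ℕ) x, x ∈ Ioc (0 : ℝ) k → p k x = F (⌈x / δ k⌉₊ * δ k) := fun k x hx => by
    simp only [hp, stepFun]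
    rw [hNδ, if_pos hx]
  have hpmono : ∀ x, Monotone fun k => p k x := by
    intro x
    refine monotone_nat_of_le_succ fun k => ?_
    by_cases hx : x ∈ Ioc (0 : ℝ) k
    · have hx' : x ∈ Ioc (0 : ℝ) (k + 1 : ℕ) := ⟨hx.1, hx.2.trans (by push_cast; linarith)⟩
      rw [hpx k x hx, hpx (k + 1) x hx']
      have h0 := hx.1.trans_le (le_ceil_mul (hδ (k + 1)) x)
      have h1 : (⌈x / δ (k + 1)⌉₊ : ℝ) * δ (k + 1) ≤ ⌈x / δ k⌉₊ * δ k := by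
        have h2 : δ k = 2 * δ (k + 1) := by simp only [hδdef, pow_succ]; field_simp
        have h3 : ⌈x / δ (k + 1)⌉₊ ≤ ⌈x / δ k⌉₊ * 2 := by
          refine Nat.ceil_le.2 ((div_le_iff₀ (hδ (k + 1))).2 ?_)
          have := le_ceil_mul (hδ k) x
          rw [h2] at this ⊢
          push_cast
          linarith
        rw [h2, ← mul_assoc]
        refine mul_le_mul_of_nonneg_right ?_ (hδ (k + 1)).le
        rw [h2] at h3
        exact_mod_cast h3
      exact hF h0 (h0.trans_le h1) h1
    · rw [(hpp k).zero x hx]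
      exact (hpp (k + 1)).nonneg x
  have hsup : ∀ x, 0 < x → ⨆ k, ENNReal.ofReal (p k x) = rearr f x := by
    intro x hx
    apply le_antisymm
    · refine iSup_le fun k => ?_
      rw [← hFof x hx]
      exact ENNReal.ofReal_le_ofReal (stepFun_le_self hF hF0 (hδ k) hx)
    · refine le_of_forall_lt fun s hs => ?_
      have hopen := (lowerSemicontinuous_iff_isOpen_preimage.1 (rearr_lowerSemicontinuous f)
        s).mem_nhds hs
      have hδlim : Tendsto δ atTop (𝓝 0) := by
        have := tendsto_pow_atTop_nhds_zero_of_lt_one (r := (2 : ℝ)⁻¹) (by norm_num) (by norm_num)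
        refine this.congr fun k => ?_
        simp [hδdef]
      -- The sampling nodes converge to x from the right, so lower semicontinuity of f* suffices for
      -- convergence of the steps.
      have hlim : Tendsto (fun k => (⌈x / δ k⌉₊ : ℝ) * δ k) atTop (𝓝 x) := by
        have h1 : Tendsto (fun k => x + δ k) atTop (𝓝 x) := by
          simpa using hδlim.const_add x
        refine tendsto_of_tendsto_of_tendsto_of_le_of_le tendsto_const_nhds h1
          (fun k => le_ceil_mul (hδ k) x) fun k => ?_
        have h2 := (Nat.ceil_lt_add_one (div_pos hx (hδ k)).le).le
        have h3 := mul_le_mul_of_nonneg_right h2 (hδ k).le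
        rwa [add_mul, one_mul, div_mul_cancel₀ _ (hδ k).ne'] at h3
      obtain ⟨k, h1, h2⟩ := ((hlim.eventually hopen).and
        (tendsto_natCast_atTop_atTop.eventually_ge_atTop x)).exists
      refine lt_of_lt_of_le ?_ (le_iSup (fun k => ENNReal.ofReal (p k x)) k)
      rw [hpx k x ⟨hx, h2⟩, hFof _ (hx.trans_le (le_ceil_mul (hδ k) x))]
      exact h1
  have hσf : σ f = ⨆ k, σ (fun x => ENNReal.ofReal (p k x)) := by
    have hpm : ∀ k, AEMeasurable (fun x => ENNReal.ofReal (p k x)) μ := fun k =>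
      (hpp k).measurable.ennreal_ofReal.aemeasurable
    rw [← hσ.fatou _ hpm (.of_forall fun x k l hkl => ENNReal.ofReal_le_ofReal (hpmono x hkl))]
    refine hσ.rearrangement_invariant _ _ hf (AEMeasurable.iSup hpm) fun s => ?_
    rw [← distr_rearr f]
    exact distr_congr (ae_mu_of_forall fun x hx => (hsup x hx).symm) s
  rw [hσf]
  refine iSup_le fun k => ?_
  set u : ℝ → ℝ := (Ioc (0 : ℝ) k).indicator fun x => (w x).toReal with hu
  have hwfin : ∀ x, 0 < x → w x < ∞ := fun x hx => lt_top_of_antitoneOn hw hx (hfin x hx)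
  have hup : IsProfile k u := by
    have h0 : ∀ x, 0 ≤ u x := fun x => indicator_nonneg (fun _ _ => ENNReal.toReal_nonneg) x
    have hm : Measurable u := hwm.ennreal_toReal.indicator measurableSet_Ioc
    refine ⟨fun x hx y hy hxy => ?_, h0, fun x hx => indicator_of_notMem hx _, hm, ?_⟩
    · by_cases hyk : y ∈ Ioc (0 : ℝ) k
      · rw [hu, indicator_of_mem hyk, indicator_of_mem (show x ∈ Ioc (0 : ℝ) k from
          ⟨hx, hxy.trans hyk.2⟩)]
        exact ENNReal.toReal_mono (hwfin x hx).ne (hw hx hy hxy)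
      · rw [hu, indicator_of_notMem hyk]
        exact h0 x
    · rw [hu, integrable_indicator_iff measurableSet_Ioc]
      refine integrable_toReal_of_lintegral_ne_top hwm.aemeasurable ?_
      rcases (Nat.cast_nonneg (α := ℝ) k).eq_or_lt with hk | hk
      · rw [← hk]; simp
      · exact (hfin k hk).ne
  have hub : ∀ x, 0 < x → ENNReal.ofReal (u x) ≤ w x := fun x hx => by
    by_cases hxk : x ∈ Ioc (0 : ℝ) k
    · rw [hu, indicator_of_mem hxk]; exact ENNReal.ofReal_toReal_le
    · rw [hu, indicator_of_notMem hxk]; simp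
  refine le_trans (hσ.stepFun_le hF hF0 hFm (hδ k) (by rwa [hNδ]) ?_)
    (hσ.mono _ _ hup.measurable.ennreal_ofReal.aemeasurable hwm.aemeasurable (ae_mu_of_forall hub))
  rw [hNδ]
  intro t ht
  rcases ht.1.eq_or_lt with rfl | ht0
  · simp
  have hconv : ∀ {q : ℝ → ℝ}, IsProfile k q → ENNReal.ofReal (∫ x in (0 : ℝ)..t, q x) =
      ∫⁻ x in Ioc 0 t, ENNReal.ofReal (q x) := fun hq => by
    rw [intervalIntegral.integral_of_le ht0.le]
    exact ofReal_integral_eq_lintegral_ofReal hq.integrable.integrableOn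
      (.of_forall fun x => hq.nonneg x)
  have hunn : 0 ≤ ∫ x in (0 : ℝ)..t, u x :=
    intervalIntegral.integral_nonneg ht0.le fun x _ => hup.nonneg x
  refine (ENNReal.ofReal_le_ofReal_iff hunn).1 ?_
  have h1 := hconv (hpp k)
  simp only [hp] at h1
  rw [h1, hconv hup]
  calc ∫⁻ x in Ioc 0 t, ENNReal.ofReal (stepFun F (δ k) (k * 2 ^ k) x)
      ≤ ∫⁻ x in Ioc 0 t, rearr f x := setLIntegral_mono (rearr_measurable f) fun x hx => by
        rw [← hFof x hx.1]
        exact ENNReal.ofReal_le_ofReal (stepFun_le_self hF hF0 (hδ k) hx.1)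
    _ ≤ ∫⁻ x in Ioc 0 t, w x := hle t ht0
    _ = ∫⁻ x in Ioc 0 t, ENNReal.ofReal (u x) := by
        refine setLIntegral_congr_fun measurableSet_Ioc fun x hx => ?_
        simp only [hu]
        rw [indicator_of_mem (show x ∈ Ioc (0 : ℝ) k from ⟨hx.1, hx.2.trans ht.2⟩),
          ENNReal.ofReal_toReal (hwfin x hx.1).ne]

/-! ### Minimality and equivalence of norms -/

/-- If G dominates f, the Hardy-Littlewood-Pólya principle gives σ(f) ≤ σ(SG), and boundedness of S
bounds this by C‖G‖; then take the infimum over G. -/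
theorem HardyBounded.exists_le_rangeNorm {φ : ℝ → ℝ} {hφ : QuasiConcave φ} (hgr : Growth φ)
    {σ : (ℝ → ℝ≥0∞) → ℝ≥0∞} (hσ : IsRIBanachFunctionNorm σ) (hb : HardyBounded hφ σ) :
    ∃ C : ℝ≥0, 0 < C ∧ ∀ f, AEMeasurable f μ → σ f ≤ C * rangeNorm hφ f := by
  obtain ⟨C, hC⟩ := hb
  refine ⟨C + 1, by positivity, fun f hf => ?_⟩
  rw [rangeNorm_eq hφ hgr hf, iInf_subtype', ENNReal.mul_iInf_of_ne (by simp) (by simp)]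
  refine le_iInf fun ⟨G, hG⟩ => ?_
  by_cases hfin : hφ.nrm G < ∞
  swap
  · rw [not_lt.1 hfin |> top_le_iff.1, ENNReal.mul_top (by simp)]
    exact le_top
  have hmem := (hG.mem_majorants (hφ := hφ) hfin).2.1
  have h1 : σ f ≤ σ (avg G) := hσ.le_of_lintegral_rearr_le hf measurable_avg
    (avg_antitoneOn hG.1.anti) (fun t ht => hφ.avgInt_lt_top hgr hG.1 hfin ht) hG.2
  have h2 : σ (avg G) ≤ σ (absFun (hardy fun x => (G x).toReal)) :=
    hσ.mono _ _ measurable_avg.aemeasurable (aemeasurable_hardy hmem.1).enorm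
      (ae_mu_of_forall fun x hx => (hφ.absFun_hardy_toReal hG.1 hfin hx).ge)
  refine h1.trans (h2.trans ((hC _ hmem).trans (mul_le_mul' ?_ (hφ.lorentzNorm_toReal_le hG.1))))
  exact_mod_cast le_self_add

theorem isMinimalRange_rangeNorm {φ : ℝ → ℝ} (hφ : QuasiConcave φ) (hgr : Growth φ) :
    IsMinimalRange hφ (rangeNorm hφ) where
  isRI := isRIBanachFunctionNorm_rangeNorm hφ hgr
  bounded := hardyBounded_rangeNorm hφ hgr
  minimal σ hσ hb f hf := by
    obtain ⟨C, _, hC⟩ := hb.exists_le_rangeNorm hgr hσ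
    exact ⟨hf.1, (hC _ hf.1.enorm).trans_lt (ENNReal.mul_lt_top ENNReal.coe_lt_top hf.2)⟩

/-! ### Necessity of the growth condition -/

theorem mul_log_le_of_le_one {t : ℝ} (ht : 0 < t) (h : t ≤ 1) :
    t * Real.log (1 + 1 / t) ≤ t * (1 + Real.log (1 / t)) := by
  refine mul_le_mul_of_nonneg_left ?_ ht.le
  have h1 : 1 ≤ 1 / t := (one_le_div ht).2 h
  have h2 : Real.log (1 + 1 / t) ≤ Real.log (2 * (1 / t)) :=
    Real.log_le_log (by positivity) (by linarith)
  rw [Real.log_mul two_ne_zero (by positivity)] at h2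
  linarith [Real.log_two_lt_d9]

theorem mul_log_le_one {t : ℝ} (ht : 0 < t) : t * Real.log (1 + 1 / t) ≤ 1 := by
  have h1 := Real.log_le_sub_one_of_pos (show 0 < 1 + 1 / t by positivity)
  calc t * Real.log (1 + 1 / t) ≤ t * (1 / t) :=
        mul_le_mul_of_nonneg_left (by linarith) ht.le
    _ = 1 := by field_simp

/-- Test S on the indicator of (0,t), t ≤ 1: its norm is at most φ(t), and ∫_0^1 of its average is
t(1 + log(1/t)), which local integrability controls. For t ≥ 1, t log(1 + 1/t) ≤ 1 ≤ φ(t)/φ(1). -/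
theorem HardyBounded.growth {φ : ℝ → ℝ} {hφ : QuasiConcave φ} {σ : (ℝ → ℝ≥0∞) → ℝ≥0∞}
    (hσ : IsRIBanachFunctionNorm σ) (hb : HardyBounded hφ σ) : Growth φ := by
  obtain ⟨C, hC⟩ := hb
  obtain ⟨K, hK⟩ := hσ.lintegral_le (Ioc 0 1) measurableSet_Ioc (by simp [mu_Ioc])
  have key : ∀ t, 0 < t → t ≤ 1 → t * (1 + Real.log (1 / t)) ≤ K * C * φ t := by
    intro t ht ht1
    have hd := decr_indicator_Iio t
    have hn : hφ.nrm ((Iio t).indicator 1) = ENNReal.ofReal (φ t) := by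
      rw [QuasiConcave.nrm, lintegral_indicator_one measurableSet_Iio, hφ.dφ_Iio ht]
    have hfin : hφ.nrm ((Iio t).indicator 1) < ∞ := by rw [hn]; exact ENNReal.ofReal_lt_top
    set g : ℝ → ℝ := fun x => ((Iio t).indicator (1 : ℝ → ℝ≥0∞) x).toReal with hg
    have hmem : g ∈ lorentzSpace hφ := ⟨hd.measurable.ennreal_toReal.aemeasurable,
      (hφ.lorentzNorm_toReal_le hd).trans_lt hfin⟩
    have h1 : ∫⁻ x in Ioc 0 1, absFun (hardy g) x ∂μ =
        ENNReal.ofReal (t * (1 + Real.log (1 / t))) := by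
      rw [← logMeasure_Iio_of_ge ht ht1, logMeasure_Iio, avgInt, restrict_mu_Ioc]
      exact setLIntegral_congr_fun measurableSet_Ioc fun x hx =>
        hφ.absFun_hardy_toReal hd hfin hx.1
    have h2 := hK _ (aemeasurable_hardy hmem.1).enorm
    have h3 : ENNReal.ofReal (t * (1 + Real.log (1 / t))) ≤ ENNReal.ofReal (K * C * φ t) := by
      rw [← h1]
      refine h2.trans ((mul_le_mul_right (hC g hmem) _).trans ?_)
      rw [ENNReal.ofReal_mul (by positivity), ENNReal.ofReal_mul (by positivity),
        ENNReal.ofReal_coe_nnreal, ENNReal.ofReal_coe_nnreal, mul_assoc, ← hn]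
      gcongr
      exact hφ.lorentzNorm_toReal_le hd
    have := hφ.pos t ht
    exact (ENNReal.ofReal_le_ofReal_iff (by positivity)).1 h3
  have hp1 := hφ.pos 1 one_pos
  have hA : 0 < K * C + 1 / φ 1 := by positivity
  refine ⟨(K * C + 1 / φ 1)⁻¹, inv_pos.2 hA, fun t ht => ?_⟩
  rw [inv_mul_le_iff₀ hA]
  have hpt := hφ.pos t ht
  rcases le_total t 1 with h | h
  · refine (mul_log_le_of_le_one ht h).trans ((key t ht h).trans ?_)
    exact mul_le_mul_of_nonneg_right (le_add_of_nonneg_right (by positivity)) hpt.le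
  · calc t * Real.log (1 + 1 / t) ≤ 1 := mul_log_le_one ht
      _ = 1 / φ 1 * φ 1 := by field_simp
      _ ≤ (K * C + 1 / φ 1) * φ t := by
        refine mul_le_mul ?_ (hφ.mono (mem_Ioi.2 one_pos) ht h) hp1.le hA.le
        exact le_add_of_nonneg_left (by positivity)

/-! ### Boundedness of inclusions -/

theorem IsRIBanachFunctionNorm.ae_lt_top {ρ : (ℝ → ℝ≥0∞) → ℝ≥0∞} (hρ : IsRIBanachFunctionNorm ρ)
    {f : ℝ → ℝ≥0∞} (hf : AEMeasurable f μ) (h : ρ f < ∞) : ∀ᵐ x ∂μ, f x < ∞ := by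
  have h1 : ∀ n : ℕ, ∀ᵐ x ∂μ, x ∈ Ioc (0 : ℝ) n → f x < ∞ := fun n => by
    obtain ⟨C, hC⟩ := hρ.lintegral_le (Ioc 0 (n : ℝ)) measurableSet_Ioc (by simp [mu_Ioc])
    refine (ae_restrict_iff' measurableSet_Ioc).1 (ae_lt_top' hf.restrict ?_)
    exact ((hC f hf).trans_lt (ENNReal.mul_lt_top ENNReal.coe_lt_top h)).ne
  filter_upwards [ae_all_iff.2 h1, ae_mu_of_forall (p := fun x => 0 < x) fun _ h => h] with x hx hx0
  obtain ⟨n, hn⟩ := exists_nat_ge x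
  exact hx n ⟨hx0, hn⟩

theorem IsRIBanachFunctionNorm.tsum_le {ρ : (ℝ → ℝ≥0∞) → ℝ≥0∞} (hρ : IsRIBanachFunctionNorm ρ)
    {f : ℕ → ℝ → ℝ≥0∞} (hf : ∀ n, AEMeasurable (f n) μ) :
    ρ (fun x => ∑' n, f n x) ≤ ∑' n, ρ (f n) := by
  have h1 : (fun x => ∑' n, f n x) = fun x => ⨆ n, ∑ j ∈ Finset.range n, f j x := by
    ext x; exact ENNReal.tsum_eq_iSup_nat
  rw [h1, hρ.fatou _ (fun n => Finset.aemeasurable_fun_sum _ fun j _ => hf j)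
    (.of_forall fun x m n hmn => Finset.sum_le_sum_of_subset (Finset.range_subset_range.2 hmn))]
  exact iSup_le fun n => (hρ.sum_le hf n).trans (ENNReal.sum_le_tsum _)

/-- An inclusion between two rearrangement invariant Banach function spaces is bounded. -/
theorem IsRIBanachFunctionNorm.exists_le_of_subset {ρ σ : (ℝ → ℝ≥0∞) → ℝ≥0∞}
    (hρ : IsRIBanachFunctionNorm ρ) (hσ : IsRIBanachFunctionNorm σ)
    (hsub : functionSpace ρ ⊆ functionSpace σ) :
    ∃ C : ℝ≥0, 0 < C ∧ ∀ f, AEMeasurable f μ → σ f ≤ C * ρ f := by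
  by_contra hcon
  push Not at hcon
  choose f hf hlt using fun n : ℕ => hcon ((n + 1) * 2 ^ (n + 1)) (by positivity)
  have hfin : ∀ n, ρ (f n) ≠ ∞ := fun n h => by
    have := hlt n
    rw [h, ENNReal.mul_top (by simp)] at this
    exact absurd this (not_lt.2 le_top)
  have hne : ∀ n, ρ (f n) ≠ 0 := fun n h => by
    have h1 := (hσ.eq_zero_iff _ (hf n)).2 ((hρ.eq_zero_iff _ (hf n)).1 h)
    have := hlt n
    rw [h1] at this
    exact absurd this (not_lt.2 zero_le)
  set r : ℕ → ℝ≥0 := fun n => (ρ (f n)).toNNReal⁻¹ * 2⁻¹ ^ (n + 1) with hr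
  have hrρ : ∀ n, (r n : ℝ≥0∞) * ρ (f n) = 2⁻¹ ^ (n + 1) := fun n => by
    have h0 : (ρ (f n)).toNNReal ≠ 0 := by simp [ENNReal.toNNReal_eq_zero_iff, hne n, hfin n]
    have h1 : ρ (f n) = ((ρ (f n)).toNNReal : ℝ≥0∞) := (ENNReal.coe_toNNReal (hfin n)).symm
    conv_lhs => rw [h1]
    rw [hr, ← ENNReal.coe_mul]
    have h2 : (ρ (f n)).toNNReal⁻¹ * 2⁻¹ ^ (n + 1) * (ρ (f n)).toNNReal = 2⁻¹ ^ (n + 1) := by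
      field_simp
    rw [h2]
    push_cast
    rfl
  -- Gliding hump: the n-th term has ρ-norm 2^{-(n+1)}, so ρ(g) is finite, while its σ-norm exceeds
  -- n + 1.
  set g : ℝ → ℝ≥0∞ := fun x => ∑' n, (r n : ℝ≥0∞) * f n x with hg
  have hgm : AEMeasurable g μ := AEMeasurable.tsum fun n => (hf n).const_mul _
  have hgρ : ρ g < ∞ := by
    refine (hρ.tsum_le fun n => (hf n).const_mul _).trans_lt ?_
    simp_rw [fun n => hρ.smul (r n) (f n) (hf n), hrρ]
    rw [ENNReal.tsum_geometric_add_one, ENNReal.one_sub_inv_two, inv_inv]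
    exact ENNReal.mul_lt_top (by simp) (by simp)
  have hae : g =ᵐ[μ] absFun fun x => (g x).toReal := by
    filter_upwards [hρ.ae_lt_top hgm hgρ] with x hx
    rw [absFun, Real.enorm_of_nonneg ENNReal.toReal_nonneg, ENNReal.ofReal_toReal hx.ne]
  have hmem : (fun x => (g x).toReal) ∈ functionSpace ρ := by
    refine ⟨hgm.ennreal_toReal, lt_of_le_of_lt ?_ hgρ⟩
    exact hρ.mono _ _ hgm.ennreal_toReal.enorm hgm (hae.mono fun x hx => hx.ge)
  have hgσ : σ g < ∞ := lt_of_le_of_lt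
    (hσ.mono _ _ hgm hgm.ennreal_toReal.enorm (hae.mono fun x hx => hx.le)) (hsub hmem).2
  have hbig : ∀ n : ℕ, (n : ℝ≥0∞) ≤ σ g := fun n => by
    calc (n : ℝ≥0∞) ≤ n + 1 := le_self_add
      _ = (n + 1) * 2 ^ (n + 1) * 2⁻¹ ^ (n + 1) := by
        rw [mul_assoc, ← mul_pow, ENNReal.mul_inv_cancel (by simp) (by simp), one_pow, mul_one]
      _ = r n * ((((n + 1) * 2 ^ (n + 1) : ℝ≥0) : ℝ≥0∞) * ρ (f n)) := by
        rw [← hrρ n]; push_cast; ring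
      _ ≤ r n * σ (f n) := mul_le_mul_right (hlt n).le _
      _ = σ (fun x => (r n : ℝ≥0∞) * f n x) := (hσ.smul _ _ (hf n)).symm
      _ ≤ σ g := hσ.mono _ _ ((hf n).const_mul _) hgm
          (.of_forall fun x => ENNReal.le_tsum (f := fun n => (r n : ℝ≥0∞) * f n x) n)
  obtain ⟨n, hn⟩ := ENNReal.exists_nat_gt hgσ.ne
  exact absurd (hbig n) (not_le.2 hn)

end HardyRange

theorem theorem2p3 (φ : ℝ → ℝ) (hφ : HardyRange.QuasiConcave φ) :
    -- the growth condition holds if and only if the minimal range space exists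
    ((∃ C : ℝ, 0 < C ∧ ∀ t : ℝ, 0 < t → C * (t * Real.log (1 + 1 / t)) ≤ φ t) ↔
      ∃ ρ, HardyRange.IsMinimalRange hφ ρ) ∧
    -- in this case, the explicit space with its norm is a minimal range space ...
    ((∃ ρ, HardyRange.IsMinimalRange hφ ρ) →
      HardyRange.IsMinimalRange hφ (HardyRange.rangeNorm hφ) ∧
      HardyRange.functionSpace (HardyRange.rangeNorm hφ) = HardyRange.rangeSpace hφ) ∧
    -- ... and every minimal range space coincides with it, with equivalent norms
    (∀ ρ, HardyRange.IsMinimalRange hφ ρ →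
      HardyRange.functionSpace ρ = HardyRange.rangeSpace hφ ∧
      ∃ c C : NNReal, 0 < c ∧ 0 < C ∧ ∀ f ∈ HardyRange.rangeSpace hφ,
        c * HardyRange.rangeNorm hφ (HardyRange.absFun f) ≤ ρ (HardyRange.absFun f) ∧
        ρ (HardyRange.absFun f) ≤ C * HardyRange.rangeNorm hφ (HardyRange.absFun f)) := by
  have hgrowth : ∀ ρ, HardyRange.IsMinimalRange hφ ρ → HardyRange.Growth φ := fun ρ hρ =>
    hρ.bounded.growth hρ.isRI
  refine ⟨⟨fun hgr => ⟨_, HardyRange.isMinimalRange_rangeNorm hφ hgr⟩,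
    fun ⟨ρ, hρ⟩ => hgrowth ρ hρ⟩, fun ⟨ρ, hρ⟩ => ?_, fun ρ hρ => ?_⟩
  · have hgr := hgrowth ρ hρ
    exact ⟨HardyRange.isMinimalRange_rangeNorm hφ hgr, HardyRange.functionSpace_rangeNorm hφ hgr⟩
  · have hgr := hgrowth ρ hρ
    have hmin := HardyRange.isMinimalRange_rangeNorm hφ hgr
    have hsub := hρ.minimal _ hmin.isRI hmin.bounded
    have hspace := HardyRange.functionSpace_rangeNorm hφ hgr
    refine ⟨hspace ▸ hsub.antisymm (hmin.minimal _ hρ.isRI hρ.bounded), ?_⟩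
    obtain ⟨C, hC0, hC⟩ := hρ.bounded.exists_le_rangeNorm hgr hρ.isRI
    -- The lower estimate has no direct proof from the definition of the range norm; it comes from
    -- the set inclusion given by minimality of ρ.
    obtain ⟨K, hK0, hK⟩ := hρ.isRI.exists_le_of_subset hmin.isRI hsub
    refine ⟨K⁻¹, C, inv_pos.2 hK0, hC0, fun f hf => ?_⟩
    rw [← hspace] at hf
    refine ⟨?_, hC _ hf.1.enorm⟩
    calc ((K⁻¹ : ℝ≥0) : ℝ≥0∞) * HardyRange.rangeNorm hφ (HardyRange.absFun f)
        ≤ (K⁻¹ : ℝ≥0) * (K * ρ (HardyRange.absFun f)) := mul_le_mul_right (hK _ hf.1.enorm) _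
      _ = ρ (HardyRange.absFun f) := by
        rw [← mul_assoc, ← ENNReal.coe_mul, inv_mul_cancel₀ hK0.ne', ENNReal.coe_one, one_mul]
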